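/- Let $(a,q^2,\Lambda)$ be the characteristic triplet of a real Lévy process: $a,q\in\mathbb{R}$ and $\Lambda$ is a Lévy measure on $\mathbb{R}$, i.e. $\Lambda(\{0\})=0$ and $\int (1\wedge x^2)\,\Lambda(\mathrm{d}x)<\infty$. Its characteristic exponent is $$\Psi(\lambda)= i a\lambda-\frac{q^2}{2}\lambda^2+\int_{\mathbb{R}}\big(e^{i\lambda x}-1-i\lambda x\,\mathbf{1}_{\{|x|\le 1\}}\big)\Lambda(\mathrm{d}x).$$ Put $\beta(\Lambda)=\inf\{r>0:\int_{[-1,1]}|x|^r\Lambda(\mathrm{d}x)<\infty\}$, and $\beta=\beta(\Lambda)$ if $q=0$, $\beta=2$ if $q\neq 0$. A parameter $p\in(0,1)$ is called admissible for the triplet if $p\beta<1$; fix such a $p$. Let $Y(t)=\mathbf{1}_{\{U\le t\}}Z_{p(\ln t-\ln U)}$, $t\in[0,1]$, be the Yule–Simon process with parameter $1/p$, where $U$ is uniform on $[0,1]$ and $Z$ is an independent standard Yule process (pure birth process started from $1$, with birth rate $k$ in state $k$). A noise reinforced Lévy process (NRLP) with characteristics $(a,q^2,\Lambda,p)$ is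 a real process $\hat\xi=(\hat\xi_s)_{s\ge 0}$ on a probability space with $\hat\xi_0=0$ a.s. and, for all $0<s_1<\dots<s_k\le t$ and $\lambda_1,\dots,\lambda_k\in\mathbb{R}$, $$\mathbb{E}\Big[\exp\Big\{i\sum_{j=1}^k\lambda_j\hat\xi_{s_j}\Big\}\Big]=\exp\Big\{(1-p)\,t\,\mathbb{E}\Big[\Psi\Big(\sum_{j=1}^k\lambda_jY(s_j/t)\Big)\Big]\Big\}.$$ \textbf{Theorem.} Every NRLP $\hat\xi$ with characteristics $(a,q^2,\Lambda,p)$ has an rcll modification, that is, there is a process with right-continuous paths with left limits that coincides with $\hat\xi$ almost surely at each fixed time. Moreover, if for each $\varepsilon\in(0,1)$ the process $\hat\xi^{(3)}_{0,\varepsilon}$ is (an rcll modification of) a NRLP with characteristics $(0,0,\mathbf{1}_{\{|x|<\varepsilon\}}\Lambda,p)$, then for every $t>0$ $$\lim_{\varepsilon\downarrow 0}\mathbb{E}\Big[\sup_{s\le t}\big|\hat\xi^{(3)}_{0,\varepsilon}(s)\big|\Big]=0.$$ -/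

import Mathlib

open MeasureTheory ProbabilityTheory Filter Topology
open scoped NNReal ENNReal

noncomputable section

/-- A Lévy measure on the real line. -/
structure IsLevyMeasure (Λ : Measure ℝ) : Prop where
  zero : Λ {0} = 0
  integrable : ∫⁻ x, ENNReal.ofReal (min 1 (x ^ 2)) ∂Λ < ∞

/-- The characteristic exponent with triplet `(a, q², Λ)`, by the Lévy-Khintchine formula. -/
def levyExponent (a q : ℝ) (Λ : Measure ℝ) (l : ℝ) : ℂ :=
  Complex.I * a * l - (q : ℂ) ^ 2 / 2 * (l : ℂ) ^ 2
    + ∫ x : ℝ, (Complex.exp (Complex.I * l * x) - 1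
        - Set.indicator {y : ℝ | |y| ≤ 1} (fun y : ℝ => Complex.I * y * l) x) ∂Λ

/-- The Blumenthal-Getoor (upper) index of a Lévy measure. -/
def bgIndexMeasure (Λ : Measure ℝ) : ℝ :=
  sInf {r : ℝ | 0 < r ∧ ∫⁻ x in Set.Icc (-1 : ℝ) 1, ENNReal.ofReal (|x| ^ r) ∂Λ < ∞}

open Classical in
/-- The Blumenthal-Getoor index of a Lévy process with triplet `(a, q², Λ)`. -/
def bgIndex (q : ℝ) (Λ : Measure ℝ) : ℝ :=
  if q = 0 then bgIndexMeasure Λ else 2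

/-- The memory parameter `p` is admissible for a triplet `(a, q², Λ)`. -/
structure IsAdmissible (q : ℝ) (Λ : Measure ℝ) (p : ℝ) : Prop where
  pos : 0 < p
  lt_one : p < 1
  mul_lt_one : p * bgIndex q Λ < 1

/-- The standard Yule process (pure birth process with rate `k` in state `k`, started from `1`)
as a function of the time `s` and of its holding times: `τ k` is the time spent in state `k + 1`,
so that `∑ k ∈ range (n + 1), τ k` is the time of the `(n + 1)`-th birth. -/
def yuleProcess (s : ℝ) (τ : ℕ → ℝ) : ℕ :=
  1 + Set.ncard {n : ℕ | ∑ k ∈ Finset.range (n + 1), τ k ≤ s}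

/-- The joint law of the holding times of the standard Yule process: independent, and
exponential with rate `k + 1` in state `k + 1`. -/
def yuleHoldingLaw : Measure (ℕ → ℝ) :=
  Measure.infinitePi fun k : ℕ => expMeasure ((k : ℝ) + 1)

/-- The joint law of a uniform random variable on `[0,1]` and of independent Yule holding times. -/
def yuleSimonLaw : Measure (ℝ × (ℕ → ℝ)) :=
  (volume.restrict (Set.Icc (0 : ℝ) 1)).prod yuleHoldingLaw

/-- The sample space `ℝ × (ℕ → ℝ)` of the Yule-Simon process indeed carries
a probability measure. -/
instance isProbabilityMeasure_yuleSimonLaw : IsProbabilityMeasure yuleSimonLaw := by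
  have h1 : ∀ k : ℕ, IsProbabilityMeasure (expMeasure ((k : ℝ) + 1)) := fun k =>
    isProbabilityMeasure_expMeasure (by positivity)
  have h2 : IsProbabilityMeasure yuleHoldingLaw := by
    unfold yuleHoldingLaw
    infer_instance
  have h3 : IsProbabilityMeasure (volume.restrict (Set.Icc (0 : ℝ) 1)) :=
    ⟨by simp⟩
  unfold yuleSimonLaw
  infer_instance

open Classical in
/-- The Yule-Simon process with parameter `1 / p` at time `t ∈ [0,1]`, on the probability space
`(ℝ × (ℕ → ℝ), yuleSimonLaw)`:
`Y(t) = 1_{U ≤ t} Z_{p (ln t - ln U)}` with `U` uniform and `Z` an independent Yule process. -/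
def yuleSimon (p t : ℝ) (ω : ℝ × (ℕ → ℝ)) : ℝ :=
  if ω.1 ≤ t then (yuleProcess (p * (Real.log t - Real.log ω.1)) ω.2 : ℝ) else 0

/-- `X` is, under `μ`, a noise reinforced Lévy process with characteristics `(a, q², Λ, p)`:
a process started from `0` with the prescribed finite-dimensional distributions. -/
structure IsNRLP {Ω : Type*} [MeasurableSpace Ω] (a q : ℝ) (Λ : Measure ℝ) (p : ℝ)
    (X : ℝ≥0 → Ω → ℝ) (μ : Measure Ω) : Prop where
  measurable : ∀ t, Measurable (X t)
  zero : ∀ᵐ ω ∂μ, X 0 ω = 0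
  fdd : ∀ (k : ℕ) (s : Fin k → ℝ≥0) (l : Fin k → ℝ) (t : ℝ≥0),
    StrictMono s → (∀ i, 0 < s i) → (∀ i, s i ≤ t) →
    ∫ ω, Complex.exp (Complex.I * ((∑ i, l i * X (s i) ω : ℝ) : ℂ)) ∂μ
      = Complex.exp ((1 - (p : ℂ)) * (t : ℝ) *
          ∫ y, levyExponent a q Λ (∑ i, l i * yuleSimon p ((s i : ℝ) / t) y) ∂yuleSimonLaw)

/-- Right-continuous functions with left limits on `[0, ∞)`. -/
def IsRcll (f : ℝ≥0 → ℝ) : Prop :=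
  ∀ t, ContinuousWithinAt f (Set.Ici t) t ∧ ∃ y, Tendsto f (𝓝[<] t) (𝓝 y)

end

/-!
A noise reinforced Lévy process has neither independent increments nor a martingale structure that
is visible in its finite-dimensional laws, so the regularity of its paths is derived directly from
these laws by a chaining argument along the dyadic rationals. It rests on two facts about the
Yule–Simon process `Y`.

* The jump times of `Y` have uniform intensity (`yuleSimonLaw_birthTime_mem_le`): given the holding
  times, the `n`-th jump time `U exp (Tₙ / p)` is uniform on an interval. Consequently, for
  `r < 1/p`, the moment of order `r` of an increment of `Y` over an interval of length `h` is `O(h)`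
  (`exists_lintegral_yuleSimon_sub_rpow_le`).
* It is unlikely that `Y` increases on both of two adjacent intervals of length of order `h`: the
  moment of order `r`, restricted to this event, is `O(h ^ (1 + d))` for some `d > 0`
  (`exists_lintegral_yuleSimon_two_increments_le`).

Admissibility of `p` provides an exponent `r ∈ (1, 1/p)`, `r ≤ 2`, with `|Ψ(l)| ≤ K (|l| ^ r + 1)`.
If `A` and `B` are adjacent increments of the process `X`, then
`E[(1 - exp (ilA)) (1 - exp (imB))]` is a second order difference of exponentials, controlled by the
product of the exponents of `A` and `B` and by an interaction term which only involves the event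
that both increments of `Y` are nonzero. By a two-dimensional truncation inequality
(`measureReal_two_abs_gt_le`), this gives a Chentsov-type bound on the probability that `A` and `B`
are both large (`HasYuleSimonExponent.measureReal_two_increments_le`).

Call level `n` bad if on some dyadic interval of `(0, 1]` of that level both half-increments
exceed `x θ ^ n`, or if the value at time `2 ^ (-n)` does. For `θ < 1` close to `1` the probabilities
of these events decay geometrically (`measureReal_badEvent_le`). Where they fail from some level on,
a deterministic bisection shows that each dyadic interval has a cut such that the path stays close
to its left endpoint value before the cut and to its right endpoint value after it
(`IsChainable.exists_cut`). Hence

* almost surely there are one-sided limits along the dyadic rationals, and the right limits form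
  the rcll modification, by stochastic continuity (`exists_rcll_modification`);
* if no bad event occurs, the supremum over `(0, 1]` is at most a constant multiple of `x`. For the
  jumps smaller than `ε` the bound on the exponent is `K |l| ^ r` with a constant `K` that tends
  to `0` with `ε` (`exponentBound_levyExponent_restrict`), and as `r > 1`, the tail of the supremum
  is integrable in `x` with an integral that tends to `0` (`exists_lintegral_dyadicSup_le`).

Other time horizons reduce to `(0, 1]`, because a change of the time unit multiplies the exponent
by a constant (`IsNRLP.hasYuleSimonExponent`).
-/

/-! ### Birth times of the Yule–Simon process -/

/-- The time of the `n`-th birth of a Yule process with holding times `τ`, the process being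
started at time `0`. -/
noncomputable def holdingSum (n : ℕ) (τ : ℕ → ℝ) : ℝ := ∑ k ∈ Finset.range n, τ k

/-- The `n`-th jump time `U exp (Tₙ / p)` of the Yule–Simon process, `Tₙ` being the time of the
`n`-th birth of the underlying Yule process; the jump of index `0` occurs at time `U`. -/
noncomputable def birthTime (p : ℝ) (n : ℕ) (ω : ℝ × (ℕ → ℝ)) : ℝ :=
  ω.1 * Real.exp (holdingSum n ω.2 / p)

/-- The probability `E[exp (-Tₙ / p)]` that the `n`-th jump of the Yule–Simon process occurs
before time `1`. -/
noncomputable def birthWeight (p : ℝ) (n : ℕ) : ℝ≥0∞ :=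
  ∏ k ∈ Finset.range n, ENNReal.ofReal (((k : ℝ) + 1) / ((k : ℝ) + 1 + p⁻¹))

instance isProbabilityMeasure_expMeasure_natCast (k : ℕ) :
    IsProbabilityMeasure (expMeasure ((k : ℝ) + 1)) :=
  isProbabilityMeasure_expMeasure (by positivity)

instance isProbabilityMeasure_yuleHoldingLaw : IsProbabilityMeasure yuleHoldingLaw := by
  unfold yuleHoldingLaw
  infer_instance

lemma lintegral_exp_neg_expMeasure {r a : ℝ} (hr : 0 < r) (ha : 0 ≤ a) :
    ∫⁻ x, ENNReal.ofReal (Real.exp (-(a * x))) ∂(expMeasure r) = ENNReal.ofReal (r / (r + a)) := by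
  have h1 : expMeasure r = volume.withDensity (exponentialPDF r) := rfl
  have hmeas : ∀ r, Measurable (exponentialPDF r) := fun r =>
    (measurable_exponentialPDFReal r).ennreal_ofReal
  rw [h1, lintegral_withDensity_eq_lintegral_mul _ (hmeas r) (by fun_prop)]
  have h2 : ∀ x, (exponentialPDF r * fun x => ENNReal.ofReal (Real.exp (-(a * x)))) x
      = ENNReal.ofReal (r / (r + a)) * exponentialPDF (r + a) x := by
    intro x
    simp only [Pi.mul_apply, exponentialPDF_eq]
    split_ifs with hx
    · rw [← ENNReal.ofReal_mul (by positivity), ← ENNReal.ofReal_mul (by positivity)]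
      congr 1
      have h3 : Real.exp (-((r + a) * x)) = Real.exp (-(r * x)) * Real.exp (-(a * x)) := by
        rw [← Real.exp_add]
        ring_nf
      rw [h3]
      have : r + a ≠ 0 := by positivity
      field_simp
    · simp
  simp_rw [h2]
  rw [lintegral_const_mul _ (hmeas (r + a)),
    lintegral_exponentialPDF_eq_one (by positivity), mul_one]

lemma expMeasure_Iio_zero (r : ℝ) : expMeasure r (Set.Iio 0) = 0 := by
  have h1 : expMeasure r = volume.withDensity (exponentialPDF r) := rfl
  rw [h1, withDensity_apply _ measurableSet_Iio, lintegral_exponentialPDF_of_nonpos le_rfl]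

lemma expMeasure_Iic_le {r : ℝ} (hr : 0 < r) {x : ℝ} (hx : 0 ≤ x) :
    expMeasure r (Set.Iic x) ≤ ENNReal.ofReal (r * x) := by
  have h1 : expMeasure r = volume.withDensity (exponentialPDF r) := rfl
  rw [h1, withDensity_apply _ measurableSet_Iic, lintegral_exponentialPDF_eq_antiDeriv hr, if_pos hx]
  apply ENNReal.ofReal_le_ofReal
  linarith [Real.add_one_le_exp (-(r * x))]

lemma measurable_holdingSum (n : ℕ) : Measurable (holdingSum n) := by
  unfold holdingSum
  fun_prop

lemma measurable_birthTime (p : ℝ) (n : ℕ) : Measurable (birthTime p n) := by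
  have := measurable_holdingSum n
  unfold birthTime
  fun_prop

/-- Independence of the holding times, in the form needed to decide at once when the `n`-th
jump occurs and how long the next holding time is. -/
lemma lintegral_exp_holdingSum {p : ℝ} (hp : 0 < p) (n : ℕ) {B : Set ℝ} (hB : MeasurableSet B) :
    ∫⁻ τ, ENNReal.ofReal (Real.exp (-(holdingSum n τ / p))) * B.indicator 1 (τ n) ∂yuleHoldingLaw
      = birthWeight p n * expMeasure ((n : ℝ) + 1) B := by
  classical
  let f : ℕ → ℝ → ℝ≥0∞ := fun k x =>
    if k = n then B.indicator 1 x else ENNReal.ofReal (Real.exp (-(p⁻¹ * x)))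
  have hf : ∀ k, Measurable (f k) := by
    intro k
    by_cases hk : k = n
    · simp only [f, hk, if_true]
      exact measurable_one.indicator hB
    · simp only [f, hk, if_false]
      fun_prop
  have h1 : ∀ τ : ℕ → ℝ, ENNReal.ofReal (Real.exp (-(holdingSum n τ / p))) * B.indicator 1 (τ n)
      = ∏ k ∈ Finset.range (n + 1), f k (τ k) := by
    intro τ
    rw [Finset.prod_range_succ]
    congr 1
    · have h2 : ∀ k ∈ Finset.range n, f k (τ k) = ENNReal.ofReal (Real.exp (-(p⁻¹ * τ k))) := by
        intro k hk
        simp [f, (Finset.mem_range.1 hk).ne]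
      rw [Finset.prod_congr rfl h2, ← ENNReal.ofReal_prod_of_nonneg (fun _ _ => (Real.exp_pos _).le),
        ← Real.exp_sum, Finset.sum_neg_distrib, ← Finset.mul_sum, holdingSum, div_eq_inv_mul]
    · simp [f]
  simp_rw [h1]
  have hind := iIndepFun_infinitePi (P := fun k : ℕ => expMeasure ((k : ℝ) + 1)) (X := f) hf
  have h3 := lintegral_prod_eq_prod_lintegral_of_indepFun (Finset.range (n + 1))
    (fun k (τ : ℕ → ℝ) => f k (τ k)) hind (fun k => (hf k).comp (measurable_pi_apply k))
  have h4 : ∀ k, ∫⁻ τ : ℕ → ℝ, f k (τ k) ∂yuleHoldingLaw = ∫⁻ x, f k x ∂(expMeasure ((k : ℝ) + 1)) :=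
    fun k => (measurePreserving_eval_infinitePi
      (fun k : ℕ => expMeasure ((k : ℝ) + 1)) k).lintegral_comp (hf k)
  unfold yuleHoldingLaw at h4 ⊢
  rw [h3]
  simp_rw [h4]
  rw [Finset.prod_range_succ, birthWeight]
  congr 1
  · refine Finset.prod_congr rfl fun k hk => ?_
    simp only [f, (Finset.mem_range.1 hk).ne, if_false]
    rw [lintegral_exp_neg_expMeasure (by positivity) (by positivity)]
  · simp only [f, if_true]
    exact lintegral_indicator_one hB

/-- The jump times of the Yule–Simon process have uniform intensity: conditionally on the holding
times, the `n`-th jump time is uniform on an interval of length `exp (Tₙ / p)`. -/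
lemma yuleSimonLaw_birthTime_mem_le {p : ℝ} (hp : 0 < p) (n : ℕ) {B : Set ℝ} (hB : MeasurableSet B)
    (s t : ℝ) :
    yuleSimonLaw {ω | s < birthTime p n ω ∧ birthTime p n ω ≤ t ∧ ω.2 n ∈ B}
      ≤ ENNReal.ofReal (t - s) * (birthWeight p n * expMeasure ((n : ℝ) + 1) B) := by
  have hm := measurable_birthTime p n
  have hmeas : MeasurableSet {ω : ℝ × (ℕ → ℝ) | s < birthTime p n ω ∧ birthTime p n ω ≤ t ∧ ω.2 n ∈ B} :=
    (measurableSet_lt measurable_const hm).inter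
      ((measurableSet_le hm measurable_const).inter
        (hB.preimage ((measurable_pi_apply n).comp measurable_snd)))
  have hH := measurable_holdingSum n
  have hind : Measurable fun τ : ℕ → ℝ => B.indicator (1 : ℝ → ℝ≥0∞) (τ n) :=
    (measurable_one.indicator hB).comp (measurable_pi_apply n)
  rw [← lintegral_exp_holdingSum hp n hB, ← lintegral_const_mul _ (by fun_prop), yuleSimonLaw,
    Measure.prod_apply_symm hmeas]
  refine lintegral_mono fun τ => ?_
  by_cases hτ : τ n ∈ B
  · simp only [hτ, Set.indicator_of_mem, Pi.one_apply, mul_one]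
    refine (Measure.restrict_apply_le _ _).trans ?_
    have hsub : (fun x : ℝ => (x, τ)) ⁻¹' {ω | s < birthTime p n ω ∧ birthTime p n ω ≤ t ∧ ω.2 n ∈ B}
        ⊆ Set.Ioc (s * Real.exp (-(holdingSum n τ / p))) (t * Real.exp (-(holdingSum n τ / p))) := by
      intro x hx
      simp only [birthTime, Set.mem_preimage, Set.mem_ofPred_eq] at hx
      obtain ⟨h1, h2, -⟩ := hx
      rw [Real.exp_neg]
      constructor
      · rwa [← div_eq_mul_inv, div_lt_iff₀ (Real.exp_pos _)]
      · rwa [← div_eq_mul_inv, le_div_iff₀ (Real.exp_pos _)]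
    refine (measure_mono hsub).trans ?_
    rw [Real.volume_Ioc, ← sub_mul, ENNReal.ofReal_mul' (Real.exp_pos _).le]
  · have hempty : (fun x : ℝ => (x, τ)) ⁻¹' {ω | s < birthTime p n ω ∧ birthTime p n ω ≤ t ∧ ω.2 n ∈ B}
        = ∅ := by
      ext x
      simp [hτ]
    rw [hempty]
    simp

/-- The jump probabilities decay like `n ^ (-1/p)`, since `∏ k / (k + ρ)` does so as `n ^ (-ρ)`. -/
lemma birthWeight_le {p : ℝ} (hp : 0 < p) (n : ℕ) :
    birthWeight p n ≤ ENNReal.ofReal (((1 + p⁻¹) / ((n : ℝ) + 1 + p⁻¹)) ^ p⁻¹) := by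
  set ρ := p⁻¹ with hρ
  have hρ0 : 0 < ρ := inv_pos.2 hp
  induction n with
  | zero => simp [birthWeight, div_self (by positivity : (1 + ρ) ≠ 0)]
  | succ n ih =>
    have hc : (0 : ℝ) < n + 1 + ρ := by positivity
    rw [birthWeight, Finset.prod_range_succ]
    refine (mul_le_mul' ih le_rfl).trans ?_
    rw [← hρ, ← ENNReal.ofReal_mul (by positivity)]
    apply ENNReal.ofReal_le_ofReal
    have h1 : (1 + ((n : ℝ) + 1 + ρ)⁻¹) ^ ρ ≤ Real.exp (ρ * ((n : ℝ) + 1 + ρ)⁻¹) := by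
      rw [mul_comm, Real.exp_mul]
      exact Real.rpow_le_rpow (by positivity) (by linarith [Real.add_one_le_exp ((n : ℝ) + 1 + ρ)⁻¹])
        hρ0.le
    have h2 : ((n : ℝ) + 1) / (n + 1 + ρ) ≤ Real.exp (-(ρ * ((n : ℝ) + 1 + ρ)⁻¹)) := by
      have : ((n : ℝ) + 1) / (n + 1 + ρ) = -(ρ * ((n : ℝ) + 1 + ρ)⁻¹) + 1 := by
        field_simp
        ring
      rw [this]
      exact Real.add_one_le_exp _
    have h3 : ((n : ℝ) + 1) / (n + 1 + ρ) ≤ (((n : ℝ) + 1 + ρ) / (((n + 1 : ℕ) : ℝ) + 1 + ρ)) ^ ρ := by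
      have h4 : ((n : ℝ) + 1 + ρ) / (((n + 1 : ℕ) : ℝ) + 1 + ρ) = (1 + ((n : ℝ) + 1 + ρ)⁻¹)⁻¹ := by
        push_cast
        field_simp
        ring
      rw [h4, Real.inv_rpow (by positivity)]
      refine h2.trans ?_
      rw [Real.exp_neg]
      exact inv_anti₀ (by positivity) h1
    calc _ ≤ ((1 + ρ) / ((n : ℝ) + 1 + ρ)) ^ ρ * (((n : ℝ) + 1 + ρ) / (((n + 1 : ℕ) : ℝ) + 1 + ρ)) ^ ρ :=
          mul_le_mul_of_nonneg_left h3 (by positivity)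
      _ = _ := by
        rw [← Real.mul_rpow (by positivity) (by positivity)]
        congr 1
        field_simp

/-- Moments of order `r < 1/p` of the Yule–Simon law are finite. -/
lemma tsum_birthWeight_lt_top {p : ℝ} (hp : 0 < p) {r : ℝ} (hr : r < p⁻¹) :
    ∑' n : ℕ, ENNReal.ofReal (((n : ℝ) + 1) ^ (r - 1)) * birthWeight p n < ∞ := by
  have hρ0 : 0 < p⁻¹ := inv_pos.2 hp
  have hs : Summable fun n : ℕ => (1 + p⁻¹) ^ p⁻¹ * ((n + 1 : ℕ) : ℝ) ^ (r - 1 - p⁻¹) := by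
    apply Summable.mul_left
    exact (summable_nat_add_iff 1).2 (Real.summable_nat_rpow.2 (by linarith))
  refine lt_of_le_of_lt (ENNReal.tsum_le_tsum fun n => ?_) hs.tsum_ofReal_lt_top
  refine (mul_le_mul' le_rfl (birthWeight_le hp n)).trans ?_
  rw [← ENNReal.ofReal_mul (by positivity)]
  apply ENNReal.ofReal_le_ofReal
  rw [Real.div_rpow (by positivity) (by positivity), Real.rpow_sub (by positivity) (r - 1), mul_div,
    mul_comm, ← mul_div]
  push_cast
  have h1 : ((n : ℝ) + 1) ^ p⁻¹ ≤ ((n : ℝ) + 1 + p⁻¹) ^ p⁻¹ :=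
    Real.rpow_le_rpow (by positivity) (by linarith) hρ0.le
  gcongr

/-! ### Moments of the increments of the Yule–Simon process -/

lemma birthTime_succ (p : ℝ) (n : ℕ) (ω : ℝ × (ℕ → ℝ)) :
    birthTime p (n + 1) ω = birthTime p n ω * Real.exp (ω.2 n / p) := by
  rw [birthTime, birthTime, mul_assoc, ← Real.exp_add, holdingSum, Finset.sum_range_succ, holdingSum,
    add_div]

/-- The almost sure properties of the sample points of the Yule–Simon process: the starting point
is positive, the holding times are nonnegative, and there is no explosion. -/
structure IsRegularSample (p : ℝ) (ω : ℝ × (ℕ → ℝ)) : Prop where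
  pos : 0 < ω.1
  nonneg : ∀ k, 0 ≤ ω.2 k
  finite : {n | birthTime p n ω ≤ 1}.Finite

lemma ae_isRegularSample {p : ℝ} (hp : 0 < p) (hp1 : p < 1) :
    ∀ᵐ ω ∂yuleSimonLaw, IsRegularSample p ω := by
  have h1 : ∀ᵐ ω ∂yuleSimonLaw, 0 < ω.1 := by
    have : ∀ᵐ u ∂(volume.restrict (Set.Icc (0 : ℝ) 1)), 0 < u := by
      rw [ae_restrict_iff' measurableSet_Icc]
      have h0 : ∀ᵐ u : ℝ, u ≠ 0 := by simp [ae_iff]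
      filter_upwards [h0] with u hu hu1
      exact lt_of_le_of_ne hu1.1 (Ne.symm hu)
    exact Measure.quasiMeasurePreserving_fst.ae this
  have h2 : ∀ᵐ ω ∂yuleSimonLaw, ∀ k, 0 ≤ ω.2 k := by
    have : ∀ᵐ τ ∂yuleHoldingLaw, ∀ k, 0 ≤ τ k := by
      rw [ae_all_iff]
      intro k
      have h3 : ∀ᵐ x ∂(expMeasure ((k : ℝ) + 1)), 0 ≤ x := by
        rw [ae_iff]
        convert! expMeasure_Iio_zero ((k : ℝ) + 1) using 2
        ext x
        simp
      exact (measurePreserving_eval_infinitePi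
        (fun k : ℕ => expMeasure ((k : ℝ) + 1)) k).quasiMeasurePreserving.ae h3
    exact Measure.quasiMeasurePreserving_snd.ae this
  have h3 : ∀ᵐ ω ∂yuleSimonLaw, {n | 0 < birthTime p n ω ∧ birthTime p n ω ≤ 1}.Finite := by
    have hsum : ∑' n, yuleSimonLaw {ω | 0 < birthTime p n ω ∧ birthTime p n ω ≤ 1} ≠ ∞ := by
      refine ne_of_lt (lt_of_le_of_lt (ENNReal.tsum_le_tsum fun n => ?_)
        (tsum_birthWeight_lt_top hp (r := 1) ((one_lt_inv₀ hp).2 hp1)))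
      have := yuleSimonLaw_birthTime_mem_le hp n MeasurableSet.univ 0 1
      simpa using this
    have h := measure_setOfPred_frequently_eq_zero hsum
    rw [ae_iff]
    convert! h using 3
    ext ω
    rw [Nat.frequently_atTop_iff_infinite]
    rfl
  filter_upwards [h1, h2, h3] with ω hω1 hω2 hω3
  refine ⟨hω1, hω2, hω3.subset fun n hn => ⟨?_, hn⟩⟩
  unfold birthTime
  positivity

section Regular

variable {p : ℝ} {ω : ℝ × (ℕ → ℝ)}

lemma IsRegularSample.birthTime_pos (hω : IsRegularSample p ω) (n : ℕ) : 0 < birthTime p n ω := by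
  have := hω.pos
  unfold birthTime
  positivity

lemma IsRegularSample.monotone (hω : IsRegularSample p ω) (hp : 0 < p) :
    Monotone fun n => birthTime p n ω := by
  refine monotone_nat_of_le_succ fun n => ?_
  rw [birthTime_succ]
  exact le_mul_of_one_le_right (hω.birthTime_pos n).le
    (Real.one_le_exp (div_nonneg (hω.nonneg n) hp.le))

lemma IsRegularSample.finite_le (hω : IsRegularSample p ω) {t : ℝ} (ht : t ≤ 1) :
    {n | birthTime p n ω ≤ t}.Finite :=
  hω.finite.subset fun _ hn => le_trans hn ht

lemma IsRegularSample.yuleSimon_eq (hω : IsRegularSample p ω) (hp : 0 < p) {t : ℝ}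
    (ht : t ≤ 1) : yuleSimon p t ω = ({n | birthTime p n ω ≤ t}.ncard : ℝ) := by
  by_cases hU : ω.1 ≤ t
  · have htpos : 0 < t := hω.pos.trans_le hU
    rw [yuleSimon, if_pos hU, yuleProcess]
    congr 1
    have hiff : ∀ n, birthTime p n ω ≤ t ↔ holdingSum n ω.2 ≤ p * (Real.log t - Real.log ω.1) := by
      intro n
      rw [← Real.log_le_log_iff (hω.birthTime_pos n) htpos, birthTime,
        Real.log_mul hω.pos.ne' (Real.exp_pos _).ne', Real.log_exp, ← div_le_iff₀' hp]
      constructor <;> intro h <;> linarith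
    have hset : {n | birthTime p n ω ≤ t}
        = insert 0 (Nat.succ '' {n | ∑ k ∈ Finset.range (n + 1), ω.2 k
          ≤ p * (Real.log t - Real.log ω.1)}) := by
      ext n
      cases n with
      | zero => simpa [birthTime, holdingSum] using hU
      | succ n => simp [hiff, holdingSum]
    have hfin := hω.finite_le ht
    rw [hset] at hfin ⊢
    rw [Set.ncard_insert_of_notMem (by simp) (hfin.subset (Set.subset_insert _ _)),
      Set.ncard_image_of_injective _ Nat.succ_injective, add_comm]
  · have hempty : {n | birthTime p n ω ≤ t} = ∅ := by
      ext n
      simp only [Set.mem_ofPred_eq, Set.mem_empty_iff_false, iff_false, not_le]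
      refine (not_le.1 hU).trans_le ((hω.monotone hp (Nat.zero_le n)).trans' ?_)
      simp [birthTime, holdingSum]
    rw [yuleSimon, if_neg hU, hempty]
    simp

lemma IsRegularSample.yuleSimon_sub_eq (hω : IsRegularSample p ω) (hp : 0 < p) {s t : ℝ}
    (hst : s ≤ t) (ht : t ≤ 1) : yuleSimon p t ω - yuleSimon p s ω
      = ({n | s < birthTime p n ω ∧ birthTime p n ω ≤ t}.ncard : ℝ) := by
  rw [hω.yuleSimon_eq hp ht, hω.yuleSimon_eq hp (hst.trans ht)]
  have hsub : {n | birthTime p n ω ≤ s} ⊆ {n | birthTime p n ω ≤ t} := fun n hn => le_trans hn hst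
  have h1 := Set.ncard_sdiff_add_ncard_of_subset hsub (hω.finite_le ht)
  have h2 : {n | birthTime p n ω ≤ t} \ {n | birthTime p n ω ≤ s}
      = {n | s < birthTime p n ω ∧ birthTime p n ω ≤ t} := by
    ext n
    simp [and_comm]
  rw [h2] at h1
  rw [← h1]
  push_cast
  ring

end Regular

/-- A measurable, integer valued version of the Yule–Simon process. -/
noncomputable def yuleCount (p t : ℝ) (ω : ℝ × (ℕ → ℝ)) : ℕ :=
  ⌊(∑' n, {ω | birthTime p n ω ≤ t}.indicator (1 : ℝ × (ℕ → ℝ) → ℝ≥0∞) ω).toReal⌋₊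

lemma measurable_yuleCount (p t : ℝ) : Measurable (yuleCount p t) := by
  refine Nat.measurable_floor.comp (Measurable.ennreal_toReal (Measurable.tsum fun n => ?_))
  exact measurable_one.indicator (measurableSet_le (measurable_birthTime p n) measurable_const)

lemma IsRegularSample.yuleSimon_eq_yuleCount {p : ℝ} {ω : ℝ × (ℕ → ℝ)} (hω : IsRegularSample p ω)
    (hp : 0 < p) {t : ℝ} (ht : t ≤ 1) : yuleSimon p t ω = (yuleCount p t ω : ℝ) := by
  rw [hω.yuleSimon_eq hp ht, yuleCount]
  have hfin := hω.finite_le ht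
  have h1 : ∑' n, {ω | birthTime p n ω ≤ t}.indicator (1 : ℝ × (ℕ → ℝ) → ℝ≥0∞) ω
      = ({n | birthTime p n ω ≤ t}.ncard : ℝ≥0∞) := by
    rw [tsum_eq_sum (s := hfin.toFinset) (fun n hn => by
      simp only [Set.Finite.mem_toFinset, Set.mem_ofPred_eq] at hn
      simp [hn])]
    rw [Finset.sum_congr rfl (g := fun _ => (1 : ℝ≥0∞)) (fun n hn => by
      simp only [Set.Finite.mem_toFinset, Set.mem_ofPred_eq] at hn
      simp [hn])]
    rw [Finset.sum_const, Set.ncard_eq_toFinset_card _ hfin]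
    simp
  rw [h1]
  simp

/-- Any function of finitely many values of the Yule–Simon process is measurable, since these
values are integers. -/
lemma aestronglyMeasurable_comp_yuleSimon {p : ℝ} (hp : 0 < p) (hp1 : p < 1) {E : Type*}
    [TopologicalSpace E] [TopologicalSpace.PseudoMetrizableSpace E] [SecondCountableTopology E]
    [MeasurableSpace E] [OpensMeasurableSpace E] {k : ℕ} {t : Fin k → ℝ}
    (ht : ∀ i, t i ≤ 1) (F : (Fin k → ℝ) → E) :
    AEStronglyMeasurable (fun ω => F fun i => yuleSimon p (t i) ω) yuleSimonLaw := by
  have h1 : Measurable fun ω => fun i => yuleCount p (t i) ω :=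
    measurable_pi_lambda _ fun i => measurable_yuleCount p (t i)
  have h2 : Measurable fun ω => F fun i => (yuleCount p (t i) ω : ℝ) :=
    (measurable_of_countable fun v : Fin k → ℕ => F fun i => (v i : ℝ)).comp h1
  refine h2.aestronglyMeasurable.congr ?_
  filter_upwards [ae_isRegularSample hp hp1] with ω hω
  congr 1
  ext i
  exact (hω.yuleSimon_eq_yuleCount hp (ht i)).symm

lemma add_one_rpow_le {r : ℝ} (hr : 1 ≤ r) (m : ℕ) :
    ((m : ℝ) + 1) ^ r ≤ (m : ℝ) ^ r + r * ((m : ℝ) + 1) ^ (r - 1) := by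
  have hm : (0 : ℝ) < m + 1 := by positivity
  have h1 := one_add_mul_self_le_rpow_one_add (s := -((m : ℝ) + 1)⁻¹)
    (by rw [neg_le_neg_iff]; exact inv_le_one_of_one_le₀ (by linarith [m.cast_nonneg (α := ℝ)])) hr
  have h2 : 1 + -((m : ℝ) + 1)⁻¹ = m / (m + 1) := by
    field_simp
    ring
  rw [h2, Real.div_rpow (by positivity) hm.le, le_div_iff₀ (by positivity)] at h1
  rw [Real.rpow_sub_one hm.ne']
  calc ((m : ℝ) + 1) ^ r = (1 + r * -((m : ℝ) + 1)⁻¹) * ((m : ℝ) + 1) ^ r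
        + r * (((m : ℝ) + 1) ^ r / (m + 1)) := by
          field_simp
          ring
    _ ≤ _ := by gcongr

/-- The power `r` of the number of jumps in a time interval is charged to these jumps, the jump of
index `n` being charged at most the increment of `m ↦ m ^ r` at `m = n + 1`, up to a constant. -/
lemma card_rpow_le_sum {r : ℝ} (hr : 1 ≤ r) (S : Finset ℕ) :
    (S.card : ℝ) ^ r ≤ ∑ n ∈ S, r * ((n : ℝ) + 1) ^ (r - 1) := by
  induction S using Finset.induction_on_max with
  | empty => simp [Real.zero_rpow (by linarith : r ≠ 0)]
  | insert a S hS ih =>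
    have ha : a ∉ S := fun h => lt_irrefl _ (hS a h)
    rw [Finset.card_insert_of_notMem ha, Finset.sum_insert ha]
    have hcard : S.card ≤ a := by
      have : S ⊆ Finset.range a := fun x hx => Finset.mem_range.2 (hS x hx)
      simpa using Finset.card_le_card this
    have h1 := add_one_rpow_le hr S.card
    have h2 : ((S.card : ℝ) + 1) ^ (r - 1) ≤ ((a : ℝ) + 1) ^ (r - 1) :=
      Real.rpow_le_rpow (by positivity) (by gcongr) (by linarith)
    have h3 := mul_le_mul_of_nonneg_left h2 (by linarith : (0 : ℝ) ≤ r)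
    push_cast
    linarith

/-- The moment of order `r < 1/p` of an increment of the Yule–Simon process over an interval is at
most proportional to the length of that interval: an increment by `m` is charged to the jumps it
consists of, and the jump times have uniform intensity. -/
lemma exists_lintegral_yuleSimon_sub_rpow_le {p : ℝ} (hp : 0 < p) (hp1 : p < 1) {r : ℝ} (hr1 : 1 ≤ r)
    (hr : r < p⁻¹) : ∃ M : ℝ, 0 < M ∧ ∀ s t : ℝ, s ≤ t → t ≤ 1 →
      ∫⁻ ω, ENNReal.ofReal (|yuleSimon p t ω - yuleSimon p s ω| ^ r) ∂yuleSimonLaw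
        ≤ ENNReal.ofReal (M * (t - s)) := by
  set W := ∑' n : ℕ, ENNReal.ofReal (((n : ℝ) + 1) ^ (r - 1)) * birthWeight p n with hW
  have hWtop : W < ∞ := tsum_birthWeight_lt_top hp hr
  refine ⟨r * W.toReal + 1, by positivity, fun s t hst ht => ?_⟩
  have hmeas : ∀ n, MeasurableSet {ω | s < birthTime p n ω ∧ birthTime p n ω ≤ t} := fun n =>
    (measurableSet_lt measurable_const (measurable_birthTime p n)).inter
      (measurableSet_le (measurable_birthTime p n) measurable_const)
  calc ∫⁻ ω, ENNReal.ofReal (|yuleSimon p t ω - yuleSimon p s ω| ^ r) ∂yuleSimonLaw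
      ≤ ∫⁻ ω, ∑' n : ℕ, ENNReal.ofReal (r * ((n : ℝ) + 1) ^ (r - 1))
          * {ω | s < birthTime p n ω ∧ birthTime p n ω ≤ t}.indicator 1 ω ∂yuleSimonLaw := by
        apply lintegral_mono_ae
        filter_upwards [ae_isRegularSample hp hp1] with ω hω
        have hfin : {n | s < birthTime p n ω ∧ birthTime p n ω ≤ t}.Finite :=
          (hω.finite_le ht).subset fun n hn => hn.2
        rw [hω.yuleSimon_sub_eq hp hst ht, Nat.abs_cast, Set.ncard_eq_toFinset_card _ hfin]
        refine (ENNReal.ofReal_le_ofReal (card_rpow_le_sum hr1 _)).trans ?_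
        rw [ENNReal.ofReal_sum_of_nonneg (fun n _ => by positivity)]
        refine le_trans (le_of_eq (Finset.sum_congr rfl fun n hn => ?_)) (ENNReal.sum_le_tsum hfin.toFinset)
        simp only [Set.Finite.mem_toFinset, Set.mem_ofPred_eq] at hn
        simp [hn]
    _ = ∑' n : ℕ, ENNReal.ofReal (r * ((n : ℝ) + 1) ^ (r - 1))
          * yuleSimonLaw {ω | s < birthTime p n ω ∧ birthTime p n ω ≤ t} := by
        rw [lintegral_tsum fun n => by
          exact ((measurable_one.indicator (hmeas n)).const_mul _).aemeasurable]
        refine tsum_congr fun n => ?_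
        rw [lintegral_const_mul _ (measurable_one.indicator (hmeas n)), lintegral_indicator_one (hmeas n)]
    _ ≤ ∑' n : ℕ, ENNReal.ofReal (r * ((n : ℝ) + 1) ^ (r - 1))
          * (ENNReal.ofReal (t - s) * birthWeight p n) := by
        refine ENNReal.tsum_le_tsum fun n => mul_le_mul' le_rfl ?_
        have := yuleSimonLaw_birthTime_mem_le hp n MeasurableSet.univ s t
        simpa using this
    _ = ENNReal.ofReal r * ENNReal.ofReal (t - s) * W := by
        rw [hW, ← ENNReal.tsum_mul_left]
        refine tsum_congr fun n => ?_
        rw [ENNReal.ofReal_mul (by positivity)]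
        ring
    _ ≤ _ := by
        rw [← ENNReal.ofReal_toReal hWtop.ne, ENNReal.toReal_ofReal ENNReal.toReal_nonneg, ← ENNReal.ofReal_mul (by positivity),
          ← ENNReal.ofReal_mul (by have := sub_nonneg.2 hst; positivity)]
        apply ENNReal.ofReal_le_ofReal
        have := sub_nonneg.2 hst
        nlinarith

lemma min_one_le_rpow {z d : ℝ} (hz : 0 ≤ z) (hd0 : 0 ≤ d) (hd1 : d ≤ 1) : min 1 z ≤ z ^ d := by
  rcases le_total z 1 with h | h
  · exact (min_le_right _ _).trans (Real.self_le_rpow_of_le_one hz h hd1)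
  · exact (min_le_left _ _).trans (Real.one_le_rpow h hd0)

/-- The Yule–Simon process is unlikely to increase on two adjacent intervals of length at most `h`:
the particle alive after the `n`-th jump would have to reproduce within a time of order `h`, which
has probability of order `n h`. -/
lemma exists_yuleSimonLaw_two_increments_le {p : ℝ} (hp : 0 < p) (hp1 : p < 1) :
    ∃ d M : ℝ, 0 < d ∧ d < 1 ∧ 0 < M ∧ ∀ s t u : ℝ, 2⁻¹ ≤ s → s ≤ t → t ≤ u → u ≤ 1 →
      yuleSimonLaw {ω | yuleSimon p t ω ≠ yuleSimon p s ω ∧ yuleSimon p u ω ≠ yuleSimon p t ω}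
        ≤ ENNReal.ofReal (M * (u - s) ^ (1 + d)) := by
  have hp1' : 1 < p⁻¹ := (one_lt_inv₀ hp).2 hp1
  obtain ⟨d, hd0, hd⟩ : ∃ d, 0 < d ∧ d < min 1 (p⁻¹ - 1) :=
    exists_between (lt_min one_pos (by linarith))
  have hd1 : d < 1 := hd.trans_le (min_le_left _ _)
  have hdp : d < p⁻¹ - 1 := hd.trans_le (min_le_right _ _)
  set W := ∑' n : ℕ, ENNReal.ofReal (((n : ℝ) + 1) ^ (1 + d - 1)) * birthWeight p n with hW
  have hWtop : W < ∞ := tsum_birthWeight_lt_top hp (by linarith)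
  refine ⟨d, 2 * W.toReal + 1, hd0, hd1, by positivity, fun s t u hs hst htu hu => ?_⟩
  have hs0 : 0 < s := by linarith
  have hus : 0 ≤ u - s := by linarith
  set B : Set ℝ := Set.Iic (2 * (u - s)) with hB
  calc yuleSimonLaw {ω | yuleSimon p t ω ≠ yuleSimon p s ω ∧ yuleSimon p u ω ≠ yuleSimon p t ω}
      ≤ yuleSimonLaw (⋃ n, {ω | s < birthTime p n ω ∧ birthTime p n ω ≤ u ∧ ω.2 n ∈ B}) := by
        apply measure_mono_ae
        filter_upwards [ae_isRegularSample hp hp1] with ω hω hmem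
        obtain ⟨h1, h2⟩ := hmem
        have h1' := sub_ne_zero.2 h1
        have h2' := sub_ne_zero.2 h2
        rw [hω.yuleSimon_sub_eq hp hst (htu.trans hu)] at h1'
        rw [hω.yuleSimon_sub_eq hp htu hu] at h2'
        obtain ⟨n, hn1, hn2⟩ := Set.nonempty_of_ncard_ne_zero (Nat.cast_ne_zero.1 h1')
        obtain ⟨m, hm1, hm2⟩ := Set.nonempty_of_ncard_ne_zero (Nat.cast_ne_zero.1 h2')
        have hnm : n + 1 ≤ m := by
          by_contra hcon
          have : birthTime p m ω ≤ birthTime p n ω := hω.monotone hp (by omega)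
          linarith
        -- Two jumps in `(s, u]` with `s ≥ 1 / 2` force the holding time after the first of them to be
        -- at most `2 (u - s)`.
        have hle : birthTime p (n + 1) ω ≤ u := (hω.monotone hp hnm).trans hm2
        refine Set.mem_iUnion.2 ⟨n, hn1, hn2.trans htu, ?_⟩
        rw [birthTime_succ] at hle
        have h3 : s * (ω.2 n / p + 1) ≤ u :=
          (mul_le_mul hn1.le (Real.add_one_le_exp _) (by
            have := hω.nonneg n
            positivity) (hω.birthTime_pos n).le).trans hle
        have h4 : ω.2 n ≤ ω.2 n / p := by
          rw [le_div_iff₀ hp]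
          exact mul_le_of_le_one_right (hω.nonneg n) hp1.le
        have h5 := hω.nonneg n
        simp only [hB, Set.mem_Iic]
        nlinarith
    _ ≤ ∑' n, yuleSimonLaw {ω | s < birthTime p n ω ∧ birthTime p n ω ≤ u ∧ ω.2 n ∈ B} :=
        measure_iUnion_le _
    _ ≤ ∑' n : ℕ, ENNReal.ofReal (2 * (u - s) ^ (1 + d))
          * (ENNReal.ofReal (((n : ℝ) + 1) ^ (1 + d - 1)) * birthWeight p n) := by
        refine ENNReal.tsum_le_tsum fun n => ?_
        refine (yuleSimonLaw_birthTime_mem_le hp n measurableSet_Iic s u).trans ?_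
        -- The bound `min 1 z ≤ z ^ d` trades the factor `n` for `n ^ d`, which the jump probabilities
        -- can sum up, as `1 + d < 1 / p`.
        have h1 : expMeasure ((n : ℝ) + 1) B
            ≤ ENNReal.ofReal ((((n : ℝ) + 1) * (2 * (u - s))) ^ d) := by
          refine le_trans (le_min prob_le_one (expMeasure_Iic_le (by positivity) (by positivity))) ?_
          rw [← ENNReal.ofReal_one, ← ENNReal.ofReal_min]
          exact ENNReal.ofReal_le_ofReal (min_one_le_rpow (by positivity) hd0.le hd1.le)
        refine (mul_le_mul' le_rfl (mul_le_mul' le_rfl h1)).trans ?_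
        rw [mul_comm (birthWeight p n), ← mul_assoc (ENNReal.ofReal (u - s)),
          ← mul_assoc (ENNReal.ofReal (2 * (u - s) ^ (1 + d))), ← ENNReal.ofReal_mul hus,
          ← ENNReal.ofReal_mul (by positivity)]
        refine mul_le_mul' (ENNReal.ofReal_le_ofReal ?_) le_rfl
        rw [Real.mul_rpow (by positivity) (by positivity), Real.mul_rpow (by positivity) hus,
          show 1 + d - 1 = d by ring, Real.rpow_one_add' hus (by linarith)]
        have h2 : (2 : ℝ) ^ d ≤ 2 := by
          simpa using Real.rpow_le_rpow_of_exponent_le (one_le_two (α := ℝ)) hd1.le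
        calc (u - s) * (((n : ℝ) + 1) ^ d * (2 ^ d * (u - s) ^ d))
            = 2 ^ d * ((u - s) * (u - s) ^ d * ((n : ℝ) + 1) ^ d) := by ring
          _ ≤ 2 * ((u - s) * (u - s) ^ d * ((n : ℝ) + 1) ^ d) := by gcongr
          _ = _ := by ring
    _ = ENNReal.ofReal (2 * (u - s) ^ (1 + d)) * W := by rw [ENNReal.tsum_mul_left]
    _ ≤ _ := by
        rw [← ENNReal.ofReal_toReal hWtop.ne, ENNReal.toReal_ofReal ENNReal.toReal_nonneg, ← ENNReal.ofReal_mul (by positivity)]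
        apply ENNReal.ofReal_le_ofReal
        have : 0 ≤ (u - s) ^ (1 + d) := by positivity
        nlinarith

/-- Interpolation between the two previous estimates: the moment of order `r < 1/p` of an
increment of the Yule–Simon process, restricted to the event that both halves of the increment are
nonzero, is small of order larger than `1` in the length of the interval. -/
lemma exists_lintegral_yuleSimon_two_increments_le {p : ℝ} (hp : 0 < p) (hp1 : p < 1) {r : ℝ}
    (hr1 : 1 ≤ r) (hr : r < p⁻¹) :
    ∃ d M : ℝ, 0 < d ∧ d < 1 ∧ 0 < M ∧ ∀ s t u : ℝ, 2⁻¹ ≤ s → s ≤ t → t ≤ u → s < u → u ≤ 1 →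
      ∫⁻ ω in {ω | yuleSimon p t ω ≠ yuleSimon p s ω ∧ yuleSimon p u ω ≠ yuleSimon p t ω},
        ENNReal.ofReal (|yuleSimon p u ω - yuleSimon p s ω| ^ r) ∂yuleSimonLaw
        ≤ ENNReal.ofReal (M * (u - s) ^ (1 + d)) := by
  obtain ⟨d, M, hd0, hd1, hM, hE⟩ := exists_yuleSimonLaw_two_increments_le hp hp1
  obtain ⟨r', hr', hr'p⟩ := exists_between hr
  obtain ⟨M', hM', hE'⟩ := exists_lintegral_yuleSimon_sub_rpow_le hp hp1 (hr1.trans hr'.le) hr'p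
  have hr0 : 0 < r := by linarith
  set g := d / (2 * r) with hg
  have hg0 : 0 < g := by positivity
  have hgr : g * r = d / 2 := by
    rw [hg]
    field_simp
  set e := min (d / 2) (g * (r' - r)) with he
  have he0 : 0 < e := lt_min (by positivity) (mul_pos hg0 (by linarith))
  refine ⟨e, M' + M, he0, (min_le_left _ _).trans_lt (by linarith), by positivity,
    fun s t u hs hst htu hsu hu => ?_⟩
  set h := u - s with hh
  have hh0 : 0 < h := sub_pos.2 hsu
  have hh1 : h ≤ 1 := by linarith
  -- Increments larger than `h ^ (-g)` are handled by a moment of order `r' > r`, the others by the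
  -- probability of the event.
  have hpt : ∀ z : ℝ, 0 ≤ z → z ^ r ≤ h ^ (g * (r' - r)) * z ^ r' + h ^ (-(d / 2)) := by
    intro z hz
    rcases le_total z (h ^ (-g)) with hz1 | hz1
    · have h1 : z ^ r ≤ (h ^ (-g)) ^ r := Real.rpow_le_rpow hz hz1 hr0.le
      rw [← Real.rpow_mul hh0.le, neg_mul, hgr] at h1
      have : 0 ≤ h ^ (g * (r' - r)) * z ^ r' := by positivity
      linarith
    · have hzpos : 0 < z := (Real.rpow_pos_of_pos hh0 _).trans_le hz1
      have h1 : (h ^ (-g)) ^ (r' - r) ≤ z ^ (r' - r) :=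
        Real.rpow_le_rpow (by positivity) hz1 (by linarith)
      rw [← Real.rpow_mul hh0.le, neg_mul, Real.rpow_neg hh0.le, Real.rpow_sub hzpos,
        inv_le_comm₀ (by positivity) (by positivity), inv_div, div_le_iff₀ (by positivity)] at h1
      have : 0 ≤ h ^ (-(d / 2)) := by positivity
      linarith
  set E := {ω | yuleSimon p t ω ≠ yuleSimon p s ω ∧ yuleSimon p u ω ≠ yuleSimon p t ω} with hEdef
  calc ∫⁻ ω in E, ENNReal.ofReal (|yuleSimon p u ω - yuleSimon p s ω| ^ r) ∂yuleSimonLaw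
      ≤ ∫⁻ ω in E, (ENNReal.ofReal (h ^ (g * (r' - r)))
          * ENNReal.ofReal (|yuleSimon p u ω - yuleSimon p s ω| ^ r')
          + ENNReal.ofReal (h ^ (-(d / 2)))) ∂yuleSimonLaw := by
        refine lintegral_mono fun ω => ?_
        rw [← ENNReal.ofReal_mul (by positivity), ← ENNReal.ofReal_add (by positivity) (by positivity)]
        exact ENNReal.ofReal_le_ofReal (hpt _ (abs_nonneg _))
    _ = ENNReal.ofReal (h ^ (g * (r' - r)))
          * ∫⁻ ω in E, ENNReal.ofReal (|yuleSimon p u ω - yuleSimon p s ω| ^ r') ∂yuleSimonLaw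
          + ENNReal.ofReal (h ^ (-(d / 2))) * yuleSimonLaw E := by
        rw [lintegral_add_right _ measurable_const, lintegral_const_mul' _ _ ENNReal.ofReal_ne_top,
          lintegral_const, Measure.restrict_apply_univ]
    _ ≤ ENNReal.ofReal (h ^ (g * (r' - r))) * ENNReal.ofReal (M' * h)
          + ENNReal.ofReal (h ^ (-(d / 2))) * ENNReal.ofReal (M * h ^ (1 + d)) := by
        gcongr
        · exact (lintegral_mono' Measure.restrict_le_self le_rfl).trans (hE' s u hsu.le hu)
        · exact hE s t u hs hst htu hu
    _ ≤ _ := by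
        rw [← ENNReal.ofReal_mul (by positivity), ← ENNReal.ofReal_mul (by positivity),
          ← ENNReal.ofReal_add (by positivity) (by positivity)]
        apply ENNReal.ofReal_le_ofReal
        have h1 : h ^ (g * (r' - r)) * h ≤ h ^ (1 + e) := by
          rw [← Real.rpow_add_one hh0.ne']
          exact Real.rpow_le_rpow_of_exponent_ge hh0 hh1 (by linarith [min_le_right (d / 2) (g * (r' - r))])
        have h2 : h ^ (-(d / 2)) * h ^ (1 + d) ≤ h ^ (1 + e) := by
          rw [← Real.rpow_add hh0]
          exact Real.rpow_le_rpow_of_exponent_ge hh0 hh1 (by linarith [min_le_left (d / 2) (g * (r' - r))])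
        nlinarith

/-! ### Tail bounds from characteristic functions -/

lemma integral_one_sub_exp_eq_sinc {R : ℝ} (hR : 0 < R) (a : ℝ) :
    ∫ l in Set.Ioc (-R) R, (1 - Complex.exp (Complex.I * ((l * a : ℝ) : ℂ)))
      = ((2 * R * (1 - Real.sinc (R * a)) : ℝ) : ℂ) := by
  have h1 := integral_charFun_Icc (μ := Measure.dirac a) hR
  rw [intervalIntegral.integral_of_le (by linarith), integral_dirac] at h1
  have hint : IntegrableOn (fun l : ℝ => Complex.exp (Complex.I * ((l * a : ℝ) : ℂ)))
      (Set.Ioc (-R) R) := by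
    apply Continuous.integrableOn_Ioc
    fun_prop
  rw [integral_sub (by simp) hint]
  have h2 : ∀ l : ℝ, Complex.exp (Complex.I * ((l * a : ℝ) : ℂ)) = charFun (Measure.dirac a) l := by
    intro l
    rw [charFun_dirac]
    congr 1
    simp [mul_comm]
  simp_rw [h2, h1]
  simp only [integral_const, measureReal_restrict_apply_univ, Real.volume_real_Ioc, Complex.real_smul]
  rw [max_eq_left (by linarith)]
  push_cast
  ring

lemma half_le_one_sub_sinc {R a : ℝ} (hR : 0 < R) (ha : 2 / R < |a|) :
    1 / 2 ≤ 1 - Real.sinc (R * a) := by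
  have h1 : 2 < |R * a| := by
    rw [abs_mul, abs_of_pos hR, mul_comm]
    exact (div_lt_iff₀ hR).1 ha
  have h2 : R * a ≠ 0 := by
    intro h
    rw [h, abs_zero] at h1
    linarith
  have h3 := Real.sinc_le_inv_abs h2
  have h4 : |R * a|⁻¹ ≤ 2⁻¹ := inv_anti₀ two_pos h1.le
  linarith

/-- Two-dimensional truncation inequality: averaging `(1 - exp (ilA)) (1 - exp (imB))` over
`l, m ∈ [-R, R]` detects the event that `A` and `B` are both large. -/
lemma measureReal_two_abs_gt_le {Ω : Type*} [MeasurableSpace Ω] {μ : Measure Ω}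
    [IsProbabilityMeasure μ] {A B : Ω → ℝ} (hA : Measurable A) (hB : Measurable B) {R D : ℝ}
    (hR : 0 < R)
    (hD : ∀ l m : ℝ, |l| ≤ R → |m| ≤ R →
      ‖∫ ω, (1 - Complex.exp (Complex.I * ((l * A ω : ℝ) : ℂ)))
        * (1 - Complex.exp (Complex.I * ((m * B ω : ℝ) : ℂ))) ∂μ‖ ≤ D) :
    μ.real {ω | 2 / R < |A ω| ∧ 2 / R < |B ω|} ≤ 4 * D := by
  set ν : Measure ℝ := volume.restrict (Set.Ioc (-R) R) with hν
  set f : ℝ → ℝ → ℂ := fun l a => 1 - Complex.exp (Complex.I * ((l * a : ℝ) : ℂ)) with hf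
  set S : ℝ → ℝ := fun a => 1 - Real.sinc (R * a) with hS
  have hS0 : ∀ a, 0 ≤ S a := fun a => sub_nonneg.2 (Real.sinc_le_one _)
  have hfmeas : Measurable fun z : ℝ × ℝ => f z.1 z.2 := by
    simp only [hf]
    fun_prop
  have hfn : ∀ l a, ‖f l a‖ ≤ 2 := by
    intro l a
    refine (norm_sub_le _ _).trans ?_
    rw [mul_comm, Complex.norm_exp_ofReal_mul_I]
    norm_num
  have hint : Integrable (Function.uncurry fun (ω : Ω) (z : ℝ × ℝ) => f z.1 (A ω) * f z.2 (B ω))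
      (μ.prod (ν.prod ν)) := by
    refine Integrable.of_bound (C := 4) ?_ (ae_of_all _ fun z => ?_)
    · apply Measurable.aestronglyMeasurable
      refine Measurable.mul ?_ ?_
      · exact hfmeas.comp (f := fun z : Ω × ℝ × ℝ => (z.2.1, A z.1)) (by fun_prop)
      · exact hfmeas.comp (f := fun z : Ω × ℝ × ℝ => (z.2.2, B z.1)) (by fun_prop)
    · simp only [Function.uncurry, norm_mul]
      nlinarith [hfn z.2.1 (A z.1), hfn z.2.2 (B z.1), norm_nonneg (f z.2.1 (A z.1)),
        norm_nonneg (f z.2.2 (B z.1))]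
  have hswap := integral_integral_swap hint
  have hleft : ∀ ω, ∫ z, f z.1 (A ω) * f z.2 (B ω) ∂(ν.prod ν)
      = ((2 * R * S (A ω) * (2 * R * S (B ω)) : ℝ) : ℂ) := by
    intro ω
    rw [integral_prod_mul (fun l => f l (A ω)) (fun m => f m (B ω))]
    simp only [hf, hν, hS, integral_one_sub_exp_eq_sinc hR]
    push_cast
    ring
  have hright : ‖∫ z, (∫ ω, f z.1 (A ω) * f z.2 (B ω) ∂μ) ∂(ν.prod ν)‖ ≤ D * (2 * R) ^ 2 := by
    have hν1 : (ν.prod ν).real Set.univ = (2 * R) ^ 2 := by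
      rw [← Set.univ_prod_univ, measureReal_prod_prod, hν, measureReal_restrict_apply_univ,
        Real.volume_real_Ioc, max_eq_left (by linarith)]
      ring
    rw [← hν1]
    refine norm_integral_le_of_norm_le_const ?_
    have h1 : ∀ᵐ l ∂ν, |l| ≤ R := by
      rw [hν, ae_restrict_iff' measurableSet_Ioc]
      exact ae_of_all _ fun l hl => abs_le.2 ⟨hl.1.le, hl.2⟩
    filter_upwards [Measure.quasiMeasurePreserving_fst.ae h1,
      Measure.quasiMeasurePreserving_snd.ae h1] with z hz1 hz2
    exact hD _ _ hz1 hz2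
  rw [← hswap] at hright
  simp_rw [hleft] at hright
  rw [integral_complex_ofReal, Complex.norm_real] at hright
  have hmeasS : Measurable S := by
    simp only [hS]
    fun_prop
  have hset : MeasurableSet {ω | 2 / R < |A ω| ∧ 2 / R < |B ω|} :=
    (measurableSet_lt measurable_const hA.abs).inter (measurableSet_lt measurable_const hB.abs)
  have hS2 : ∀ a, S a ≤ 2 := by
    intro a
    have := Real.neg_one_le_sinc (R * a)
    simp only [hS]
    linarith
  have hSint : Integrable (fun ω => 2 * R * S (A ω) * (2 * R * S (B ω))) μ := by
    refine Integrable.of_bound (C := (2 * R * 2) * (2 * R * 2)) ?_ (ae_of_all _ fun ω => ?_)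
    · apply Measurable.aestronglyMeasurable
      have h1 := hmeasS.comp hA
      have h2 := hmeasS.comp hB
      exact (h1.const_mul _).mul (h2.const_mul _)
    · have hA0 := hS0 (A ω)
      have hB0 := hS0 (B ω)
      rw [Real.norm_of_nonneg (by positivity)]
      gcongr
      · exact hS2 _
      · exact hS2 _
  have hlow : R ^ 2 * μ.real {ω | 2 / R < |A ω| ∧ 2 / R < |B ω|}
      ≤ ∫ ω, 2 * R * S (A ω) * (2 * R * S (B ω)) ∂μ := by
    rw [← smul_eq_mul, smul_eq_mul, mul_comm, ← smul_eq_mul, ← integral_indicator_const _ hset]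
    refine integral_mono ((integrable_const _).indicator hset) hSint fun ω => ?_
    by_cases hω : ω ∈ {ω | 2 / R < |A ω| ∧ 2 / R < |B ω|}
    · rw [Set.indicator_of_mem hω]
      have h1 : R ≤ 2 * R * S (A ω) := by
        have := half_le_one_sub_sinc hR hω.1
        simp only [hS]
        nlinarith
      have h2 : R ≤ 2 * R * S (B ω) := by
        have := half_le_one_sub_sinc hR hω.2
        simp only [hS]
        nlinarith
      rw [sq]
      exact mul_le_mul h1 h2 hR.le (by linarith)
    · rw [Set.indicator_of_notMem hω]
      have hA0 := hS0 (A ω)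
      have hB0 := hS0 (B ω)
      positivity
  have hfin := hlow.trans ((Real.le_norm_self _).trans hright)
  have hR2 : 0 < R ^ 2 := by positivity
  nlinarith

lemma measureReal_abs_gt_le {Ω : Type*} [MeasurableSpace Ω] {μ : Measure Ω}
    [IsProbabilityMeasure μ] {A : Ω → ℝ} (hA : Measurable A) {R D : ℝ} (hR : 0 < R)
    (hD : ∀ l : ℝ, |l| ≤ R → ‖1 - ∫ ω, Complex.exp (Complex.I * ((l * A ω : ℝ) : ℂ)) ∂μ‖ ≤ D) :
    μ.real {ω | 2 / R < |A ω|} ≤ 2 * D := by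
  have : IsProbabilityMeasure (μ.map A) := Measure.isProbabilityMeasure_map hA.aemeasurable
  have h1 := measureReal_abs_gt_le_integral_charFun (μ := μ.map A) (r := 2 / R) (by positivity)
  rw [map_measureReal_apply hA (measurableSet_lt measurable_const
    (by fun_prop : Measurable fun x : ℝ => |x|))] at h1
  refine h1.trans ?_
  have h2 : ‖∫ t in (-2 * (2 / R)⁻¹)..(2 * (2 / R)⁻¹), 1 - charFun (μ.map A) t‖
      ≤ D * |2 * (2 / R)⁻¹ - -2 * (2 / R)⁻¹| := by
    refine intervalIntegral.norm_integral_le_of_norm_le_const fun t ht => ?_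
    have e1 : 2 * (2 / R)⁻¹ = R := by field_simp
    rw [neg_mul, e1, Set.uIoc_of_le (by linarith)] at ht
    have hchar : charFun (μ.map A) t
        = ∫ ω, Complex.exp (Complex.I * ((t * A ω : ℝ) : ℂ)) ∂μ := by
      rw [charFun_apply_real, integral_map hA.aemeasurable (by fun_prop)]
      congr 1
      ext ω
      congr 1
      push_cast
      ring
    rw [hchar]
    exact hD t (abs_le.2 ⟨ht.1.le, ht.2⟩)
  calc _ ≤ 2⁻¹ * (2 / R) * (D * |2 * (2 / R)⁻¹ - -2 * (2 / R)⁻¹|) := by gcongr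
    _ = 2 * D := by
      rw [abs_of_pos (by rw [neg_mul, sub_neg_eq_add]; positivity)]
      field_simp
      ring

lemma norm_exp_sub_exp_le {z w : ℂ} (hz : z.re ≤ 0) (hw : w.re ≤ 0) :
    ‖Complex.exp z - Complex.exp w‖ ≤ ‖z - w‖ := by
  have := (convex_halfSpace_re_le 0).norm_image_sub_le_of_norm_hasDerivWithin_le (f := Complex.exp)
    (f' := Complex.exp) (C := 1) (fun x _ => (Complex.hasDerivAt_exp x).hasDerivWithinAt)
    (fun x hx => by
      rw [Complex.norm_exp]
      exact Real.exp_le_one_iff.2 hx) hw hz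
  simpa using this

/-- With `exp f`, `exp g` and `exp F` bounded by `1`, the second order difference of the exponential
is controlled by the product `f g` and the interaction `F - f - g`. -/
lemma norm_second_difference_exp_le {f g F : ℂ} (hf : f.re ≤ 0) (hg : g.re ≤ 0) (hF : F.re ≤ 0) :
    ‖1 - Complex.exp f - Complex.exp g + Complex.exp F‖ ≤ ‖f‖ * ‖g‖ + ‖F - f - g‖ := by
  have h1 : 1 - Complex.exp f - Complex.exp g + Complex.exp F
      = (Complex.exp 0 - Complex.exp f) * (Complex.exp 0 - Complex.exp g)
        + (Complex.exp F - Complex.exp (f + g)) := by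
    rw [Complex.exp_add, Complex.exp_zero]
    ring
  rw [h1]
  refine (norm_add_le _ _).trans ?_
  rw [norm_mul]
  have hfg : (f + g).re ≤ 0 := by
    rw [Complex.add_re]
    linarith
  have h2 := norm_exp_sub_exp_le (z := 0) (by simp) hf
  have h3 := norm_exp_sub_exp_le (z := 0) (by simp) hg
  have h4 := norm_exp_sub_exp_le hF hfg
  rw [zero_sub, norm_neg] at h2 h3
  rw [show F - f - g = F - (f + g) by ring]
  gcongr

/-! ### Increments of a process with Yule–Simon exponent -/

/-- The moment bounds on the increments of the Yule–Simon process that govern the paths of noise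
reinforced Lévy processes: `M` is the constant, `r` the order of the moment, and `d` the gain in the
exponent when both halves of an increment are nonzero. -/
structure YuleSimonBound (p r d M : ℝ) : Prop where
  d_pos : 0 < d
  d_lt_one : d < 1
  M_pos : 0 < M
  moment : ∀ s t : ℝ, s ≤ t → t ≤ 1 →
    ∫⁻ ω, ENNReal.ofReal (|yuleSimon p t ω - yuleSimon p s ω| ^ r) ∂yuleSimonLaw
      ≤ ENNReal.ofReal (M * (t - s))
  moment_two : ∀ s t u : ℝ, 2⁻¹ ≤ s → s ≤ t → t ≤ u → s < u → u ≤ 1 →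
    ∫⁻ ω in {ω | yuleSimon p t ω ≠ yuleSimon p s ω ∧ yuleSimon p u ω ≠ yuleSimon p t ω},
      ENNReal.ofReal (|yuleSimon p u ω - yuleSimon p s ω| ^ r) ∂yuleSimonLaw
      ≤ ENNReal.ofReal (M * (u - s) ^ (1 + d))

lemma exists_yuleSimonBound {p : ℝ} (hp : 0 < p) (hp1 : p < 1) {r : ℝ} (hr1 : 1 ≤ r)
    (hr : r < p⁻¹) : ∃ d M, YuleSimonBound p r d M := by
  obtain ⟨M, hM, h⟩ := exists_lintegral_yuleSimon_sub_rpow_le hp hp1 hr1 hr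
  obtain ⟨d, M', hd0, hd1, hM', h'⟩ := exists_lintegral_yuleSimon_two_increments_le hp hp1 hr1 hr
  refine ⟨d, M + M', hd0, hd1, by positivity, fun s t hst ht => (h s t hst ht).trans ?_,
    fun s t u hs hst htu hsu hu => (h' s t u hs hst htu hsu hu).trans ?_⟩
  · apply ENNReal.ofReal_le_ofReal
    have := sub_nonneg.2 hst
    nlinarith
  · apply ENNReal.ofReal_le_ofReal
    have : 0 ≤ (u - s) ^ (1 + d) := Real.rpow_nonneg (sub_pos.2 hsu).le _
    nlinarith

/-- The growth condition `‖ψ l‖ ≤ K (|l| ^ r + κ)` on an exponent. The constant `κ` accounts for the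
large jumps; with `κ = 0` the bound also holds near the origin. -/
structure ExponentBound (ψ : ℝ → ℂ) (r K κ : ℝ) : Prop where
  K_nonneg : 0 ≤ K
  κ_nonneg : 0 ≤ κ
  map_zero : ψ 0 = 0
  norm_le : ∀ l, ‖ψ l‖ ≤ K * (|l| ^ r + κ)

/-- `X` has on `(0, ∞)` the finite-dimensional laws of a noise reinforced Lévy process, the factor
`1 - p` being included in the exponent `ψ`. -/
structure HasYuleSimonExponent {Ω : Type*} [MeasurableSpace Ω] (p : ℝ) (ψ : ℝ → ℂ)
    (X : ℝ≥0 → Ω → ℝ) (μ : Measure Ω) : Prop where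
  measurable : ∀ t, Measurable (X t)
  fdd : ∀ (k : ℕ) (s : Fin k → ℝ≥0) (l : Fin k → ℝ) (t : ℝ≥0),
    StrictMono s → (∀ i, 0 < s i) → (∀ i, s i ≤ t) →
    ∫ ω, Complex.exp (Complex.I * ((∑ i, l i * X (s i) ω : ℝ) : ℂ)) ∂μ
      = Complex.exp ((t : ℝ) * ∫ y, ψ (∑ i, l i * yuleSimon p ((s i : ℝ) / t) y) ∂yuleSimonLaw)

section Pointwise

variable {p : ℝ} {ω : ℝ × (ℕ → ℝ)}

lemma IsRegularSample.yuleSimon_mono (hω : IsRegularSample p ω) (hp : 0 < p) {s t : ℝ} (hst : s ≤ t)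
    (ht : t ≤ 1) : yuleSimon p s ω ≤ yuleSimon p t ω := by
  have := hω.yuleSimon_sub_eq hp hst ht
  have h2 : (0 : ℝ) ≤ ({n | s < birthTime p n ω ∧ birthTime p n ω ≤ t}.ncard : ℝ) := Nat.cast_nonneg _
  linarith

lemma IsRegularSample.one_le_sub (hω : IsRegularSample p ω) (hp : 0 < p) {s t : ℝ} (hst : s ≤ t)
    (ht : t ≤ 1) (hne : yuleSimon p t ω ≠ yuleSimon p s ω) :
    1 ≤ yuleSimon p t ω - yuleSimon p s ω := by
  have h1 := hω.yuleSimon_sub_eq hp hst ht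
  have h2 := sub_ne_zero.2 hne
  rw [h1] at h2 ⊢
  exact_mod_cast Nat.one_le_iff_ne_zero.2 (Nat.cast_ne_zero.1 h2)

lemma IsRegularSample.norm_exponent_le (hω : IsRegularSample p ω) (hp : 0 < p) {ψ : ℝ → ℂ}
    {r K κ : ℝ} (hψ : ExponentBound ψ r K κ) (hr : 1 ≤ r) {s t u : ℝ} (hst : s ≤ t) (htu : t ≤ u)
    (hu : u ≤ 1) {l m R : ℝ} (hl : |l| ≤ R) (hm : |m| ≤ R) :
    ‖ψ (l * (yuleSimon p t ω - yuleSimon p s ω) + m * (yuleSimon p u ω - yuleSimon p t ω))‖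
      ≤ K * (R ^ r + κ) * |yuleSimon p u ω - yuleSimon p s ω| ^ r := by
  have hR : 0 ≤ R := (abs_nonneg l).trans hl
  have h1 := hω.yuleSimon_mono hp hst (htu.trans hu)
  have h2 := hω.yuleSimon_mono hp htu hu
  have hK := hψ.K_nonneg
  have hκ := hψ.κ_nonneg
  by_cases hne : yuleSimon p u ω = yuleSimon p s ω
  · have e1 : yuleSimon p t ω - yuleSimon p s ω = 0 := by linarith
    have e2 : yuleSimon p u ω - yuleSimon p t ω = 0 := by linarith
    rw [e1, e2, mul_zero, mul_zero, add_zero, hψ.map_zero, norm_zero]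
    positivity
  · have h3 := hω.one_le_sub hp (hst.trans htu) hu hne
    set x := yuleSimon p t ω - yuleSimon p s ω with hx
    set y := yuleSimon p u ω - yuleSimon p t ω with hy
    have hxy : yuleSimon p u ω - yuleSimon p s ω = x + y := by
      rw [hx, hy]
      ring
    have hx0 : 0 ≤ x := sub_nonneg.2 h1
    have hy0 : 0 ≤ y := sub_nonneg.2 h2
    rw [hxy] at h3 ⊢
    rw [abs_of_nonneg (by positivity : 0 ≤ x + y)]
    have h4 : |l * x + m * y| ≤ R * (x + y) := by
      refine (abs_add_le _ _).trans ?_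
      rw [abs_mul, abs_mul, abs_of_nonneg hx0, abs_of_nonneg hy0, mul_add]
      gcongr
    have h5 : |l * x + m * y| ^ r ≤ R ^ r * (x + y) ^ r := by
      rw [← Real.mul_rpow hR (by positivity)]
      exact Real.rpow_le_rpow (abs_nonneg _) h4 (by linarith)
    have h6 : 1 ≤ (x + y) ^ r := Real.one_le_rpow h3 (by linarith)
    refine (hψ.norm_le _).trans ?_
    rw [mul_assoc]
    refine mul_le_mul_of_nonneg_left ?_ hK
    nlinarith

end Pointwise

section Integrals

variable {p r d M : ℝ} {ψ : ℝ → ℂ} {K κ : ℝ}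

lemma integrable_yuleSimon_sub_rpow (hp : 0 < p) (hp1 : p < 1) (hY : YuleSimonBound p r d M) {s t : ℝ}
    (hst : s ≤ t) (ht : t ≤ 1) :
    Integrable (fun ω => |yuleSimon p t ω - yuleSimon p s ω| ^ r) yuleSimonLaw := by
  have hmeas : AEStronglyMeasurable (fun ω => |yuleSimon p t ω - yuleSimon p s ω| ^ r) yuleSimonLaw :=
    aestronglyMeasurable_comp_yuleSimon hp hp1 (t := ![s, t])
      (by simp [Fin.forall_fin_two, hst.trans ht, ht]) (fun v => |v 1 - v 0| ^ r)
  refine ⟨hmeas, ?_⟩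
  rw [hasFiniteIntegral_iff_ofReal (ae_of_all _ fun ω => by positivity)]
  exact (hY.moment s t hst ht).trans_lt ENNReal.ofReal_lt_top

lemma integral_yuleSimon_sub_rpow_le (hp : 0 < p) (hp1 : p < 1) (hY : YuleSimonBound p r d M) {s t : ℝ}
    (hst : s ≤ t) (ht : t ≤ 1) :
    ∫ ω, |yuleSimon p t ω - yuleSimon p s ω| ^ r ∂yuleSimonLaw ≤ M * (t - s) := by
  rw [integral_eq_lintegral_of_nonneg_ae (ae_of_all _ fun ω => by positivity)
    (integrable_yuleSimon_sub_rpow hp hp1 hY hst ht).1]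
  exact ENNReal.toReal_le_of_le_ofReal (mul_nonneg hY.M_pos.le (sub_nonneg.2 hst))
    (hY.moment s t hst ht)

lemma integrable_exponent (hp : 0 < p) (hp1 : p < 1) (hr : 1 ≤ r) (hY : YuleSimonBound p r d M)
    (hψ : ExponentBound ψ r K κ) {s t u : ℝ} (hst : s ≤ t) (htu : t ≤ u) (hu : u ≤ 1) (l m : ℝ) :
    Integrable (fun ω => ψ (l * (yuleSimon p t ω - yuleSimon p s ω)
      + m * (yuleSimon p u ω - yuleSimon p t ω))) yuleSimonLaw := by
  have hmeas := aestronglyMeasurable_comp_yuleSimon hp hp1 (t := ![s, t, u])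
      (by simp [Fin.forall_fin_succ, hst.trans (htu.trans hu), htu.trans hu, hu])
      (fun v => ψ (l * (v 1 - v 0) + m * (v 2 - v 1)))
  refine Integrable.mono' ((integrable_yuleSimon_sub_rpow hp hp1 hY (hst.trans htu) hu).const_mul
    (K * ((max |l| |m|) ^ r + κ))) hmeas ?_
  filter_upwards [ae_isRegularSample hp hp1] with ω hω
  exact hω.norm_exponent_le hp hψ hr hst htu hu (le_max_left _ _) (le_max_right _ _)

lemma norm_integral_exponent_le (hp : 0 < p) (hp1 : p < 1) (hr : 1 ≤ r) (hY : YuleSimonBound p r d M)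
    (hψ : ExponentBound ψ r K κ) {s t u : ℝ} (hst : s ≤ t) (htu : t ≤ u) (hu : u ≤ 1) {l m R : ℝ}
    (hl : |l| ≤ R) (hm : |m| ≤ R) :
    ‖∫ ω, ψ (l * (yuleSimon p t ω - yuleSimon p s ω)
      + m * (yuleSimon p u ω - yuleSimon p t ω)) ∂yuleSimonLaw‖ ≤ K * (R ^ r + κ) * (M * (u - s)) := by
  have hR : 0 ≤ R := (abs_nonneg l).trans hl
  have hK := hψ.K_nonneg
  have hκ := hψ.κ_nonneg
  refine (norm_integral_le_of_norm_le ((integrable_yuleSimon_sub_rpow hp hp1 hY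
    (hst.trans htu) hu).const_mul (K * (R ^ r + κ))) ?_).trans ?_
  · filter_upwards [ae_isRegularSample hp hp1] with ω hω
    exact hω.norm_exponent_le hp hψ hr hst htu hu hl hm
  · rw [integral_const_mul]
    exact mul_le_mul_of_nonneg_left (integral_yuleSimon_sub_rpow_le hp hp1 hY (hst.trans htu) hu)
      (by positivity)

/-- The interaction between two adjacent increments only involves the event that both are nonzero. -/
lemma norm_integral_interaction_le (hp : 0 < p) (hp1 : p < 1) (hr : 1 ≤ r) (hY : YuleSimonBound p r d M)
    (hψ : ExponentBound ψ r K κ) {s t u : ℝ} (hs : 2⁻¹ ≤ s) (hst : s ≤ t) (htu : t ≤ u) (hsu : s < u)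
    (hu : u ≤ 1) {l m R : ℝ} (hl : |l| ≤ R) (hm : |m| ≤ R) :
    ‖∫ ω, (ψ (l * (yuleSimon p t ω - yuleSimon p s ω) + m * (yuleSimon p u ω - yuleSimon p t ω))
        - ψ (l * (yuleSimon p t ω - yuleSimon p s ω))
        - ψ (m * (yuleSimon p u ω - yuleSimon p t ω))) ∂yuleSimonLaw‖
      ≤ 3 * (K * (R ^ r + κ)) * (M * (u - s) ^ (1 + d)) := by
  have hR : 0 ≤ R := (abs_nonneg l).trans hl
  have hK := hψ.K_nonneg
  have hκ := hψ.κ_nonneg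
  have hM := hY.M_pos
  have hus : 0 ≤ u - s := by linarith
  set E := {ω | yuleSimon p t ω ≠ yuleSimon p s ω ∧ yuleSimon p u ω ≠ yuleSimon p t ω} with hE
  set c := 3 * (K * (R ^ r + κ)) with hc
  have hc0 : 0 ≤ c := by positivity
  refine (norm_integral_le_lintegral_norm _).trans (ENNReal.toReal_le_of_le_ofReal (by positivity) ?_)
  have hnull : NullMeasurableSet E yuleSimonLaw := by
    have h1 : AEStronglyMeasurable (E.indicator fun _ => (1 : ℝ)) yuleSimonLaw := by
      classical
      have := aestronglyMeasurable_comp_yuleSimon hp hp1 (t := ![s, t, u])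
        (by simp [Fin.forall_fin_succ, hst.trans (htu.trans hu), htu.trans hu, hu])
        (fun v => if v 1 ≠ v 0 ∧ v 2 ≠ v 1 then (1 : ℝ) else 0)
      refine this.congr (ae_of_all _ fun ω => ?_)
      by_cases h : ω ∈ E
      · rw [Set.indicator_of_mem h]
        exact if_pos h
      · rw [Set.indicator_of_notMem h]
        exact if_neg h
    exact (aemeasurable_indicator_const_iff (1 : ℝ)).1 h1.aemeasurable
  calc _ ≤ ∫⁻ ω, E.indicator (fun ω => ENNReal.ofReal c
          * ENNReal.ofReal (|yuleSimon p u ω - yuleSimon p s ω| ^ r)) ω ∂yuleSimonLaw := by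
        apply lintegral_mono_ae
        filter_upwards [ae_isRegularSample hp hp1] with ω hω
        by_cases hωE : ω ∈ E
        · rw [Set.indicator_of_mem hωE, ← ENNReal.ofReal_mul hc0]
          apply ENNReal.ofReal_le_ofReal
          have h1 := hω.norm_exponent_le hp hψ hr hst htu hu hl hm
          have h2 := hω.norm_exponent_le hp hψ hr hst htu hu hl (m := 0) (by simpa using hR)
          have h3 := hω.norm_exponent_le hp hψ hr hst htu hu (l := 0) (by simpa using hR) hm
          rw [zero_mul, add_zero] at h2
          rw [zero_mul, zero_add] at h3
          refine (norm_sub_le _ _).trans ((add_le_add_left (norm_sub_le _ _) _).trans ?_)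
          rw [hc]
          linarith
        · rw [Set.indicator_of_notMem hωE]
          simp only [nonpos_iff_eq_zero, ENNReal.ofReal_eq_zero]
          simp only [hE, Set.mem_ofPred_eq, not_and_or, not_not] at hωE
          rcases hωE with h | h
          · simp [h, hψ.map_zero]
          · simp [h, hψ.map_zero]
    _ = ENNReal.ofReal c * ∫⁻ ω in E,
          ENNReal.ofReal (|yuleSimon p u ω - yuleSimon p s ω| ^ r) ∂yuleSimonLaw := by
        rw [lintegral_indicator₀ hnull, lintegral_const_mul' _ _ ENNReal.ofReal_ne_top]
    _ ≤ ENNReal.ofReal c * ENNReal.ofReal (M * (u - s) ^ (1 + d)) := by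
        gcongr
        exact hY.moment_two s t u hs hst htu hsu hu
    _ = _ := by rw [← ENNReal.ofReal_mul hc0]

end Integrals

section Tails

variable {Ω : Type*} [MeasurableSpace Ω] {μ : Measure Ω} {p r d M : ℝ}
  {ψ : ℝ → ℂ} {K κ : ℝ} {X : ℝ≥0 → Ω → ℝ}

/-- The joint characteristic function of two adjacent increments, with the last of the three times
as the time horizon. -/
lemma HasYuleSimonExponent.integral_three (hX : HasYuleSimonExponent p ψ X μ) {s t u : ℝ≥0}
    (hs : 0 < s) (hst : s < t) (htu : t < u) (l m : ℝ) :
    ∫ ω, Complex.exp (Complex.I * ((l * (X t ω - X s ω) + m * (X u ω - X t ω) : ℝ) : ℂ)) ∂μ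
      = Complex.exp ((u : ℝ) * ∫ y, ψ (l * (yuleSimon p (t / u) y - yuleSimon p (s / u) y)
          + m * (yuleSimon p (u / u) y - yuleSimon p (t / u) y)) ∂yuleSimonLaw) := by
  have h := hX.fdd 3 ![s, t, u] ![-l, l - m, m] u
    (by
      rw [Fin.strictMono_iff_lt_succ]
      simp [Fin.forall_fin_succ, hst, htu])
    (by simp [Fin.forall_fin_succ, hs, hs.trans hst, hs.trans (hst.trans htu)])
    (by simp [Fin.forall_fin_succ, (hst.trans htu).le, htu.le])
  have e1 : ∀ a b c : ℝ, ∑ i, (![-l, l - m, m] : Fin 3 → ℝ) i * (![a, b, c] : Fin 3 → ℝ) i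
      = l * (b - a) + m * (c - b) := by
    intro a b c
    simp [Fin.sum_univ_three]
    ring
  have e2 : ∀ ω, (fun i => X ((![s, t, u] : Fin 3 → ℝ≥0) i) ω) = ![X s ω, X t ω, X u ω] := by
    intro ω
    ext i
    fin_cases i <;> rfl
  have e3 : ∀ y, (fun i => yuleSimon p (((![s, t, u] : Fin 3 → ℝ≥0) i : ℝ) / u) y)
      = ![yuleSimon p (s / u) y, yuleSimon p (t / u) y, yuleSimon p (u / u) y] := by
    intro y
    ext i
    fin_cases i <;> rfl
  have e4 : ∀ ω, ∑ i, (![-l, l - m, m] : Fin 3 → ℝ) i * X ((![s, t, u] : Fin 3 → ℝ≥0) i) ω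
      = l * (X t ω - X s ω) + m * (X u ω - X t ω) := by
    intro ω
    rw [← e1, ← e2]
  have e5 : ∀ y, ∑ i, (![-l, l - m, m] : Fin 3 → ℝ) i
      * yuleSimon p (((![s, t, u] : Fin 3 → ℝ≥0) i : ℝ) / u) y
      = l * (yuleSimon p (t / u) y - yuleSimon p (s / u) y)
          + m * (yuleSimon p (u / u) y - yuleSimon p (t / u) y) := by
    intro y
    rw [← e1, ← e3]
  simp_rw [e4, e5] at h
  exact h

lemma HasYuleSimonExponent.integral_two (hX : HasYuleSimonExponent p ψ X μ) {s t : ℝ≥0}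
    (hs : 0 < s) (hst : s < t) (l : ℝ) :
    ∫ ω, Complex.exp (Complex.I * ((l * (X t ω - X s ω) : ℝ) : ℂ)) ∂μ
      = Complex.exp ((t : ℝ) * ∫ y, ψ (l * (yuleSimon p (t / t) y - yuleSimon p (s / t) y))
          ∂yuleSimonLaw) := by
  have h := hX.fdd 2 ![s, t] ![-l, l] t
    (by
      rw [Fin.strictMono_iff_lt_succ]
      simp [Fin.forall_fin_succ, hst])
    (by simp [Fin.forall_fin_succ, hs, hs.trans hst])
    (by simp [Fin.forall_fin_succ, hst.le])
  simp only [Fin.sum_univ_two, Matrix.cons_val_zero, Matrix.cons_val_one] at h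
  have e : ∀ a b : ℝ, -l * a + l * b = l * (b - a) := fun a b => by ring
  simp_rw [e] at h
  exact h

lemma HasYuleSimonExponent.integral_one (hX : HasYuleSimonExponent p ψ X μ) {t : ℝ≥0}
    (ht : 0 < t) (l : ℝ) :
    ∫ ω, Complex.exp (Complex.I * ((l * X t ω : ℝ) : ℂ)) ∂μ
      = Complex.exp ((t : ℝ) * ∫ y, ψ (l * yuleSimon p (t / t) y) ∂yuleSimonLaw) := by
  have h := hX.fdd 1 ![t] ![l] t (Subsingleton.strictMono _)
    (by simp [ht]) (by simp)
  simpa using h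

variable [IsProbabilityMeasure μ]

/-- Characteristic functions are bounded by `1`, so their exponents have nonpositive real parts. -/
lemma re_nonpos_of_exp_eq_integral {Z : Ω → ℝ} {z : ℂ}
    (h : ∫ ω, Complex.exp (Complex.I * (Z ω : ℂ)) ∂μ = Complex.exp z) : z.re ≤ 0 := by
  have h1 : ‖Complex.exp z‖ ≤ 1 := by
    rw [← h]
    refine (norm_integral_le_of_norm_le_const (C := 1) (ae_of_all _ fun ω => ?_)).trans (by simp)
    rw [mul_comm, Complex.norm_exp_ofReal_mul_I]
  rwa [Complex.norm_exp, Real.exp_le_one_iff] at h1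

/-- Chentsov-type bound: two adjacent increments are unlikely to be both large. -/
lemma HasYuleSimonExponent.measureReal_two_increments_le (hp : 0 < p) (hp1 : p < 1) (hr : 1 ≤ r)
    (hY : YuleSimonBound p r d M) (hψ : ExponentBound ψ r K κ) (hX : HasYuleSimonExponent p ψ X μ)
    {s t u : ℝ≥0} (hs : 0 < s) (hst : s < t) (htu : t < u) (hus : (u : ℝ) ≤ 2 * s) {x : ℝ}
    (hx : 0 < x) :
    μ.real {ω | x < |X t ω - X s ω| ∧ x < |X u ω - X t ω|}
      ≤ 4 * ((K * ((2 / x) ^ r + κ) * (M * (u - s))) ^ 2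
        + u * (3 * (K * ((2 / x) ^ r + κ)) * (M * ((u - s) / u) ^ (1 + d)))) := by
  have hu : (0 : ℝ) < u := by
    exact_mod_cast hs.trans (hst.trans htu)
  have e1 : (s : ℝ) / u ≤ t / u := by
    gcongr
  have e2 : (t : ℝ) / u ≤ u / u := by
    gcongr
  have e3 : (u : ℝ) / u ≤ 1 := (div_self hu.ne').le
  have e4 : (2 : ℝ)⁻¹ ≤ s / u := by
    rw [le_div_iff₀ hu]
    linarith
  have e5 : (s : ℝ) / u < u / u := by
    gcongr
    exact hst.trans htu
  have e6 : (u : ℝ) / u - s / u = (u - s) / u := by ring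
  set R := 2 / x with hRdef
  have hR : 0 < R := by positivity
  have hxR : x = 2 / R := by
    rw [hRdef]
    field_simp
  set A := fun ω => X t ω - X s ω with hA
  set B := fun ω => X u ω - X t ω with hB
  have hAm : Measurable A := (hX.measurable t).sub (hX.measurable s)
  have hBm : Measurable B := (hX.measurable u).sub (hX.measurable t)
  have hmain := measureReal_two_abs_gt_le (μ := μ) hAm hBm (R := R)
    (D := (K * (R ^ r + κ) * (M * (u - s))) ^ 2
        + u * (3 * (K * (R ^ r + κ)) * (M * ((u - s) / u) ^ (1 + d)))) hR ?_
  · rw [← hxR] at hmain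
    exact hmain
  intro l m hl hm
  have hF := hX.integral_three hs hst htu l m
  have hf := hX.integral_three hs hst htu l 0
  have hg := hX.integral_three hs hst htu 0 m
  have hFre := re_nonpos_of_exp_eq_integral hF
  have hfre := re_nonpos_of_exp_eq_integral hf
  have hgre := re_nonpos_of_exp_eq_integral hg
  have hR0 : |(0 : ℝ)| ≤ R := by simpa using hR.le
  have hfn := norm_integral_exponent_le hp hp1 hr hY hψ e1 e2 e3 hl hR0
  have hgn := norm_integral_exponent_le hp hp1 hr hY hψ e1 e2 e3 hR0 hm
  have hFi := integrable_exponent hp hp1 hr hY hψ e1 e2 e3 l m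
  have hfi := integrable_exponent hp hp1 hr hY hψ e1 e2 e3 l 0
  have hgi := integrable_exponent hp hp1 hr hY hψ e1 e2 e3 0 m
  have hd := norm_integral_interaction_le hp hp1 hr hY hψ e4 e1 e2 e5 e3 hl hm
  simp only [zero_mul, add_zero, zero_add] at hf hg hfre hgre hfn hgn hfi hgi
  have hFfi : Integrable (fun ω => ψ (l * (yuleSimon p (t / u) ω - yuleSimon p (s / u) ω)
      + m * (yuleSimon p (u / u) ω - yuleSimon p (t / u) ω))
      - ψ (l * (yuleSimon p (t / u) ω - yuleSimon p (s / u) ω))) yuleSimonLaw := hFi.sub hfi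
  rw [integral_sub hFfi hgi, integral_sub hFi hfi] at hd
  rw [e6] at hfn hgn hd
  have hexp : ∫ ω, (1 - Complex.exp (Complex.I * ((l * A ω : ℝ) : ℂ)))
        * (1 - Complex.exp (Complex.I * ((m * B ω : ℝ) : ℂ))) ∂μ
      = 1 - ∫ ω, Complex.exp (Complex.I * ((l * A ω : ℝ) : ℂ)) ∂μ
        - ∫ ω, Complex.exp (Complex.I * ((m * B ω : ℝ) : ℂ)) ∂μ
        + ∫ ω, Complex.exp (Complex.I * ((l * A ω + m * B ω : ℝ) : ℂ)) ∂μ := by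
    have hint : ∀ Z : Ω → ℝ, Measurable Z →
        Integrable (fun ω => Complex.exp (Complex.I * (Z ω : ℂ))) μ := by
      intro Z hZ
      refine Integrable.of_bound (C := 1) (Measurable.aestronglyMeasurable (by fun_prop))
        (ae_of_all _ fun ω => ?_)
      rw [mul_comm, Complex.norm_exp_ofReal_mul_I]
    have i1 := hint _ (hAm.const_mul l)
    have i2 := hint _ (hBm.const_mul m)
    have i3 := hint (fun ω => l * A ω + m * B ω) ((hAm.const_mul l).add (hBm.const_mul m))
    have i0 : Integrable (fun _ : Ω => (1 : ℂ)) μ := integrable_const _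
    have hpt : ∀ ω, (1 - Complex.exp (Complex.I * ((l * A ω : ℝ) : ℂ)))
        * (1 - Complex.exp (Complex.I * ((m * B ω : ℝ) : ℂ)))
        = 1 - Complex.exp (Complex.I * ((l * A ω : ℝ) : ℂ))
          - Complex.exp (Complex.I * ((m * B ω : ℝ) : ℂ))
          + Complex.exp (Complex.I * ((l * A ω + m * B ω : ℝ) : ℂ)) := by
      intro ω
      rw [Complex.ofReal_add, mul_add, Complex.exp_add]
      ring
    simp_rw [hpt]
    have i4 : Integrable (fun ω => 1 - Complex.exp (Complex.I * ((l * A ω : ℝ) : ℂ))) μ := i0.sub i1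
    have i5 : Integrable (fun ω => 1 - Complex.exp (Complex.I * ((l * A ω : ℝ) : ℂ))
      - Complex.exp (Complex.I * ((m * B ω : ℝ) : ℂ))) μ := i4.sub i2
    rw [integral_add i5 i3, integral_sub i4 i2, integral_sub i0 i1]
    simp
  rw [hexp, hF, hf, hg]
  refine (norm_second_difference_exp_le hfre hgre hFre).trans ?_
  rw [← mul_sub, ← mul_sub, norm_mul, norm_mul, norm_mul, Complex.norm_real, Real.norm_of_nonneg hu.le]
  have hscale : ∀ a : ℝ, a ≤ K * (R ^ r + κ) * (M * ((u - s) / u)) →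
      u * a ≤ K * (R ^ r + κ) * (M * (u - s)) := by
    intro a ha
    refine (mul_le_mul_of_nonneg_left ha hu.le).trans (le_of_eq ?_)
    field_simp
  have hsq := mul_le_mul (hscale _ hfn) (hscale _ hgn) (by positivity)
    (le_trans (by positivity) (hscale _ hfn))
  rw [← sq] at hsq
  exact add_le_add hsq (mul_le_mul_of_nonneg_left hd hu.le)

lemma HasYuleSimonExponent.measureReal_increment_le (hp : 0 < p) (hp1 : p < 1) (hr : 1 ≤ r)
    (hY : YuleSimonBound p r d M) (hψ : ExponentBound ψ r K κ) (hX : HasYuleSimonExponent p ψ X μ)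
    {s t : ℝ≥0} (hs : 0 < s) (hst : s < t) {x : ℝ} (hx : 0 < x) :
    μ.real {ω | x < |X t ω - X s ω|} ≤ 2 * (K * ((2 / x) ^ r + κ) * (M * (t - s))) := by
  have ht : (0 : ℝ) < t := by
    exact_mod_cast hs.trans hst
  have e1 : (s : ℝ) / t ≤ t / t := by
    gcongr
  have e3 : (t : ℝ) / t ≤ 1 := (div_self ht.ne').le
  set R := 2 / x with hRdef
  have hR : 0 < R := by positivity
  have hxR : x = 2 / R := by
    rw [hRdef]
    field_simp
  have hmain := measureReal_abs_gt_le (μ := μ) ((hX.measurable t).sub (hX.measurable s)) (R := R)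
    (D := K * (R ^ r + κ) * (M * (t - s))) hR ?_
  · rw [← hxR] at hmain
    exact hmain
  intro l hl
  have hf := hX.integral_two hs hst l
  have hfre := re_nonpos_of_exp_eq_integral hf
  have hfn := norm_integral_exponent_le hp hp1 hr hY hψ e1 le_rfl e3 hl (m := 0) (by simpa using hR.le)
  simp only [zero_mul, add_zero] at hfn
  simp only [Pi.sub_apply]
  rw [hf, ← Complex.exp_zero]
  refine (norm_exp_sub_exp_le (by simp) hfre).trans ?_
  rw [zero_sub, norm_neg, norm_mul, Complex.norm_real, Real.norm_of_nonneg ht.le]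
  refine (mul_le_mul_of_nonneg_left hfn ht.le).trans (le_of_eq ?_)
  field_simp

lemma HasYuleSimonExponent.measureReal_le (hp : 0 < p) (hp1 : p < 1) (hr : 1 ≤ r)
    (hY : YuleSimonBound p r d M) (hψ : ExponentBound ψ r K κ) (hX : HasYuleSimonExponent p ψ X μ)
    {t : ℝ≥0} (ht : 0 < t) {x : ℝ} (hx : 0 < x) :
    μ.real {ω | x < |X t ω|} ≤ 2 * (K * ((2 / x) ^ r + κ) * (M * t)) := by
  have ht' : (0 : ℝ) < t := by exact_mod_cast ht
  set R := 2 / x with hRdef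
  have hR : 0 < R := by positivity
  have hxR : x = 2 / R := by
    rw [hRdef]
    field_simp
  have hmain := measureReal_abs_gt_le (μ := μ) (hX.measurable t) (R := R)
    (D := K * (R ^ r + κ) * (M * t)) hR ?_
  · rw [← hxR] at hmain
    exact hmain
  intro l hl
  have hf := hX.integral_one ht l
  have hfre := re_nonpos_of_exp_eq_integral hf
  have hfn := norm_integral_exponent_le hp hp1 hr hY hψ zero_le_one le_rfl le_rfl hl (m := 0)
    (by simpa using hR.le)
  have hzero : ∀ᵐ y ∂yuleSimonLaw, yuleSimon p 0 y = 0 := by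
    filter_upwards [ae_isRegularSample hp hp1] with y hy
    rw [yuleSimon, if_neg (not_le.2 hy.pos)]
  have hcongr : ∫ y, ψ (l * (yuleSimon p 1 y - yuleSimon p 0 y) + 0 * (yuleSimon p 1 y - yuleSimon p 1 y))
      ∂yuleSimonLaw = ∫ y, ψ (l * yuleSimon p (t / t) y) ∂yuleSimonLaw := by
    apply integral_congr_ae
    filter_upwards [hzero] with y hy
    rw [hy, div_self ht'.ne']
    simp
  rw [hcongr] at hfn
  rw [hf, ← Complex.exp_zero]
  refine (norm_exp_sub_exp_le (by simp) hfre).trans ?_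
  rw [zero_sub, norm_neg, norm_mul, Complex.norm_real, Real.norm_of_nonneg ht'.le]
  refine (mul_le_mul_of_nonneg_left hfn ht'.le).trans (le_of_eq ?_)
  ring

end Tails

/-! ### Dyadic estimates -/

/-- The dyadic rational `i / 2 ^ n`. -/
noncomputable def dyadic (n i : ℕ) : ℝ≥0 := (i : ℝ≥0) / 2 ^ n

lemma coe_dyadic (n i : ℕ) : (dyadic n i : ℝ) = i / 2 ^ n := by
  simp [dyadic]

lemma dyadic_succ_two_mul (n i : ℕ) : dyadic (n + 1) (2 * i) = dyadic n i := by
  rw [← NNReal.coe_inj, coe_dyadic, coe_dyadic]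
  push_cast
  field_simp
  ring

lemma dyadic_pos {n i : ℕ} (hi : 1 ≤ i) : 0 < dyadic n i := by
  have : (0 : ℝ≥0) < i := by exact_mod_cast hi
  unfold dyadic
  positivity

lemma dyadic_lt_dyadic {n i j : ℕ} (hij : i < j) : dyadic n i < dyadic n j := by
  unfold dyadic
  gcongr

/-- The event that, at level `n`, the process violates one of the two requirements on which chaining
rests: on each dyadic interval of level `n` contained in `(0, 1]`, one of the two half-increments
is at most `x θ ^ n`; and the value at time `2 ^ (-n)` is at most `x θ ^ n`. -/
def badEvent {Ω : Type*} (X : ℝ≥0 → Ω → ℝ) (θ x : ℝ) (n : ℕ) : Set Ω :=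
  {ω | x * θ ^ n < |X (dyadic n 1) ω|} ∪ ⋃ i ∈ Finset.Ico 1 (2 ^ n),
    {ω | x * θ ^ n < |X (dyadic (n + 1) (2 * i + 1)) ω - X (dyadic n i) ω|
      ∧ x * θ ^ n < |X (dyadic n (i + 1)) ω - X (dyadic (n + 1) (2 * i + 1)) ω|}

lemma sum_rpow_neg_le {d : ℝ} (hd0 : 0 < d) (hd1 : d < 1) (N : ℕ) :
    ∑ i ∈ Finset.range N, ((i : ℝ) + 1) ^ (-d) ≤ (1 - d)⁻¹ * (N : ℝ) ^ (1 - d) := by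
  have hd : 0 < 1 - d := by linarith
  induction N with
  | zero => simp [Real.zero_rpow hd.ne']
  | succ N ih =>
    rw [Finset.sum_range_succ]
    have hN : (0 : ℝ) < N + 1 := by positivity
    have h1 := rpow_one_add_le_one_add_mul_self (s := -((N : ℝ) + 1)⁻¹)
      (by rw [neg_le_neg_iff]; exact inv_le_one_of_one_le₀ (by linarith [N.cast_nonneg (α := ℝ)]))
      hd.le (by linarith : 1 - d ≤ 1)
    have h2 : 1 + -((N : ℝ) + 1)⁻¹ = N / (N + 1) := by
      field_simp
      ring
    rw [h2, Real.div_rpow (by positivity) hN.le, div_le_iff₀ (by positivity)] at h1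
    have h3 : ((N : ℝ) + 1) ^ (1 - d) = ((N : ℝ) + 1) * ((N : ℝ) + 1) ^ (-d) := by
      rw [sub_eq_add_neg, Real.rpow_add hN, Real.rpow_one]
    have h4 : (1 + (1 - d) * -((N : ℝ) + 1)⁻¹) * ((N : ℝ) + 1) ^ (1 - d)
        = ((N : ℝ) + 1) ^ (1 - d) - (1 - d) * ((N : ℝ) + 1) ^ (-d) := by
      rw [h3]
      field_simp
      ring
    rw [h4] at h1
    push_cast
    have h5 : ((N : ℝ) + 1) ^ (-d) ≤ (1 - d)⁻¹ * (((N : ℝ) + 1) ^ (1 - d) - (N : ℝ) ^ (1 - d)) := by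
      rw [le_inv_mul_iff₀ hd]
      linarith
    linarith

section BadEvent

variable {Ω : Type*} [MeasurableSpace Ω] {μ : Measure Ω} [IsProbabilityMeasure μ] {p r d M : ℝ}
  {ψ : ℝ → ℂ} {K κ : ℝ} {X : ℝ≥0 → Ω → ℝ}

/-- The bound for two adjacent increments, on the two halves of the `i`-th dyadic interval of level
`n`. The length of this interval relative to its position is `1 / (i + 1)`, whence the factor
`(i + 1) ^ (-d)`, which makes the sum over `i` of order `2 ^ (-d n)`. -/
lemma HasYuleSimonExponent.measureReal_dyadic_increments_le (hp : 0 < p) (hp1 : p < 1) (hr : 1 ≤ r)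
    (hY : YuleSimonBound p r d M) (hψ : ExponentBound ψ r K κ) (hX : HasYuleSimonExponent p ψ X μ)
    {y : ℝ} (hy : 0 < y) {n i : ℕ} (hi : i ∈ Finset.Ico 1 (2 ^ n)) :
    μ.real {ω | y < |X (dyadic (n + 1) (2 * i + 1)) ω - X (dyadic n i) ω|
        ∧ y < |X (dyadic n (i + 1)) ω - X (dyadic (n + 1) (2 * i + 1)) ω|}
      ≤ 4 * (M ^ 2 + 3 * M) * (K * ((2 / y) ^ r + κ) + (K * ((2 / y) ^ r + κ)) ^ 2)
        * ((2 ^ n)⁻¹ * ((i : ℝ) + 1) ^ (-d)) := by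
  have hd0 := hY.d_pos
  have hd1 := hY.d_lt_one
  have hM := hY.M_pos
  have hK := hψ.K_nonneg
  have hκ := hψ.κ_nonneg
  rw [Finset.mem_Ico] at hi
  have hi1 : (1 : ℝ) ≤ i := by exact_mod_cast hi.1
  have hi2 : (i : ℝ) + 1 ≤ 2 ^ n := by exact_mod_cast hi.2
  have e1 : dyadic n i < dyadic (n + 1) (2 * i + 1) := by
    rw [← dyadic_succ_two_mul]
    exact dyadic_lt_dyadic (by omega)
  have e2 : dyadic (n + 1) (2 * i + 1) < dyadic n (i + 1) := by
    rw [← dyadic_succ_two_mul n (i + 1)]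
    exact dyadic_lt_dyadic (by omega)
  have e3 : (dyadic n (i + 1) : ℝ) ≤ 2 * dyadic n i := by
    rw [coe_dyadic, coe_dyadic, mul_div_assoc']
    push_cast
    gcongr
    linarith
  refine (hX.measureReal_two_increments_le hp hp1 hr hY hψ (dyadic_pos hi.1) e1 e2 e3 hy).trans ?_
  set h : ℝ := (2 ^ n)⁻¹ with hh
  have hh0 : 0 < h := by positivity
  have e4 : (dyadic n (i + 1) : ℝ) = (i + 1) * h := by
    rw [coe_dyadic, hh]
    push_cast
    rfl
  have e5 : (dyadic n (i + 1) : ℝ) - dyadic n i = h := by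
    rw [e4, coe_dyadic, hh]
    ring
  have e6 : h / ((i + 1) * h) = ((i : ℝ) + 1)⁻¹ := by
    field_simp
  have e7 : (((i : ℝ) + 1)⁻¹) ^ (1 + d) = ((i : ℝ) + 1)⁻¹ * ((i : ℝ) + 1) ^ (-d) := by
    rw [Real.rpow_add (by positivity), Real.rpow_one, Real.inv_rpow (by positivity),
      Real.rpow_neg (by positivity)]
  have e8 : h ≤ ((i : ℝ) + 1) ^ (-d) := by
    calc h ≤ ((i : ℝ) + 1)⁻¹ := inv_anti₀ (by positivity) hi2
      _ = ((i : ℝ) + 1) ^ (-1 : ℝ) := by rw [Real.rpow_neg_one]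
      _ ≤ _ := Real.rpow_le_rpow_of_exponent_le (by linarith) (by linarith)
  rw [e5, e4, e6, e7]
  have hQ0 : 0 ≤ K * ((2 / y) ^ r + κ) := by positivity
  generalize K * ((2 / y) ^ r + κ) = Q at hQ0 ⊢
  have hw0 : 0 ≤ ((i : ℝ) + 1) ^ (-d) := by positivity
  generalize ((i : ℝ) + 1) ^ (-d) = w at e8 hw0 ⊢
  have e9 : ((i : ℝ) + 1) * h * (3 * Q * (M * (((i : ℝ) + 1)⁻¹ * w))) = 3 * M * Q * (h * w) := by
    field_simp
  rw [e9]
  have e10 : M ^ 2 * Q ^ 2 * (h * h) ≤ M ^ 2 * Q ^ 2 * (h * w) :=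
    mul_le_mul_of_nonneg_left (mul_le_mul_of_nonneg_left e8 hh0.le) (by positivity)
  have e11 : 0 ≤ M ^ 2 * Q * (h * w) := by positivity
  have e12 : 0 ≤ M * Q ^ 2 * (h * w) := by positivity
  linear_combination 4 * e10 + 4 * e11 + 12 * e12

/-- The bad events of level `n` have geometrically small probabilities. The ratio
`θ = 2 ^ (-d / (4 r))` is so close to `1` that the loss `θ ^ (-2 r n)` incurred by the shrinking thresholds is
compensated by the gain `2 ^ (-d n)` of the estimate for two adjacent increments. -/
lemma measureReal_badEvent_le (hp : 0 < p) (hp1 : p < 1) (hr : 1 ≤ r)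
    (hY : YuleSimonBound p r d M) (hψ : ExponentBound ψ r K κ) (hX : HasYuleSimonExponent p ψ X μ)
    {x : ℝ} (hx : 0 < x) (n : ℕ) :
    μ.real (badEvent X (2 ^ (-(d / (4 * r)))) x n)
      ≤ (2 * M + 4 * (M ^ 2 + 3 * M) * (1 - d)⁻¹) * ((K + K ^ 2)
        * (((2 / x) ^ r + κ) + ((2 / x) ^ r + κ) ^ 2)) * ((2 : ℝ) ^ (-(d / 2))) ^ n := by
  have hd0 := hY.d_pos
  have hd1 := hY.d_lt_one
  have hM := hY.M_pos
  have hK := hψ.K_nonneg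
  have hκ := hψ.κ_nonneg
  have hr0 : 0 < r := by linarith
  set θ : ℝ := 2 ^ (-(d / (4 * r))) with hθ
  have hθ0 : 0 < θ := by positivity
  set G := (2 / x) ^ r + κ with hG
  have hG0 : 0 ≤ G := by positivity
  set a : ℝ := 2 ^ (d / 4) with ha
  have ha1 : 1 ≤ a := Real.one_le_rpow one_le_two (by positivity)
  have hθr : θ ^ r = a⁻¹ := by
    rw [hθ, ha, ← Real.rpow_mul two_pos.le, ← Real.rpow_neg two_pos.le]
    congr 1
    field_simp
  have han : 1 ≤ a ^ n := one_le_pow₀ ha1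
  set H := (2 / (x * θ ^ n)) ^ r + κ with hH
  have hH0 : 0 ≤ H := by positivity
  have hHG : H ≤ a ^ n * G := by
    have h1 : (2 / (x * θ ^ n)) ^ r = (2 / x) ^ r * a ^ n := by
      rw [← div_div, Real.div_rpow (by positivity) (by positivity), ← Real.rpow_natCast θ,
        ← Real.rpow_mul hθ0.le, mul_comm (n : ℝ), Real.rpow_mul hθ0.le, hθr, Real.rpow_natCast,
        inv_pow, div_inv_eq_mul]
    rw [hH, h1, hG]
    nlinarith
  have hHG2 : H + H ^ 2 ≤ (a ^ n) ^ 2 * (G + G ^ 2) := by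
    have h1 : H ^ 2 ≤ (a ^ n * G) ^ 2 := by gcongr
    have h2 : a ^ n * G ≤ (a ^ n) ^ 2 * G := by
      apply mul_le_mul_of_nonneg_right _ hG0
      nlinarith
    nlinarith
  set L := (K + K ^ 2) * (G + G ^ 2) with hL
  have hL0 : 0 ≤ L := by positivity
  set h : ℝ := (2 ^ n)⁻¹ with hh
  have hh0 : 0 < h := by positivity
  have hKH : K * H ≤ (a ^ n) ^ 2 * L ∧ K * H + (K * H) ^ 2 ≤ (a ^ n) ^ 2 * L := by
    have h1 : (K + K ^ 2) * (H + H ^ 2) ≤ (K + K ^ 2) * ((a ^ n) ^ 2 * (G + G ^ 2)) :=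
      mul_le_mul_of_nonneg_left hHG2 (by positivity)
    have h2 : 0 ≤ K * H ^ 2 := by positivity
    have h3 : 0 ≤ K ^ 2 * H := by positivity
    have h4 : 0 ≤ (K * H) ^ 2 := by positivity
    rw [hL]
    constructor <;> nlinarith
  have hpow : (a ^ n) ^ 2 * (h * ((2 : ℝ) ^ n) ^ (1 - d)) = ((2 : ℝ) ^ (-(d / 2))) ^ n := by
    have h1 : h * ((2 : ℝ) ^ n) ^ (1 - d) = ((2 : ℝ) ^ (-d)) ^ n := by
      rw [hh, sub_eq_add_neg, Real.rpow_add (by positivity), Real.rpow_one, ← mul_assoc,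
        inv_mul_cancel₀ (by positivity), one_mul, ← Real.rpow_natCast, ← Real.rpow_natCast,
        ← Real.rpow_mul two_pos.le, ← Real.rpow_mul two_pos.le, mul_comm]
    rw [h1, ← pow_mul, mul_comm n 2, pow_mul, ← mul_pow]
    congr 1
    rw [ha, ← Real.rpow_natCast, ← Real.rpow_mul two_pos.le, ← Real.rpow_add two_pos]
    congr 1
    push_cast
    ring
  have h2n : (1 : ℝ) ≤ 2 ^ n := one_le_pow₀ one_le_two
  have hfirst : μ.real {ω | x * θ ^ n < |X (dyadic n 1) ω|}
      ≤ 2 * M * L * ((2 : ℝ) ^ (-(d / 2))) ^ n := by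
    refine (hX.measureReal_le hp hp1 hr hY hψ (dyadic_pos le_rfl)
      (by positivity : 0 < x * θ ^ n)).trans ?_
    rw [coe_dyadic, ← hH, ← hpow, Nat.cast_one, one_div, ← hh]
    have h1 : (1 : ℝ) ≤ ((2 : ℝ) ^ n) ^ (1 - d) := Real.one_le_rpow h2n (by linarith)
    calc 2 * (K * H * (M * h)) = 2 * M * (K * H) * (h * 1) := by ring
      _ ≤ 2 * M * ((a ^ n) ^ 2 * L) * (h * ((2 : ℝ) ^ n) ^ (1 - d)) := by
        refine mul_le_mul (mul_le_mul_of_nonneg_left hKH.1 (by positivity))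
          (mul_le_mul_of_nonneg_left h1 hh0.le) (by positivity) (by positivity)
      _ = _ := by ring
  have hsecond : ∀ i ∈ Finset.Ico 1 (2 ^ n),
      μ.real {ω | x * θ ^ n < |X (dyadic (n + 1) (2 * i + 1)) ω - X (dyadic n i) ω|
        ∧ x * θ ^ n < |X (dyadic n (i + 1)) ω - X (dyadic (n + 1) (2 * i + 1)) ω|}
      ≤ 4 * (M ^ 2 + 3 * M) * ((a ^ n) ^ 2 * L) * h * ((i : ℝ) + 1) ^ (-d) := by
    intro i hi
    refine (hX.measureReal_dyadic_increments_le hp hp1 hr hY hψ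
      (by positivity : 0 < x * θ ^ n) hi).trans ?_
    rw [← hH, ← hh, mul_assoc _ h]
    exact mul_le_mul_of_nonneg_right (mul_le_mul_of_nonneg_left hKH.2 (by positivity))
      (by positivity)
  have hsum : ∑ i ∈ Finset.Ico (1 : ℕ) (2 ^ n), ((i : ℝ) + 1) ^ (-d)
      ≤ (1 - d)⁻¹ * ((2 : ℝ) ^ n) ^ (1 - d) := by
    have h1 := sum_rpow_neg_le hd0 hd1 (2 ^ n)
    push_cast at h1
    refine le_trans (Finset.sum_le_sum_of_subset_of_nonneg ?_ fun i _ _ => by positivity) h1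
    rw [Finset.range_eq_Ico]
    exact Finset.Ico_subset_Ico_left zero_le_one
  have hdinv : 0 < (1 - d)⁻¹ := inv_pos.2 (by linarith)
  calc μ.real (badEvent X θ x n)
      ≤ 2 * M * L * ((2 : ℝ) ^ (-(d / 2))) ^ n
        + ∑ i ∈ Finset.Ico (1 : ℕ) (2 ^ n), 4 * (M ^ 2 + 3 * M) * ((a ^ n) ^ 2 * L) * h * ((i : ℝ) + 1) ^ (-d) :=
        (measureReal_union_le _ _).trans (add_le_add hfirst
          ((measureReal_biUnion_finset_le _ _).trans (Finset.sum_le_sum hsecond)))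
    _ ≤ 2 * M * L * ((2 : ℝ) ^ (-(d / 2))) ^ n
        + 4 * (M ^ 2 + 3 * M) * ((a ^ n) ^ 2 * L) * h * ((1 - d)⁻¹ * ((2 : ℝ) ^ n) ^ (1 - d)) := by
        rw [← Finset.mul_sum]
        exact add_le_add le_rfl (mul_le_mul_of_nonneg_left hsum (by positivity))
    _ = _ := by
        rw [← hpow]
        ring

end BadEvent

/-! ### Chaining along dyadic intervals -/

/-- The set of nonnegative dyadic rationals. -/
def dyadics : Set ℝ≥0 := {x | ∃ n i, x = dyadic n i}

lemma dyadic_add (n k i : ℕ) : dyadic (n + k) (i * 2 ^ k) = dyadic n i := by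
  rw [← NNReal.coe_inj, coe_dyadic, coe_dyadic]
  push_cast
  rw [pow_add]
  field_simp

lemma dyadic_le_dyadic_iff {n i j : ℕ} : dyadic n i ≤ dyadic n j ↔ i ≤ j := by
  rw [← NNReal.coe_le_coe, coe_dyadic, coe_dyadic, div_le_div_iff_of_pos_right (by positivity)]
  exact Nat.cast_le

/-- From level `m` on, the function `f` satisfies on each dyadic interval of `(0, 1]` the requirement
of the chaining argument, with threshold `a n` at level `n`: the value at the midpoint is close to
the value at one of the endpoints. On the interval adjoining the origin, the value at the right
endpoint `2 ^ (-n)` is small instead. -/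
def IsChainable (f : ℝ≥0 → ℝ) (a : ℕ → ℝ) (m : ℕ) : Prop :=
  ∀ n, m ≤ n → |f (dyadic n 1)| ≤ a n ∧ ∀ i, 1 ≤ i → i < 2 ^ n →
    |f (dyadic (n + 1) (2 * i + 1)) - f (dyadic n i)| ≤ a n
      ∨ |f (dyadic n (i + 1)) - f (dyadic (n + 1) (2 * i + 1))| ≤ a n

section Chaining

variable {f : ℝ≥0 → ℝ} {a A : ℕ → ℝ} {m : ℕ}

/-- On each dyadic interval, a chainable function has at most one large jump: to the left of some
cut it stays close to its value at the left endpoint, to the right of the cut it stays close to its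
value at the right endpoint. The proof bisects the interval: the half whose endpoints have close
values does not contain the cut. -/
lemma IsChainable.exists_cut (hf : IsChainable f a m) (hA0 : ∀ n, 0 ≤ A n)
    (hA : ∀ n, a n + A (n + 1) ≤ A n) (k : ℕ) : ∀ n i, m ≤ n → 1 ≤ i → i < 2 ^ n →
    ∃ c, ∀ j, i * 2 ^ k ≤ j → j ≤ (i + 1) * 2 ^ k →
      (j < c → |f (dyadic (n + k) j) - f (dyadic n i)| ≤ A n)
        ∧ (c ≤ j → |f (dyadic (n + k) j) - f (dyadic n (i + 1))| ≤ A n) := by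
  induction k with
  | zero =>
    intro n i _ _ _
    refine ⟨i + 1, fun j h1 h2 => ⟨fun h3 => ?_, fun h3 => ?_⟩⟩
    · have : j = i := by omega
      subst this
      simpa using hA0 n
    · have : j = i + 1 := by omega
      subst this
      simpa using hA0 n
  | succ k ih =>
    intro n i hn hi1 hi2
    obtain ⟨c1, hc1⟩ := ih (n + 1) (2 * i) (by omega) (by omega) (by rw [pow_succ]; omega)
    obtain ⟨c2, hc2⟩ := ih (n + 1) (2 * i + 1) (by omega) (by omega) (by rw [pow_succ]; omega)
    have e1 : n + 1 + k = n + (k + 1) := by ring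
    have e2 : dyadic (n + 1) (2 * i + 1 + 1) = dyadic n (i + 1) := dyadic_succ_two_mul n (i + 1)
    rw [e1, dyadic_succ_two_mul] at hc1
    rw [e1, e2] at hc2
    have e3 : i * 2 ^ (k + 1) = 2 * i * 2 ^ k := by ring
    have e4 : (i + 1) * 2 ^ (k + 1) = (2 * i + 1 + 1) * 2 ^ k := by ring
    have hAn := hA n
    have ha : 0 ≤ A (n + 1) := hA0 _
    rw [e3, e4]
    set M := (2 * i + 1) * 2 ^ k with hM
    set v := f (dyadic (n + 1) (2 * i + 1)) with hv
    -- If the left half has close endpoint values, the cut of the right half serves for both halves.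
    rcases (hf n hn).2 i hi1 hi2 with h | h
    · have hann : 0 ≤ a n := (abs_nonneg _).trans h
      refine ⟨max c2 M, fun j h1 h2 => ⟨fun h3 => ?_, fun h3 => ?_⟩⟩
      · have hnear : |f (dyadic (n + (k + 1)) j) - v| ≤ A (n + 1) →
            |f (dyadic (n + (k + 1)) j) - f (dyadic n i)| ≤ A n := fun h' => by
          have := abs_sub_le (f (dyadic (n + (k + 1)) j)) v (f (dyadic n i))
          linarith
        rcases le_total j M with h4 | h4
        · rcases lt_or_ge j c1 with h5 | h5
          · exact ((hc1 j h1 h4).1 h5).trans (by linarith)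
          · exact hnear ((hc1 j h1 h4).2 h5)
        · exact hnear ((hc2 j h4 h2).1 (by omega))
      · exact ((hc2 j (by omega) h2).2 (by omega)).trans (by linarith)
    · have hann : 0 ≤ a n := (abs_nonneg _).trans h
      refine ⟨min c1 M, fun j h1 h2 => ⟨fun h3 => ?_, fun h3 => ?_⟩⟩
      · exact ((hc1 j h1 (by omega)).1 (by omega)).trans (by linarith)
      · have hnear : |f (dyadic (n + (k + 1)) j) - v| ≤ A (n + 1) →
            |f (dyadic (n + (k + 1)) j) - f (dyadic n (i + 1))| ≤ A n := fun h' => by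
          have := abs_sub_le (f (dyadic (n + (k + 1)) j)) v (f (dyadic n (i + 1)))
          rw [abs_sub_comm] at h
          linarith
        rcases le_or_gt M j with h4 | h4
        · rcases lt_or_ge j c2 with h5 | h5
          · exact hnear ((hc2 j h4 h2).1 h5)
          · exact ((hc2 j h4 h2).2 h5).trans (by linarith)
        · exact hnear ((hc1 j h1 h4.le).2 (by omega))

lemma exists_common_level {x y z : ℝ≥0} (hx : x ∈ dyadics) (hy : y ∈ dyadics) (hz : z ∈ dyadics)
    (n : ℕ) : ∃ k j₁ j₂ j₃, x = dyadic (n + k) j₁ ∧ y = dyadic (n + k) j₂ ∧ z = dyadic (n + k) j₃ := by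
  obtain ⟨n1, i1, rfl⟩ := hx
  obtain ⟨n2, i2, rfl⟩ := hy
  obtain ⟨n3, i3, rfl⟩ := hz
  refine ⟨n1 + n2 + n3, i1 * 2 ^ (n + n2 + n3), i2 * 2 ^ (n + n1 + n3), i3 * 2 ^ (n + n1 + n2), ?_, ?_, ?_⟩
  · rw [← dyadic_add n1 (n + n2 + n3)]
    congr 1
    ring
  · rw [← dyadic_add n2 (n + n1 + n3)]
    congr 1
    ring
  · rw [← dyadic_add n3 (n + n1 + n2)]
    congr 1
    ring

/-- Of two adjacent increments between dyadic points of a dyadic interval, one is small, since the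
cut lies inside at most one of them. -/
lemma IsChainable.exists_cut_dyadics (hf : IsChainable f a m) (hA0 : ∀ n, 0 ≤ A n)
    (hA : ∀ n, a n + A (n + 1) ≤ A n) {n i : ℕ} (hn : m ≤ n) (hi1 : 1 ≤ i) (hi2 : i < 2 ^ n)
    {x y z : ℝ≥0} (hx : x ∈ dyadics) (hy : y ∈ dyadics) (hz : z ∈ dyadics) (hix : dyadic n i ≤ x)
    (hxy : x ≤ y) (hyz : y ≤ z) (hzi : z ≤ dyadic n (i + 1)) :
    |f y - f x| ≤ 2 * A n ∨ |f z - f y| ≤ 2 * A n := by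
  obtain ⟨k, j1, j2, j3, rfl, rfl, rfl⟩ := exists_common_level hx hy hz n
  obtain ⟨c, hc⟩ := hf.exists_cut hA0 hA k n i hn hi1 hi2
  rw [← dyadic_add n k, dyadic_le_dyadic_iff] at hix hzi
  rw [dyadic_le_dyadic_iff] at hxy hyz
  rcases lt_or_ge j2 c with h | h
  · left
    have h1 := (hc j1 (by omega) (by omega)).1 (by omega)
    have h2 := (hc j2 (by omega) (by omega)).1 h
    have := abs_sub_le (f (dyadic (n + k) j2)) (f (dyadic n i)) (f (dyadic (n + k) j1))
    rw [abs_sub_comm] at h1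
    linarith
  · right
    have h1 := (hc j2 (by omega) (by omega)).2 h
    have h2 := (hc j3 (by omega) (by omega)).2 (by omega)
    have := abs_sub_le (f (dyadic (n + k) j3)) (f (dyadic n (i + 1))) (f (dyadic (n + k) j2))
    rw [abs_sub_comm] at h1
    linarith

/-- Chaining up to the origin: a chainable function is small near the origin. -/
lemma IsChainable.abs_le (hf : IsChainable f a m) (hA0 : ∀ n, 0 ≤ A n)
    (hA : ∀ n, a n + A (n + 1) ≤ A n) {y : ℝ≥0} (hy : y ∈ dyadics) (hy0 : 0 < y)
    (hym : y ≤ dyadic m 1) : |f y| ≤ 2 * A m := by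
  have ha : ∀ n, m ≤ n → 0 ≤ a n := fun n hn => (abs_nonneg _).trans (hf n hn).1
  have hanti : ∀ j, A (m + j) ≤ A m := by
    intro j
    induction j with
    | zero => exact le_rfl
    | succ j ih =>
      have h1 := hA (m + j)
      have h2 := ha (m + j) (by omega)
      rw [← add_assoc]
      linarith
  obtain ⟨j, hj1, hj2⟩ : ∃ j, dyadic (m + j + 1) 1 ≤ y ∧ y ≤ dyadic (m + j) 1 := by
    have hex : ∃ j, dyadic (m + j + 1) 1 ≤ y := by
      obtain ⟨j, hj⟩ := exists_pow_lt_of_lt_one hy0 (by norm_num : (2⁻¹ : ℝ≥0) < 1)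
      refine ⟨j, le_trans ?_ hj.le⟩
      rw [dyadic, Nat.cast_one, one_div, ← inv_pow]
      exact pow_le_pow_of_le_one (by positivity) (by norm_num) (by omega)
    classical
    refine ⟨Nat.find hex, Nat.find_spec hex, ?_⟩
    rcases Nat.eq_zero_or_pos (Nat.find hex) with h | h
    · rw [h]
      exact hym
    · have h1 := Nat.find_min hex (m := Nat.find hex - 1) (by omega)
      rw [show m + (Nat.find hex - 1) + 1 = m + Nat.find hex by omega] at h1
      exact (not_le.1 h1).le
  have e1 : dyadic (m + j + 1) (1 + 1) = dyadic (m + j) 1 := dyadic_succ_two_mul (m + j) 1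
  obtain ⟨k, j1, -, -, hyj, -, -⟩ := exists_common_level hy hy hy (m + j + 1)
  obtain ⟨c, hc⟩ := hf.exists_cut hA0 hA k (m + j + 1) 1 (by omega) le_rfl
    (Nat.one_lt_two_pow (by omega))
  have h1 := hc j1 (by
      rw [← dyadic_le_dyadic_iff (n := m + j + 1 + k), dyadic_add, ← hyj]
      exact hj1) (by
      rw [← dyadic_le_dyadic_iff (n := m + j + 1 + k), dyadic_add, ← hyj, e1]
      exact hj2)
  rw [← hyj, e1] at h1
  have h2 := (hf (m + j) (by omega)).1
  have h3 := (hf (m + j + 1) (by omega)).1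
  have h4 := hA (m + j)
  have h5 := hA (m + j + 1)
  have h6 := hanti j
  have h7 := hA0 (m + j + 1)
  have h8 := hA0 (m + j + 1 + 1)
  have h9 := ha (m + j) (by omega)
  rcases lt_or_ge j1 c with h | h
  · have := h1.1 h
    have := abs_sub_abs_le_abs_sub (f y) (f (dyadic (m + j + 1) 1))
    linarith
  · have := h1.2 h
    have := abs_sub_abs_le_abs_sub (f y) (f (dyadic (m + j) 1))
    linarith

end Chaining

/-! ### Regularization of functions on the dyadic rationals -/

/-- If of any two adjacent increments shortly before `t` one is small, then there is a limit from the
left: after one large increment, all later values are close to each other. -/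
lemma exists_tendsto_left {f : ℝ≥0 → ℝ} {t : ℝ≥0}
    (h : ∀ ε > 0, ∃ u < t, ∀ x ∈ dyadics, ∀ y ∈ dyadics, ∀ z ∈ dyadics, u < x → x ≤ y → y ≤ z → z < t →
      |f y - f x| ≤ ε ∨ |f z - f y| ≤ ε) :
    ∃ l, Tendsto f (𝓝[dyadics ∩ Set.Iio t] t) (𝓝 l) := by
  rcases (𝓝[dyadics ∩ Set.Iio t] t).eq_or_neBot with hbot | hne
  · exact ⟨0, by rw [hbot]; exact tendsto_bot⟩
  rw [← cauchy_map_iff_exists_tendsto, Metric.cauchy_iff]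
  refine ⟨inferInstance, fun ε hε => ?_⟩
  have hmem : ∀ u < t, f '' (dyadics ∩ Set.Ioo u t) ∈ map f (𝓝[dyadics ∩ Set.Iio t] t) := by
    intro u hu
    refine image_mem_map (mem_nhdsWithin.2 ⟨Set.Ioi u, isOpen_Ioi, hu, ?_⟩)
    rintro x ⟨hx1, hx2, hx3⟩
    exact ⟨hx2, hx1, hx3⟩
  obtain ⟨u, hu, H⟩ := h (ε / 4) (by positivity)
  by_cases hex : ∃ x ∈ dyadics, ∃ y ∈ dyadics, u < x ∧ x ≤ y ∧ y < t ∧ ε / 4 < |f y - f x|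
  · obtain ⟨x, hx, y, hy, hux, hxy, hyt, hlt⟩ := hex
    refine ⟨_, hmem y hyt, ?_⟩
    rintro _ ⟨z, ⟨hz, hyz, hzt⟩, rfl⟩ _ ⟨w, ⟨hw, hyw, hwt⟩, rfl⟩
    have h1 := (H x hx y hy z hz hux hxy hyz.le hzt).resolve_left (not_le.2 hlt)
    have h2 := (H x hx y hy w hw hux hxy hyw.le hwt).resolve_left (not_le.2 hlt)
    rw [Real.dist_eq]
    have := abs_sub_le (f z) (f y) (f w)
    rw [abs_sub_comm] at h2
    linarith
  · push Not at hex
    refine ⟨_, hmem u hu, ?_⟩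
    rintro _ ⟨z, ⟨hz, huz, hzt⟩, rfl⟩ _ ⟨w, ⟨hw, huw, hwt⟩, rfl⟩
    rw [Real.dist_eq]
    rcases le_total z w with hzw | hzw
    · have := hex z hz w hw huz hzw hwt
      rw [abs_sub_comm]
      linarith
    · have := hex w hw z hz huw hzw hzt
      linarith

lemma exists_tendsto_right {f : ℝ≥0 → ℝ} {t : ℝ≥0}
    (h : ∀ ε > 0, ∃ u > t, ∀ x ∈ dyadics, ∀ y ∈ dyadics, ∀ z ∈ dyadics, t < x → x ≤ y → y ≤ z → z < u →
      |f y - f x| ≤ ε ∨ |f z - f y| ≤ ε) :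
    ∃ l, Tendsto f (𝓝[dyadics ∩ Set.Ioi t] t) (𝓝 l) := by
  rcases (𝓝[dyadics ∩ Set.Ioi t] t).eq_or_neBot with hbot | hne
  · exact ⟨0, by rw [hbot]; exact tendsto_bot⟩
  rw [← cauchy_map_iff_exists_tendsto, Metric.cauchy_iff]
  refine ⟨inferInstance, fun ε hε => ?_⟩
  have hmem : ∀ u > t, f '' (dyadics ∩ Set.Ioo t u) ∈ map f (𝓝[dyadics ∩ Set.Ioi t] t) := by
    intro u hu
    refine image_mem_map (mem_nhdsWithin.2 ⟨Set.Iio u, isOpen_Iio, hu, ?_⟩)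
    rintro x ⟨hx1, hx2, hx3⟩
    exact ⟨hx2, hx3, hx1⟩
  obtain ⟨u, hu, H⟩ := h (ε / 4) (by positivity)
  by_cases hex : ∃ y ∈ dyadics, ∃ z ∈ dyadics, t < y ∧ y ≤ z ∧ z < u ∧ ε / 4 < |f z - f y|
  · obtain ⟨y, hy, z, hz, hty, hyz, hzu, hlt⟩ := hex
    refine ⟨_, hmem y hty, ?_⟩
    rintro _ ⟨x, ⟨hx, htx, hxy⟩, rfl⟩ _ ⟨w, ⟨hw, htw, hwy⟩, rfl⟩
    have h1 := (H x hx y hy z hz htx hxy.le hyz hzu).resolve_right (not_le.2 hlt)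
    have h2 := (H w hw y hy z hz htw hwy.le hyz hzu).resolve_right (not_le.2 hlt)
    rw [Real.dist_eq]
    have := abs_sub_le (f x) (f y) (f w)
    rw [abs_sub_comm] at h1
    linarith
  · push Not at hex
    refine ⟨_, hmem u hu, ?_⟩
    rintro _ ⟨z, ⟨hz, htz, hzu⟩, rfl⟩ _ ⟨w, ⟨hw, htw, hwu⟩, rfl⟩
    rw [Real.dist_eq]
    rcases le_total z w with hzw | hzw
    · have := hex z hz w hw htz hzw hwu
      rw [abs_sub_comm]
      linarith
    · have := hex w hw z hz htw hzw hzu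
      linarith

lemma eventually_dyadic_one_lt {t : ℝ≥0} (ht : 0 < t) : ∀ᶠ n in atTop, dyadic n 1 < t := by
  have h1 : Tendsto (fun n : ℕ => (2⁻¹ : ℝ≥0) ^ n) atTop (𝓝 0) :=
    NNReal.tendsto_pow_atTop_nhds_zero_of_lt_one (by norm_num)
  filter_upwards [h1.eventually_lt_const ht] with n hn
  rwa [dyadic, Nat.cast_one, one_div, ← inv_pow]

section Limits

variable {f : ℝ≥0 → ℝ} {a A : ℕ → ℝ} {m : ℕ}

lemma IsChainable.exists_tendsto_left (hf : IsChainable f a m) (hA0 : ∀ n, 0 ≤ A n)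
    (hA : ∀ n, a n + A (n + 1) ≤ A n) (hAlim : Tendsto A atTop (𝓝 0)) {t : ℝ≥0} (ht0 : 0 < t)
    (ht1 : t ≤ 1) : ∃ l, Tendsto f (𝓝[dyadics ∩ Set.Iio t] t) (𝓝 l) := by
  refine _root_.exists_tendsto_left fun ε hε => ?_
  obtain ⟨n, hn1, hn2, hn3⟩ := ((hAlim.eventually_lt_const (half_pos hε)).and
    ((eventually_ge_atTop m).and (eventually_dyadic_one_lt ht0))).exists
  have hpow : (0 : ℝ≥0) < 2 ^ n := by positivity
  have hc0 : 1 < ⌈t * 2 ^ n⌉₊ := by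
    rw [Nat.lt_ceil, Nat.cast_one]
    rwa [dyadic, Nat.cast_one, div_lt_iff₀ hpow] at hn3
  obtain ⟨i, hi⟩ : ∃ i, ⌈t * 2 ^ n⌉₊ = i + 1 := ⟨⌈t * 2 ^ n⌉₊ - 1, by omega⟩
  have hlt : dyadic n i < t := by
    rw [dyadic, div_lt_iff₀ hpow, ← Nat.lt_ceil]
    omega
  have hle : t ≤ dyadic n (i + 1) := by
    rw [dyadic, le_div_iff₀ hpow, ← hi]
    exact Nat.le_ceil _
  have hi2 : i < 2 ^ n := by
    have : ⌈t * 2 ^ n⌉₊ ≤ 2 ^ n := by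
      rw [Nat.ceil_le]
      push_cast
      exact mul_le_of_le_one_left (by positivity) ht1
    omega
  refine ⟨dyadic n i, hlt, fun x hx y hy z hz hux hxy hyz hzt => ?_⟩
  have := hf.exists_cut_dyadics hA0 hA hn2 (by omega) hi2 hx hy hz hux.le hxy hyz (hzt.le.trans hle)
  exact this.imp (fun h => h.trans (by linarith)) (fun h => h.trans (by linarith))

lemma IsChainable.exists_tendsto_right (hf : IsChainable f a m) (hA0 : ∀ n, 0 ≤ A n)
    (hA : ∀ n, a n + A (n + 1) ≤ A n) (hAlim : Tendsto A atTop (𝓝 0)) {t : ℝ≥0} (ht0 : 0 < t)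
    (ht1 : t < 1) : ∃ l, Tendsto f (𝓝[dyadics ∩ Set.Ioi t] t) (𝓝 l) := by
  refine _root_.exists_tendsto_right fun ε hε => ?_
  obtain ⟨n, hn1, hn2, hn3⟩ := ((hAlim.eventually_lt_const (half_pos hε)).and
    ((eventually_ge_atTop m).and (eventually_dyadic_one_lt ht0))).exists
  have hpow : (0 : ℝ≥0) < 2 ^ n := by positivity
  set i := ⌊t * 2 ^ n⌋₊ with hi
  have hi1 : 1 ≤ i := by
    rw [hi, Nat.one_le_floor_iff]
    rw [dyadic, Nat.cast_one, div_lt_iff₀ hpow] at hn3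
    exact hn3.le
  have hle : dyadic n i ≤ t := by
    rw [dyadic, div_le_iff₀ hpow]
    exact Nat.floor_le (by positivity)
  have hlt : t < dyadic n (i + 1) := by
    rw [dyadic, lt_div_iff₀ hpow]
    push_cast
    exact Nat.lt_floor_add_one _
  have hi2 : i < 2 ^ n := by
    rw [hi, Nat.floor_lt (by positivity)]
    push_cast
    exact mul_lt_of_lt_one_left hpow ht1
  refine ⟨dyadic n (i + 1), hlt, fun x hx y hy z hz htx hxy hyz hzu => ?_⟩
  have := hf.exists_cut_dyadics hA0 hA hn2 hi1 hi2 hx hy hz (hle.trans htx.le) hxy hyz hzu.le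
  exact this.imp (fun h => h.trans (by linarith)) (fun h => h.trans (by linarith))

lemma IsChainable.mono (hf : IsChainable f a m) {n : ℕ} (hn : m ≤ n) : IsChainable f a n :=
  fun k hk => hf k (hn.trans hk)

lemma IsChainable.tendsto_zero (hf : IsChainable f a m) (hA0 : ∀ n, 0 ≤ A n)
    (hA : ∀ n, a n + A (n + 1) ≤ A n) (hAlim : Tendsto A atTop (𝓝 0)) :
    Tendsto f (𝓝[dyadics ∩ Set.Ioi 0] 0) (𝓝 0) := by
  rw [Metric.tendsto_nhds]
  intro ε hε
  obtain ⟨n, hn1, hn2⟩ := ((hAlim.eventually_lt_const (half_pos hε)).and (eventually_ge_atTop m)).exists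
  have hnhds : Set.Iio (dyadic n 1) ∈ 𝓝 (0 : ℝ≥0) := Iio_mem_nhds (dyadic_pos le_rfl)
  filter_upwards [self_mem_nhdsWithin, mem_nhdsWithin_of_mem_nhds hnhds] with y hy hyn
  rw [Real.dist_eq, sub_zero]
  exact ((hf.mono hn2).abs_le hA0 hA hy.1 hy.2 (le_of_lt hyn)).trans_lt (by linarith)

end Limits

/-- The dyadic rational following `t` at level `n`. -/
noncomputable def dyadicAfter (t : ℝ≥0) (n : ℕ) : ℝ≥0 := dyadic n (⌊t * 2 ^ n⌋₊ + 1)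

lemma lt_dyadicAfter (t : ℝ≥0) (n : ℕ) : t < dyadicAfter t n := by
  rw [dyadicAfter, dyadic, lt_div_iff₀ (by positivity)]
  push_cast
  exact Nat.lt_floor_add_one _

lemma dyadicAfter_le (t : ℝ≥0) (n : ℕ) : dyadicAfter t n ≤ t + 2⁻¹ ^ n := by
  rw [dyadicAfter, dyadic, div_le_iff₀ (by positivity), add_mul, ← mul_pow]
  push_cast
  rw [inv_mul_cancel₀ (by norm_num), one_pow]
  gcongr
  exact Nat.floor_le (by positivity)

lemma tendsto_dyadicAfter (t : ℝ≥0) :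
    Tendsto (dyadicAfter t) atTop (𝓝[dyadics ∩ Set.Ioi t] t) := by
  refine tendsto_nhdsWithin_iff.2 ⟨?_, Eventually.of_forall fun n =>
    ⟨⟨n, _, rfl⟩, lt_dyadicAfter t n⟩⟩
  have h1 : Tendsto (fun n : ℕ => t + (2⁻¹ : ℝ≥0) ^ n) atTop (𝓝 (t + 0)) :=
    tendsto_const_nhds.add (NNReal.tendsto_pow_atTop_nhds_zero_of_lt_one (by norm_num))
  rw [add_zero] at h1
  exact tendsto_of_tendsto_of_tendsto_of_le_of_le tendsto_const_nhds h1
    (fun n => (lt_dyadicAfter t n).le) (dyadicAfter_le t)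

instance neBot_nhdsWithin_dyadics_Ioi (t : ℝ≥0) : NeBot (𝓝[dyadics ∩ Set.Ioi t] t) :=
  (tendsto_dyadicAfter t).neBot

/-- The right limit along the dyadic rationals of a function that has one-sided limits along the
dyadic rationals is right-continuous with left limits. -/
lemma isRcll_of_tendsto {f g : ℝ≥0 → ℝ}
    (hright : ∀ t, Tendsto f (𝓝[dyadics ∩ Set.Ioi t] t) (𝓝 (g t)))
    (hleft : ∀ t, 0 < t → ∃ l, Tendsto f (𝓝[dyadics ∩ Set.Iio t] t) (𝓝 l)) : IsRcll g := by
  intro t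
  -- Values of `g` are limits of values of `f` at dyadic points on their right, so they inherit bounds.
  have hclosed : ∀ {U : Set ℝ≥0}, IsOpen U → ∀ {l ε : ℝ},
      (∀ x ∈ dyadics, x ∈ U → |f x - l| ≤ ε) → ∀ s ∈ U, |g s - l| ≤ ε := by
    intro U hU l ε h s hs
    have h1 : Tendsto (fun x => |f x - l|) (𝓝[dyadics ∩ Set.Ioi s] s) (𝓝 |g s - l|) :=
      ((hright s).sub_const l).abs
    refine le_of_tendsto h1 ?_
    filter_upwards [self_mem_nhdsWithin, mem_nhdsWithin_of_mem_nhds (hU.mem_nhds hs)] with x hx hxU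
    exact h x hx.1 hxU
  constructor
  · rw [← continuousWithinAt_Ioi_iff_Ici]
    refine Metric.tendsto_nhds.2 fun ε hε => ?_
    have h1 := Metric.tendsto_nhds.1 (hright t) (ε / 2) (half_pos hε)
    obtain ⟨U, hU, htU, hUs⟩ := mem_nhdsWithin.1 h1
    filter_upwards [inter_mem_nhdsWithin (Set.Ioi t) (hU.mem_nhds htU)] with s hs
    have h2 := hclosed (hU.inter isOpen_Ioi) (l := g t) (ε := ε / 2) (fun x hx hxU => by
      have := hUs ⟨hxU.1, hx, hxU.2⟩
      rw [Set.mem_ofPred_eq, Real.dist_eq] at this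
      exact this.le) s hs.symm
    rw [Real.dist_eq]
    linarith
  · rcases eq_or_ne t 0 with rfl | ht
    · refine ⟨0, ?_⟩
      have : Set.Iio (0 : ℝ≥0) = ∅ := by
        ext x
        simp
      rw [this, nhdsWithin_empty]
      exact tendsto_bot
    · obtain ⟨l, hl⟩ := hleft t (pos_iff_ne_zero.2 ht)
      refine ⟨l, Metric.tendsto_nhds.2 fun ε hε => ?_⟩
      have h1 := Metric.tendsto_nhds.1 hl (ε / 2) (half_pos hε)
      obtain ⟨U, hU, htU, hUs⟩ := mem_nhdsWithin.1 h1
      filter_upwards [inter_mem_nhdsWithin (Set.Iio t) (hU.mem_nhds htU)] with s hs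
      have h2 := hclosed (hU.inter isOpen_Iio) (l := l) (ε := ε / 2) (fun x hx hxU => by
        have := hUs ⟨hxU.1, hx, hxU.2⟩
        rw [Set.mem_ofPred_eq, Real.dist_eq] at this
        exact this.le) s hs.symm
      rw [Real.dist_eq]
      linarith

/-! ### Almost sure regularity -/

section Regularity

variable {Ω : Type*} {X : ℝ≥0 → Ω → ℝ} {θ x : ℝ} {m : ℕ}

lemma isChainable_of_notMem_badEvent {ω : Ω} (h : ∀ n, m ≤ n → ω ∉ badEvent X θ x n) :
    IsChainable (fun s => X s ω) (fun n => x * θ ^ n) m := by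
  intro n hn
  have h1 := h n hn
  simp only [badEvent, Set.mem_union, Set.mem_ofPred_eq, Set.mem_iUnion, Finset.mem_Ico, not_or,
    not_lt, not_exists, not_and] at h1
  refine ⟨h1.1, fun i hi1 hi2 => ?_⟩
  by_cases hlt : |X (dyadic (n + 1) (2 * i + 1)) ω - X (dyadic n i) ω| ≤ x * θ ^ n
  · exact Or.inl hlt
  · exact Or.inr (h1.2 i ⟨hi1, hi2⟩ (not_le.1 hlt))

/-- The tail sums of the thresholds `x θ ^ n` satisfy the recursion required in the chaining
argument. -/
lemma geometric_chaining (hθ1 : θ < 1) (n : ℕ) :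
    x * θ ^ n + x * θ ^ (n + 1) / (1 - θ) ≤ x * θ ^ n / (1 - θ) := by
  have h : 1 - θ ≠ 0 := by linarith
  apply le_of_eq
  field_simp
  ring

variable [MeasurableSpace Ω] {μ : Measure Ω} [IsProbabilityMeasure μ] {p r d M : ℝ}
  {ψ : ℝ → ℂ} {K κ : ℝ}

lemma chainRatio_pos (e : ℝ) : (0 : ℝ) < 2 ^ (-e) := by positivity

lemma chainRatio_lt_one {e : ℝ} (he : 0 < e) : (2 : ℝ) ^ (-e) < 1 :=
  Real.rpow_lt_one_of_one_lt_of_neg one_lt_two (by linarith)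

lemma tsum_badEvent_le (hp : 0 < p) (hp1 : p < 1) (hr : 1 ≤ r)
    (hY : YuleSimonBound p r d M) (hψ : ExponentBound ψ r K κ) (hX : HasYuleSimonExponent p ψ X μ)
    (hx : 0 < x) : ∑' n, μ (badEvent X (2 ^ (-(d / (4 * r)))) x n)
      ≤ ENNReal.ofReal ((2 * M + 4 * (M ^ 2 + 3 * M) * (1 - d)⁻¹) * ((K + K ^ 2)
        * (((2 / x) ^ r + κ) + ((2 / x) ^ r + κ) ^ 2)) * (1 - (2 : ℝ) ^ (-(d / 2)))⁻¹) := by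
  have hd0 := hY.d_pos
  have hd1 := hY.d_lt_one
  have hM := hY.M_pos
  have hK := hψ.K_nonneg
  have hκ := hψ.κ_nonneg
  have hdinv : 0 < (1 - d)⁻¹ := inv_pos.2 (by linarith)
  have hlt := chainRatio_lt_one (half_pos hd0)
  set c := (2 * M + 4 * (M ^ 2 + 3 * M) * (1 - d)⁻¹) * ((K + K ^ 2)
        * (((2 / x) ^ r + κ) + ((2 / x) ^ r + κ) ^ 2)) with hc
  have hc0 : 0 ≤ c := by positivity
  have hle : ∀ n, μ (badEvent X (2 ^ (-(d / (4 * r)))) x n)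
      ≤ ENNReal.ofReal (c * ((2 : ℝ) ^ (-(d / 2))) ^ n) := fun n => by
    rw [← ofReal_measureReal]
    exact ENNReal.ofReal_le_ofReal (measureReal_badEvent_le hp hp1 hr hY hψ hX hx n)
  have hs := (summable_geometric_of_lt_one (chainRatio_pos (d / 2)).le hlt).mul_left c
  calc _ ≤ ∑' n, ENNReal.ofReal (c * ((2 : ℝ) ^ (-(d / 2))) ^ n) := ENNReal.tsum_le_tsum hle
    _ = ENNReal.ofReal (∑' n, c * ((2 : ℝ) ^ (-(d / 2))) ^ n) :=
        (ENNReal.ofReal_tsum_of_nonneg (fun n => by positivity) hs).symm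
    _ = _ := by rw [tsum_mul_left, tsum_geometric_of_lt_one (chainRatio_pos (d / 2)).le hlt]

/-- By the Borel–Cantelli lemma, almost surely only finitely many bad events occur. -/
lemma ae_exists_isChainable (hp : 0 < p) (hp1 : p < 1) (hr : 1 ≤ r)
    (hY : YuleSimonBound p r d M) (hψ : ExponentBound ψ r K κ) (hX : HasYuleSimonExponent p ψ X μ) :
    ∀ᵐ ω ∂μ, ∃ m, IsChainable (fun s => X s ω) (fun n => 1 * ((2 : ℝ) ^ (-(d / (4 * r)))) ^ n) m := by
  have hsum := (tsum_badEvent_le hp hp1 hr hY hψ hX one_pos).trans_lt ENNReal.ofReal_lt_top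
  filter_upwards [ae_eventually_notMem hsum.ne] with ω hω
  obtain ⟨m, hm⟩ := eventually_atTop.1 hω
  exact ⟨m, isChainable_of_notMem_badEvent hm⟩

lemma dyadic_div_two_pow (n i k : ℕ) : dyadic n i / 2 ^ k = dyadic (n + k) i := by
  rw [dyadic, dyadic, div_div, pow_add]

/-- Dyadic limits are compatible with a change of the time unit by a power of `2`. -/
lemma tendsto_of_tendsto_scale {f : ℝ≥0 → ℝ} {k : ℕ} {t : ℝ≥0} {S : ℝ≥0 → Set ℝ≥0} {F : Filter ℝ}
    (hS : ∀ y, y ∈ S t → y / 2 ^ k ∈ S (t / 2 ^ k))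
    (h : Tendsto (fun s => f (2 ^ k * s)) (𝓝[dyadics ∩ S (t / 2 ^ k)] (t / 2 ^ k)) F) :
    Tendsto f (𝓝[dyadics ∩ S t] t) F := by
  have h1 : Tendsto (fun s : ℝ≥0 => s / 2 ^ k) (𝓝[dyadics ∩ S t] t)
      (𝓝[dyadics ∩ S (t / 2 ^ k)] (t / 2 ^ k)) := by
    refine tendsto_nhdsWithin_iff.2 ⟨?_, ?_⟩
    · exact ((continuous_id.div_const _).tendsto t).mono_left nhdsWithin_le_nhds
    · filter_upwards [self_mem_nhdsWithin] with y hy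
      obtain ⟨⟨n, i, rfl⟩, hy2⟩ := hy
      exact ⟨⟨n + k, i, dyadic_div_two_pow n i k⟩, hS _ hy2⟩
  refine (h.comp h1).congr fun s => ?_
  simp only [Function.comp_apply]
  congr 1
  rw [mul_div_assoc', mul_div_cancel_left₀]
  positivity

/-- A process started from `0` all of whose time changes by powers of `2` have Yule–Simon exponents
of moderate growth has a modification with right-continuous paths with left limits. -/
theorem exists_rcll_modification (hp : 0 < p) (hp1 : p < 1) (hr : 1 ≤ r)
    (hY : YuleSimonBound p r d M) {Ψ : ℕ → ℝ → ℂ} {k : ℕ → ℝ}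
    (hψ : ∀ j, ExponentBound (Ψ j) r (k j) κ)
    (hX : ∀ j : ℕ, HasYuleSimonExponent p (Ψ j) (fun s => X (2 ^ j * s)) μ)
    (hX0 : ∀ᵐ ω ∂μ, X 0 ω = 0) :
    ∃ X' : ℝ≥0 → Ω → ℝ, (∀ t, Measurable (X' t)) ∧ (∀ t, X' t =ᵐ[μ] X t) ∧
      ∀ ω, IsRcll (fun t => X' t ω) := by
  classical
  set θ : ℝ := 2 ^ (-(d / (4 * r))) with hθ
  have hθ0 : 0 < θ := chainRatio_pos _
  have hθ1 : θ < 1 := chainRatio_lt_one (by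
    have := hY.d_pos
    positivity)
  have hXm : ∀ t, Measurable (X t) := fun t => by
    simpa using (hX 0).measurable t
  have hgood : ∀ᵐ ω ∂μ, X 0 ω = 0 ∧
      ∀ j : ℕ, ∃ m, IsChainable (fun s => X (2 ^ j * s) ω) (fun n => 1 * θ ^ n) m :=
    hX0.and (ae_all_iff.2 fun j => ae_exists_isChainable hp hp1 hr hY (hψ j) (hX j))
  obtain ⟨G, hGsub, hGm, hGae⟩ : ∃ G : Set Ω, (∀ ω ∈ G, X 0 ω = 0 ∧
      ∀ j : ℕ, ∃ m, IsChainable (fun s => X (2 ^ j * s) ω) (fun n => 1 * θ ^ n) m) ∧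
      MeasurableSet G ∧ ∀ᵐ ω ∂μ, ω ∈ G := by
    obtain ⟨N, hN1, hN2, hN3⟩ := exists_measurable_superset_of_null (ae_iff.1 hgood)
    refine ⟨Nᶜ, fun ω hω => ?_, hN2.compl, by simpa [ae_iff] using hN3⟩
    by_contra hcon
    exact hω (hN1 hcon)
  set A : ℕ → ℝ := fun n => 1 * θ ^ n / (1 - θ) with hAdef
  have h1θ : 0 < 1 - θ := by linarith
  have hA0 : ∀ n, 0 ≤ A n := fun n => by positivity
  have hA : ∀ n, 1 * θ ^ n + A (n + 1) ≤ A n := fun n => geometric_chaining hθ1 n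
  have hAlim : Tendsto A atTop (𝓝 0) := by
    have := ((tendsto_pow_atTop_nhds_zero_of_lt_one hθ0.le hθ1).const_mul 1).div_const (1 - θ)
    simpa [A] using this
  have hscale : ∀ t : ℝ≥0, ∃ j : ℕ, t / 2 ^ j < 1 := by
    intro t
    obtain ⟨j, hj⟩ := pow_unbounded_of_one_lt t (one_lt_two (α := ℝ≥0))
    exact ⟨j, (div_lt_one (by positivity)).2 hj⟩
  have hzero : ∀ ω ∈ G, Tendsto (fun s => X s ω) (𝓝[dyadics ∩ Set.Ioi 0] 0) (𝓝 0) := by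
    intro ω hω
    obtain ⟨m, hm⟩ := (hGsub ω hω).2 0
    simpa using hm.tendsto_zero hA0 hA hAlim
  have hright : ∀ ω ∈ G, ∀ t, ∃ l, Tendsto (fun s => X s ω) (𝓝[dyadics ∩ Set.Ioi t] t) (𝓝 l) := by
    intro ω hω t
    rcases eq_or_ne t 0 with rfl | ht
    · exact ⟨0, hzero ω hω⟩
    · obtain ⟨j, hj⟩ := hscale t
      obtain ⟨m, hm⟩ := (hGsub ω hω).2 j
      obtain ⟨l, hl⟩ := hm.exists_tendsto_right hA0 hA hAlim (t := t / 2 ^ j)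
        (by have := pos_iff_ne_zero.2 ht; positivity) hj
      exact ⟨l, tendsto_of_tendsto_scale (S := Set.Ioi) (fun y hy =>
        (div_lt_div_iff_of_pos_right (c := (2 : ℝ≥0) ^ j) (by positivity)).2 hy) hl⟩
  have hleft : ∀ ω ∈ G, ∀ t, 0 < t →
      ∃ l, Tendsto (fun s => X s ω) (𝓝[dyadics ∩ Set.Iio t] t) (𝓝 l) := by
    intro ω hω t ht
    obtain ⟨j, hj⟩ := hscale t
    obtain ⟨m, hm⟩ := (hGsub ω hω).2 j
    obtain ⟨l, hl⟩ := hm.exists_tendsto_left hA0 hA hAlim (t := t / 2 ^ j) (by positivity) hj.le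
    exact ⟨l, tendsto_of_tendsto_scale (S := Set.Iio) (fun y hy =>
      (div_lt_div_iff_of_pos_right (c := (2 : ℝ≥0) ^ j) (by positivity)).2 hy) hl⟩
  choose! g hg using hright
  set X' : ℝ≥0 → Ω → ℝ := fun t ω => if ω ∈ G then g ω t else 0 with hX'
  have hlim : ∀ t ω, Tendsto (fun n => if ω ∈ G then X (dyadicAfter t n) ω else 0) atTop
      (𝓝 (X' t ω)) := by
    intro t ω
    by_cases hω : ω ∈ G
    · simp only [hX', hω, if_true]
      exact (hg ω hω t).comp (tendsto_dyadicAfter t)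
    · simp only [hX', hω, if_false]
      exact tendsto_const_nhds
  refine ⟨X', fun t => ?_, fun t => ?_, fun ω => ?_⟩
  · exact measurable_of_tendsto_metrizable
      (fun n => Measurable.ite hGm (hXm (dyadicAfter t n)) measurable_const)
      (tendsto_pi_nhds.2 fun ω => hlim t ω)
  · rcases eq_or_ne t 0 with rfl | ht
    · filter_upwards [hGae] with ω hω
      rw [(hGsub ω hω).1]
      simp only [hX', hω, if_true]
      exact tendsto_nhds_unique (hg ω hω 0) (hzero ω hω)
    · -- By stochastic continuity, `X` at dyadic times decreasing to `t` converges to `X t` in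
      -- probability, hence almost surely along a subsequence.
      have ht0 : 0 < t := pos_iff_ne_zero.2 ht
      have hmeas : TendstoInMeasure μ (fun n => X (dyadicAfter t n)) atTop (X t) := by
        rw [tendstoInMeasure_iff_norm]
        intro ε hε
        have hbound : ∀ n, μ {ω | ε ≤ ‖X (dyadicAfter t n) ω - X t ω‖}
            ≤ ENNReal.ofReal (2 * (k 0 * ((2 / (ε / 2)) ^ r + κ) * (M * (dyadicAfter t n - t)))) := by
          intro n
          have h0 : HasYuleSimonExponent p (Ψ 0) X μ := by simpa using hX 0
          refine le_trans (measure_mono fun ω (hω : ε ≤ _) => ?_)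
            ((ofReal_measureReal (μ := μ)
              (s := {ω | ε / 2 < |X (dyadicAfter t n) ω - X t ω|})).symm.le.trans
            (ENNReal.ofReal_le_ofReal (h0.measureReal_increment_le hp hp1 hr hY (hψ 0) ht0
              (lt_dyadicAfter t n) (half_pos hε))))
          exact lt_of_lt_of_le (by linarith) hω
        have hlim0 : Tendsto (fun n => ENNReal.ofReal
            (2 * (k 0 * ((2 / (ε / 2)) ^ r + κ) * (M * (dyadicAfter t n - t))))) atTop (𝓝 0) := by
          have h1 : Tendsto (fun n => (dyadicAfter t n : ℝ)) atTop (𝓝 t) :=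
            NNReal.tendsto_coe.2 ((tendsto_dyadicAfter t).mono_right nhdsWithin_le_nhds)
          have h2 := (((h1.sub_const (t : ℝ)).const_mul M).const_mul
            (k 0 * ((2 / (ε / 2)) ^ r + κ))).const_mul 2
          have h3 := ENNReal.tendsto_ofReal h2
          simpa using h3
        exact tendsto_of_tendsto_of_tendsto_of_le_of_le tendsto_const_nhds hlim0
          (fun _ => bot_le) hbound
      obtain ⟨ns, hns, hconv⟩ := hmeas.exists_seq_tendsto_ae
      filter_upwards [hGae, hconv] with ω hω hωconv
      have h1 := (hlim t ω).comp hns.tendsto_atTop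
      simp only [hω, if_true, Function.comp_def] at h1
      exact tendsto_nhds_unique h1 hωconv
  · by_cases hω : ω ∈ G
    · simp only [hX', hω, if_true]
      exact isRcll_of_tendsto (hg ω hω) (hleft ω hω)
    · simp only [hX', hω, if_false]
      exact fun t => ⟨continuousWithinAt_const, 0, tendsto_const_nhds⟩

end Regularity

/-! ### Mean of the supremum -/

/-- The supremum of the absolute value of a process over the dyadic times in `(0, 1]`. -/
noncomputable def dyadicSup {Ω : Type*} (X : ℝ≥0 → Ω → ℝ) (ω : Ω) : ℝ≥0∞ :=
  ⨆ y ∈ dyadics ∩ Set.Ioc 0 1, ‖X y ω‖ₑ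

lemma countable_dyadics : dyadics.Countable := by
  refine (Set.countable_range fun z : ℕ × ℕ => dyadic z.1 z.2).mono ?_
  rintro x ⟨n, i, rfl⟩
  exact ⟨(n, i), rfl⟩

/-- A layer cake inequality along the levels `c 2 ^ k`. -/
lemma lintegral_le_tsum_dyadic_levels {Ω : Type*} [MeasurableSpace Ω] {μ : Measure Ω}
    [IsProbabilityMeasure μ] {S : Ω → ℝ≥0∞} (hS : Measurable S) {c : ℝ} (hc : 0 < c) :
    ∫⁻ ω, S ω ∂μ ≤ ENNReal.ofReal c
      + ∑' k : ℕ, ENNReal.ofReal (c * 2 ^ k) * μ {ω | ENNReal.ofReal (c * 2 ^ k) < S ω} := by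
  set L : ℕ → ℝ≥0∞ := fun k => ENNReal.ofReal (c * 2 ^ k) with hL
  have hmeas : ∀ k, MeasurableSet {ω | L k < S ω} := fun k => measurableSet_lt measurable_const hS
  have hLsucc : ∀ k, L (k + 1) = L k + L k := by
    intro k
    simp only [hL]
    rw [← ENNReal.ofReal_add (by positivity) (by positivity)]
    congr 1
    ring
  have hmin : ∀ ω n, min (S ω) (L n) ≤ L 0 + ∑ k ∈ Finset.range n, L k * {ω | L k < S ω}.indicator 1 ω := by
    intro ω n
    induction n with
    | zero => simp
    | succ n ih =>
      rw [Finset.sum_range_succ, ← add_assoc]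
      by_cases h : L n < S ω
      · have h1 : min (S ω) (L n) = L n := min_eq_right h.le
        rw [h1] at ih
        have h2 : ω ∈ {ω | L n < S ω} := h
        rw [Set.indicator_of_mem h2, Pi.one_apply, mul_one]
        exact (min_le_right _ _).trans ((hLsucc n).le.trans (add_le_add ih le_rfl))
      · have h1 : min (S ω) (L n) = S ω := min_eq_left (not_lt.1 h)
        rw [h1] at ih
        exact (min_le_left _ _).trans (ih.trans le_self_add)
  have hLtop : Tendsto L atTop (𝓝 ∞) := by
    have h1 : Tendsto (fun k : ℕ => c * (2 : ℝ) ^ k) atTop atTop :=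
      (tendsto_pow_atTop_atTop_of_one_lt one_lt_two).const_mul_atTop hc
    exact ENNReal.tendsto_ofReal_nhds_top.2 h1
  have hpt : ∀ ω, S ω ≤ L 0 + ∑' k, L k * {ω | L k < S ω}.indicator 1 ω := by
    intro ω
    have h1 : Tendsto (fun n => min (S ω) (L n)) atTop (𝓝 (min (S ω) ∞)) :=
      tendsto_const_nhds.min hLtop
    rw [min_eq_left le_top] at h1
    refine le_of_tendsto' h1 fun n => (hmin ω n).trans ?_
    gcongr
    exact ENNReal.sum_le_tsum _
  refine (lintegral_mono hpt).trans (le_of_eq ?_)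
  rw [lintegral_add_left measurable_const, lintegral_const, measure_univ, mul_one,
    lintegral_tsum fun k => ((measurable_one.indicator (hmeas k)).const_mul _).aemeasurable]
  congr 1
  · simp [hL]
  · refine tsum_congr fun k => ?_
    rw [lintegral_const_mul _ (measurable_one.indicator (hmeas k)), lintegral_indicator_one (hmeas k)]

section Supremum

variable {Ω : Type*} [MeasurableSpace Ω] {μ : Measure Ω} [IsProbabilityMeasure μ] {p r d M : ℝ}
  {ψ : ℝ → ℂ} {K : ℝ} {X : ℝ≥0 → Ω → ℝ}

lemma measurable_dyadicSup (hX : ∀ t, Measurable (X t)) : Measurable (dyadicSup X) :=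
  Measurable.biSup _ (countable_dyadics.mono Set.inter_subset_left) fun y _ => (hX y).enorm

/-- Maximal inequality: the tail of the supremum over the dyadic times is bounded by the total
probability of the bad events. -/
lemma measure_dyadicSup_gt_le (hp : 0 < p) (hp1 : p < 1) (hr : 1 ≤ r)
    (hY : YuleSimonBound p r d M) (hψ : ExponentBound ψ r K 0) (hX : HasYuleSimonExponent p ψ X μ)
    {x : ℝ} (hx : 0 < x) :
    μ {ω | ENNReal.ofReal (2 * (x / (1 - 2 ^ (-(d / (4 * r)))))) < dyadicSup X ω}
      ≤ ENNReal.ofReal ((2 * M + 4 * (M ^ 2 + 3 * M) * (1 - d)⁻¹) * ((K + K ^ 2)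
        * ((2 / x) ^ r + ((2 / x) ^ r) ^ 2)) * (1 - (2 : ℝ) ^ (-(d / 2)))⁻¹) := by
  have h := tsum_badEvent_le hp hp1 hr hY hψ hX hx
  rw [add_zero] at h
  refine le_trans ?_ ((measure_iUnion_le _).trans h)
  refine measure_mono fun ω hω => ?_
  by_contra hcon
  set θ : ℝ := 2 ^ (-(d / (4 * r))) with hθ
  have hθ0 : 0 < θ := chainRatio_pos _
  have hθ1 : θ < 1 := chainRatio_lt_one (by
    have := hY.d_pos
    positivity)
  have h1θ : 0 < 1 - θ := by linarith
  have hchain : IsChainable (fun s => X s ω) (fun n => x * θ ^ n) 0 :=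
    isChainable_of_notMem_badEvent fun n _ hn => hcon (Set.mem_iUnion.2 ⟨n, hn⟩)
  rw [Set.mem_ofPred_eq] at hω
  refine absurd hω (not_lt.2 (iSup₂_le fun y hy => ?_))
  have h1 := hchain.abs_le (A := fun n => x * θ ^ n / (1 - θ)) (fun n => by positivity)
    (fun n => geometric_chaining hθ1 n) hy.1 hy.2.1 (by simpa [dyadic] using hy.2.2)
  rw [Real.enorm_eq_ofReal_abs]
  exact ENNReal.ofReal_le_ofReal (by simpa using h1)

/-- If the exponent is at most `K |l| ^ r` with `K` small and `r > 1`, then the supremum of the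
process has a small mean. -/
theorem exists_lintegral_dyadicSup_le (hp : 0 < p) (hp1 : p < 1) (hr : 1 < r)
    (hY : YuleSimonBound p r d M) {η : ℝ} (hη : 0 < η) :
    ∃ K₀ > 0, ∀ {Ω : Type*} [MeasurableSpace Ω] {μ : Measure Ω} [IsProbabilityMeasure μ] {ψ : ℝ → ℂ}
      {K : ℝ} {X : ℝ≥0 → Ω → ℝ}, K ≤ K₀ → ExponentBound ψ r K 0 → HasYuleSimonExponent p ψ X μ →
      ∫⁻ ω, dyadicSup X ω ∂μ ≤ ENNReal.ofReal η := by
  have hd0 := hY.d_pos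
  have hd1 := hY.d_lt_one
  have hM := hY.M_pos
  have hdinv : 0 < (1 - d)⁻¹ := inv_pos.2 (by linarith)
  set θ : ℝ := 2 ^ (-(d / (4 * r))) with hθ
  have hθ1 : θ < 1 := chainRatio_lt_one (by positivity)
  have h1θ : 0 < 1 - θ := by linarith
  have hlt := chainRatio_lt_one (half_pos hd0)
  have hinv : 0 < (1 - (2 : ℝ) ^ (-(d / 2)))⁻¹ := inv_pos.2 (by linarith)
  set C := (2 * M + 4 * (M ^ 2 + 3 * M) * (1 - d)⁻¹) * (1 - (2 : ℝ) ^ (-(d / 2)))⁻¹ with hC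
  have hC0 : 0 < C := by positivity
  -- The lowest level `c` of the layer cake contributes `η / 2`, and `x = c (1 - θ) / 2` is the
  -- threshold that corresponds to it in the maximal inequality.
  set c := η / 2 with hc
  have hc0 : 0 < c := half_pos hη
  set x := c * (1 - θ) / 2 with hx
  have hx0 : 0 < x := by positivity
  set G := (2 / x) ^ r with hG
  have hG0 : 0 < G := by positivity
  set b : ℝ := 2 ^ (-(r - 1)) with hb
  have hb0 : 0 < b := chainRatio_pos _
  have hb1 : b < 1 := chainRatio_lt_one (by linarith)
  have h1b : 0 < 1 - b := by linarith
  set T := c * (C * (G + G ^ 2)) * (1 - b)⁻¹ with hT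
  have hT0 : 0 < T := by positivity
  clear_value T b G x c C
  refine ⟨min 1 (c / (2 * T)), lt_min one_pos (by positivity), ?_⟩
  intro Ω _ μ _ ψ K X hK hψ hX
  have hK0 := hψ.K_nonneg
  have hK1 : K ≤ 1 := hK.trans (min_le_left _ _)
  have hKT : 2 * K * T ≤ c := by
    have := (le_div_iff₀ (by positivity)).1 (hK.trans (min_le_right _ _))
    linarith
  have hlevel : ∀ k : ℕ, ENNReal.ofReal (c * 2 ^ k) * μ {ω | ENNReal.ofReal (c * 2 ^ k) < dyadicSup X ω}
      ≤ ENNReal.ofReal (c * (C * ((2 * K) * (G + G ^ 2))) * b ^ k) := by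
    intro k
    have h1 := measure_dyadicSup_gt_le hp hp1 hr.le hY hψ hX (by positivity : 0 < x * 2 ^ k)
    have h2 : 2 * (x * 2 ^ k / (1 - θ)) = c * 2 ^ k := by
      rw [hx]
      field_simp
    rw [← hθ, h2] at h1
    refine (mul_le_mul' le_rfl h1).trans ?_
    rw [← ENNReal.ofReal_mul (by positivity)]
    apply ENNReal.ofReal_le_ofReal
    set w : ℝ := ((2 : ℝ) ^ (-r)) ^ k with hw
    have hw0 : 0 < w := by positivity
    have hw1 : w ≤ 1 := pow_le_one₀ (by positivity) (chainRatio_lt_one (by linarith)).le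
    have h3 : (2 / (x * 2 ^ k)) ^ r = G * w := by
      rw [← div_div, Real.div_rpow (by positivity) (by positivity), ← hG, hw, ← Real.rpow_natCast,
        ← Real.rpow_natCast, ← Real.rpow_mul two_pos.le, ← Real.rpow_mul two_pos.le, div_eq_mul_inv,
        ← Real.rpow_neg two_pos.le]
      congr 2
      ring
    have h4 : (2 : ℝ) ^ k * w = b ^ k := by
      rw [hw, hb, ← mul_pow]
      congr 1
      rw [show -(r - 1) = 1 + -r by ring, Real.rpow_add two_pos, Real.rpow_one]
    rw [h3]
    have h5 : G * w + (G * w) ^ 2 ≤ (G + G ^ 2) * w := by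
      have : w ^ 2 ≤ w := by nlinarith
      nlinarith [mul_le_mul_of_nonneg_left this (sq_nonneg G)]
    have h6 : K + K ^ 2 ≤ 2 * K := by nlinarith
    have h7 : (K + K ^ 2) * (G * w + (G * w) ^ 2) ≤ (2 * K) * ((G + G ^ 2) * w) :=
      mul_le_mul h6 h5 (by positivity) (by positivity)
    have h8 : (2 * M + 4 * (M ^ 2 + 3 * M) * (1 - d)⁻¹) * ((K + K ^ 2)
          * (G * w + (G * w) ^ 2)) * (1 - (2 : ℝ) ^ (-(d / 2)))⁻¹
        = C * ((K + K ^ 2) * (G * w + (G * w) ^ 2)) := by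
      rw [hC]
      ring
    rw [h8]
    clear_value w
    calc c * 2 ^ k * (C * ((K + K ^ 2) * (G * w + (G * w) ^ 2)))
          ≤ c * 2 ^ k * (C * ((2 * K) * ((G + G ^ 2) * w))) :=
          mul_le_mul_of_nonneg_left (mul_le_mul_of_nonneg_left h7 hC0.le) (by positivity)
      _ = c * (C * ((2 * K) * (G + G ^ 2))) * (2 ^ k * w) := by ring
      _ = _ := by rw [h4]
  have hs := (summable_geometric_of_lt_one hb0.le hb1).mul_left (c * (C * ((2 * K) * (G + G ^ 2))))
  calc ∫⁻ ω, dyadicSup X ω ∂μ ≤ ENNReal.ofReal c + ∑' k : ℕ, ENNReal.ofReal (c * 2 ^ k)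
          * μ {ω | ENNReal.ofReal (c * 2 ^ k) < dyadicSup X ω} :=
        lintegral_le_tsum_dyadic_levels (measurable_dyadicSup hX.measurable) hc0
    _ ≤ ENNReal.ofReal c + ∑' k : ℕ, ENNReal.ofReal (c * (C * ((2 * K) * (G + G ^ 2))) * b ^ k) :=
        add_le_add le_rfl (ENNReal.tsum_le_tsum hlevel)
    _ = ENNReal.ofReal c + ENNReal.ofReal (2 * K * T) := by
        rw [← ENNReal.ofReal_tsum_of_nonneg (fun k => by positivity) hs, tsum_mul_left,
          tsum_geometric_of_lt_one hb0.le hb1, hT]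
        congr 2
        ring
    _ ≤ ENNReal.ofReal c + ENNReal.ofReal c := by
        gcongr
    _ = ENNReal.ofReal η := by
        rw [← ENNReal.ofReal_add hc0.le hc0.le, hc]
        congr 1
        ring

end Supremum

/-- For a path with right limits, the supremum over an interval is approached along dyadic times. -/
lemma iSup_enorm_le_dyadicSup {Ω : Type*} {X : ℝ≥0 → Ω → ℝ} {ω : Ω} {t : ℝ≥0} (ht : 0 < t)
    (hrc : IsRcll fun s => X s ω) :
    ⨆ s ∈ Set.Iic t, ‖X s ω‖ₑ ≤ dyadicSup (fun s => X (t * s)) ω := by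
  refine iSup₂_le fun s hs => ?_
  rcases eq_or_lt_of_le (Set.mem_Iic.1 hs) with rfl | hst
  · have h1 : (1 : ℝ≥0) ∈ dyadics ∩ Set.Ioc 0 1 := ⟨⟨0, 1, by simp [dyadic]⟩, by simp⟩
    have h2 := le_iSup₂_of_le (f := fun y (_ : y ∈ dyadics ∩ Set.Ioc (0 : ℝ≥0) 1) => ‖X (s * y) ω‖ₑ)
      1 h1 le_rfl
    simpa [dyadicSup] using h2
  · set u := s / t with hu
    have hu1 : u < 1 := (div_lt_one ht).2 hst
    have htu : t * u = s := by
      rw [hu]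
      field_simp
    have h1 : Tendsto (dyadicAfter u) atTop (𝓝 u) :=
      (tendsto_dyadicAfter u).mono_right nhdsWithin_le_nhds
    have h2 : Tendsto (fun n => t * dyadicAfter u n) atTop (𝓝[≥] s) := by
      refine tendsto_nhdsWithin_iff.2 ⟨?_, Eventually.of_forall fun n => ?_⟩
      · rw [← htu]
        exact h1.const_mul t
      · rw [← htu]
        exact mul_le_mul' le_rfl (lt_dyadicAfter u n).le
    have h3 : Tendsto (fun n => ‖X (t * dyadicAfter u n) ω‖ₑ) atTop (𝓝 ‖X s ω‖ₑ) :=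
      (((hrc s).1.tendsto).comp h2).enorm
    refine le_of_tendsto h3 ?_
    filter_upwards [h1.eventually_lt_const hu1] with n hn
    have hmem : dyadicAfter u n ∈ dyadics ∩ Set.Ioc 0 1 :=
      ⟨⟨n, _, rfl⟩, bot_le.trans_lt (lt_dyadicAfter u n), hn.le⟩
    exact le_iSup₂_of_le (f := fun y (_ : y ∈ dyadics ∩ Set.Ioc (0 : ℝ≥0) 1) => ‖X (t * y) ω‖ₑ)
      _ hmem le_rfl

/-! ### The characteristic exponent -/

lemma norm_exp_I_sub_one_sub_le {r : ℝ} (hr1 : 1 ≤ r) (hr2 : r ≤ 2) (y : ℝ) :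
    ‖Complex.exp (Complex.I * y) - 1 - Complex.I * y‖ ≤ 2 * |y| ^ r := by
  have hn : ‖Complex.I * (y : ℂ)‖ = |y| := by simp
  rcases le_total |y| 1 with hy | hy
  · have h1 := Complex.norm_exp_sub_one_sub_id_le (x := Complex.I * y) (by rwa [hn])
    rw [hn] at h1
    rcases eq_or_ne y 0 with rfl | hy0
    · simp
      positivity
    have h2 : |y| ^ (2 : ℝ) ≤ |y| ^ r :=
      Real.rpow_le_rpow_of_exponent_ge (abs_pos.2 hy0) hy hr2
    rw [Real.rpow_two] at h2
    have : 0 ≤ |y| ^ r := by positivity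
    linarith
  · have h1 : ‖Complex.exp (Complex.I * y) - 1‖ ≤ |y| := by
      simpa using Real.norm_exp_I_mul_ofReal_sub_one_le (x := y)
    have h2 : |y| ≤ |y| ^ r := Real.self_le_rpow_of_one_le hy hr1
    refine (norm_sub_le _ _).trans ?_
    rw [hn]
    linarith

lemma norm_exp_I_sub_one_le_two (y : ℝ) : ‖Complex.exp (Complex.I * y) - 1‖ ≤ 2 := by
  refine (norm_sub_le _ _).trans ?_
  rw [mul_comm, Complex.norm_exp_ofReal_mul_I]
  norm_num

lemma levyExponent_zero (a q : ℝ) (Λ : Measure ℝ) : levyExponent a q Λ 0 = 0 := by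
  simp [levyExponent, Set.indicator]

/-- The integral in the Lévy–Khintchine formula is bounded by means of the absolute moment of order
`r` of the small jumps and the total mass of the large jumps. -/
lemma norm_integral_levy_le {r : ℝ} (hr1 : 1 ≤ r) (hr2 : r ≤ 2) {Λ : Measure ℝ}
    (hsmall : ∫⁻ x in Set.Icc (-1 : ℝ) 1, ENNReal.ofReal (|x| ^ r) ∂Λ < ∞)
    (hlarge : Λ (Set.Icc (-1 : ℝ) 1)ᶜ < ∞) (l : ℝ) :
    ‖∫ x : ℝ, (Complex.exp (Complex.I * l * x) - 1
        - Set.indicator {y : ℝ | |y| ≤ 1} (fun y : ℝ => Complex.I * y * l) x) ∂Λ‖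
      ≤ 2 * (∫⁻ x in Set.Icc (-1 : ℝ) 1, ENNReal.ofReal (|x| ^ r) ∂Λ).toReal * |l| ^ r
        + 2 * (Λ (Set.Icc (-1 : ℝ) 1)ᶜ).toReal := by
  set A := ∫⁻ x in Set.Icc (-1 : ℝ) 1, ENNReal.ofReal (|x| ^ r) ∂Λ with hA
  set B := Λ (Set.Icc (-1 : ℝ) 1)ᶜ with hB
  refine (norm_integral_le_lintegral_norm _).trans (ENNReal.toReal_le_of_le_ofReal (by positivity) ?_)
  have hpt : ∀ x : ℝ, ENNReal.ofReal ‖Complex.exp (Complex.I * l * x) - 1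
        - Set.indicator {y : ℝ | |y| ≤ 1} (fun y : ℝ => Complex.I * y * l) x‖
      ≤ (Set.Icc (-1 : ℝ) 1).indicator
          (fun x => ENNReal.ofReal (2 * |l| ^ r) * ENNReal.ofReal (|x| ^ r)) x
        + (Set.Icc (-1 : ℝ) 1)ᶜ.indicator (fun _ => 2) x := by
    intro x
    have e1 : Complex.I * l * x = Complex.I * ((l * x : ℝ) : ℂ) := by
      push_cast
      ring
    by_cases hx : x ∈ Set.Icc (-1 : ℝ) 1
    · have hx' : x ∈ {y : ℝ | |y| ≤ 1} := abs_le.2 hx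
      rw [Set.indicator_of_mem hx', Set.indicator_of_mem hx,
        Set.indicator_of_notMem (Set.notMem_compl_iff.2 hx), add_zero,
        ← ENNReal.ofReal_mul (by positivity)]
      apply ENNReal.ofReal_le_ofReal
      have h1 := norm_exp_I_sub_one_sub_le hr1 hr2 (l * x)
      rw [abs_mul, Real.mul_rpow (abs_nonneg _) (abs_nonneg _), ← mul_assoc] at h1
      rw [show Complex.I * x * l = Complex.I * ((l * x : ℝ) : ℂ) by
        push_cast
        ring, e1]
      exact h1
    · have hx' : x ∉ {y : ℝ | |y| ≤ 1} := fun h => hx (abs_le.1 h)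
      rw [Set.indicator_of_notMem hx', Set.indicator_of_notMem hx,
        Set.indicator_of_mem (Set.mem_compl hx), zero_add, sub_zero, e1]
      refine (ENNReal.ofReal_le_ofReal (norm_exp_I_sub_one_le_two _)).trans (by simp)
  refine (lintegral_mono hpt).trans (le_of_eq ?_)
  rw [lintegral_add_right _ (measurable_const.indicator measurableSet_Icc.compl),
    lintegral_indicator measurableSet_Icc, lintegral_const_mul' _ _ ENNReal.ofReal_ne_top,
    lintegral_indicator measurableSet_Icc.compl, setLIntegral_const, ← hA, ← hB,
    ENNReal.ofReal_add (by positivity) (by positivity), mul_right_comm,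
    ENNReal.ofReal_mul (by positivity : (0 : ℝ) ≤ 2 * |l| ^ r), ENNReal.ofReal_toReal hsmall.ne,
    ENNReal.ofReal_mul (p := 2) (q := (Λ (Set.Icc (-1 : ℝ) 1)ᶜ).toReal) two_pos.le,
    ENNReal.ofReal_toReal hlarge.ne]
  simp

lemma IsLevyMeasure.lintegral_sq_lt_top {Λ : Measure ℝ} (hΛ : IsLevyMeasure Λ) :
    ∫⁻ x in Set.Icc (-1 : ℝ) 1, ENNReal.ofReal (|x| ^ (2 : ℝ)) ∂Λ < ∞ := by
  refine lt_of_le_of_lt ?_ hΛ.integrable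
  refine le_trans (le_of_eq (setLIntegral_congr_fun measurableSet_Icc fun x hx => ?_))
    (setLIntegral_le_lintegral _ _)
  have h1 : x ^ 2 ≤ 1 := by
    rw [sq_le_one_iff_abs_le_one]
    exact abs_le.2 hx
  simp only [Real.rpow_two, sq_abs, min_eq_right h1]

lemma IsLevyMeasure.measure_compl_Icc_lt_top {Λ : Measure ℝ} (hΛ : IsLevyMeasure Λ) :
    Λ (Set.Icc (-1 : ℝ) 1)ᶜ < ∞ := by
  refine lt_of_le_of_lt ?_ hΛ.integrable
  rw [← lintegral_indicator_one measurableSet_Icc.compl]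
  refine lintegral_mono fun x => ?_
  by_cases hx : x ∈ (Set.Icc (-1 : ℝ) 1)ᶜ
  · have h1 : 1 ≤ x ^ 2 := by
      rw [one_le_sq_iff_one_le_abs]
      by_contra hcon
      exact hx (abs_le.1 (not_le.1 hcon).le)
    rw [Set.indicator_of_mem hx, min_eq_left h1]
    simp
  · rw [Set.indicator_of_notMem hx]
    exact bot_le

/-- Admissibility leaves room for an exponent `r ∈ (1, 1/p)` with `r ≤ 2` such that the small jumps
have a finite absolute moment of order `r`; and `r = 2` if there is a Brownian component. -/
lemma IsAdmissible.exists_exponent {q : ℝ} {Λ : Measure ℝ} {p : ℝ} (hp : IsAdmissible q Λ p)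
    (hΛ : IsLevyMeasure Λ) : ∃ r, 1 < r ∧ r ≤ 2 ∧ r < p⁻¹ ∧ (q ≠ 0 → r = 2) ∧
      ∫⁻ x in Set.Icc (-1 : ℝ) 1, ENNReal.ofReal (|x| ^ r) ∂Λ < ∞ := by
  have hp0 := hp.pos
  have hp1 : 1 < p⁻¹ := (one_lt_inv₀ hp.pos).2 hp.lt_one
  by_cases h2 : 2 < p⁻¹
  · exact ⟨2, by norm_num, le_rfl, h2, fun _ => rfl, hΛ.lintegral_sq_lt_top⟩
  have hindex : bgIndex q Λ < p⁻¹ := by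
    rw [← one_div, lt_div_iff₀' hp0]
    exact hp.mul_lt_one
  have hq : q = 0 := by
    by_contra hq
    rw [bgIndex, if_neg hq] at hindex
    exact h2 hindex
  rw [bgIndex, if_pos hq, bgIndexMeasure] at hindex
  have hne : {r : ℝ | 0 < r ∧
      ∫⁻ x in Set.Icc (-1 : ℝ) 1, ENNReal.ofReal (|x| ^ r) ∂Λ < ∞}.Nonempty :=
    ⟨2, by norm_num, hΛ.lintegral_sq_lt_top⟩
  obtain ⟨r, ⟨hr0, hr⟩, hrp⟩ := exists_lt_of_csInf_lt hne hindex
  refine ⟨max r ((1 + p⁻¹) / 2), lt_max_of_lt_right (by linarith), max_le (by linarith) (by linarith),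
    max_lt hrp (by linarith), fun h => absurd hq h, lt_of_le_of_lt ?_ hr⟩
  refine setLIntegral_mono' measurableSet_Icc fun x hx => ENNReal.ofReal_le_ofReal ?_
  rcases eq_or_ne x 0 with rfl | hx0
  · rw [abs_zero, Real.zero_rpow hr0.ne', Real.zero_rpow (lt_max_of_lt_left hr0).ne']
  · exact Real.rpow_le_rpow_of_exponent_ge (abs_pos.2 hx0) (abs_le.2 hx) (le_max_left _ _)

lemma exists_exponentBound_levyExponent (a : ℝ) {q : ℝ} {Λ : Measure ℝ} (hΛ : IsLevyMeasure Λ) {r : ℝ}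
    (hr1 : 1 ≤ r) (hr2 : r ≤ 2) (hq : q ≠ 0 → r = 2)
    (hsmall : ∫⁻ x in Set.Icc (-1 : ℝ) 1, ENNReal.ofReal (|x| ^ r) ∂Λ < ∞) :
    ∃ K, ExponentBound (levyExponent a q Λ) r K 1 := by
  set A := (∫⁻ x in Set.Icc (-1 : ℝ) 1, ENNReal.ofReal (|x| ^ r) ∂Λ).toReal with hA
  set B := (Λ (Set.Icc (-1 : ℝ) 1)ᶜ).toReal with hB
  have hA0 : 0 ≤ A := ENNReal.toReal_nonneg
  have hB0 : 0 ≤ B := ENNReal.toReal_nonneg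
  refine ⟨|a| + q ^ 2 / 2 + 2 * A + 2 * B, by positivity, zero_le_one, levyExponent_zero a q Λ,
    fun l => ?_⟩
  have h1 := norm_integral_levy_le hr1 hr2 hsmall hΛ.measure_compl_Icc_lt_top l
  rw [← hA, ← hB] at h1
  set w := |l| ^ r with hw
  have hw0 : 0 ≤ w := by positivity
  have h2 : ‖Complex.I * a * l‖ ≤ |a| * (w + 1) := by
    rw [norm_mul, norm_mul, Complex.norm_I, one_mul, Complex.norm_real, Complex.norm_real,
      Real.norm_eq_abs, Real.norm_eq_abs]
    refine mul_le_mul_of_nonneg_left ?_ (abs_nonneg _)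
    rcases le_total |l| 1 with h | h
    · linarith
    · linarith [Real.self_le_rpow_of_one_le h hr1]
  have h3 : ‖(q : ℂ) ^ 2 / 2 * (l : ℂ) ^ 2‖ ≤ q ^ 2 / 2 * (w + 1) := by
    have e : (q : ℂ) ^ 2 / 2 * (l : ℂ) ^ 2 = ((q ^ 2 / 2 * l ^ 2 : ℝ) : ℂ) := by
      push_cast
      ring
    rw [e, Complex.norm_real, Real.norm_of_nonneg (by positivity)]
    by_cases hq0 : q = 0
    · simp [hq0]
    · rw [hw, hq hq0, Real.rpow_two, sq_abs]
      nlinarith [sq_nonneg q]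
  unfold levyExponent
  refine (norm_add_le _ _).trans ?_
  have h4 := norm_sub_le (Complex.I * a * l) ((q : ℂ) ^ 2 / 2 * (l : ℂ) ^ 2)
  nlinarith [mul_nonneg hB0 hw0]

/-- The exponent of the jumps smaller than `ε` has no contribution of large jumps, and a constant
that tends to `0` with `ε`. -/
lemma exponentBound_levyExponent_restrict {Λ : Measure ℝ} {r : ℝ} (hr1 : 1 ≤ r) (hr2 : r ≤ 2)
    {ε : ℝ} (hε : ε < 1)
    (hsmall : ∫⁻ x in {x | |x| < ε}, ENNReal.ofReal (|x| ^ r) ∂Λ < ∞) :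
    ExponentBound (levyExponent 0 0 (Λ.restrict {x | |x| < ε})) r
      (2 * (∫⁻ x in {x | |x| < ε}, ENNReal.ofReal (|x| ^ r) ∂Λ).toReal) 0 := by
  refine ⟨by positivity, le_rfl, levyExponent_zero _ _ _, fun l => ?_⟩
  have hsub : {x : ℝ | |x| < ε} ⊆ Set.Icc (-1 : ℝ) 1 := fun x hx => abs_le.1 (le_of_lt (lt_trans hx hε))
  have e1 : (Λ.restrict {x | |x| < ε}) (Set.Icc (-1 : ℝ) 1)ᶜ = 0 := by
    rw [Measure.restrict_apply measurableSet_Icc.compl]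
    convert! measure_empty (μ := Λ)
    ext x
    simp only [Set.mem_inter_iff, Set.mem_compl_iff, Set.mem_empty_iff_false, iff_false, not_and]
    exact fun h1 h2 => h1 (hsub h2)
  have e2 : ∫⁻ x in Set.Icc (-1 : ℝ) 1, ENNReal.ofReal (|x| ^ r) ∂(Λ.restrict {x | |x| < ε})
      = ∫⁻ x in {x | |x| < ε}, ENNReal.ofReal (|x| ^ r) ∂Λ := by
    rw [Measure.restrict_restrict measurableSet_Icc, Set.inter_eq_right.2 hsub]
  have h1 := norm_integral_levy_le (Λ := Λ.restrict {x | |x| < ε}) hr1 hr2 (by rwa [e2]) (by simp [e1]) l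
  rw [e1, e2] at h1
  unfold levyExponent
  simpa using h1

lemma tendsto_lintegral_small_jumps {Λ : Measure ℝ} {r : ℝ} (hr : 0 < r)
    (hsmall : ∫⁻ x in Set.Icc (-1 : ℝ) 1, ENNReal.ofReal (|x| ^ r) ∂Λ < ∞) :
    Tendsto (fun ε : ℝ => ∫⁻ x in {x | |x| < ε}, ENNReal.ofReal (|x| ^ r) ∂Λ) (𝓝[>] 0) (𝓝 0) := by
  have hset : ∀ ε : ℝ, MeasurableSet {x : ℝ | |x| < ε} := fun ε =>
    measurableSet_lt (by fun_prop) measurable_const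
  have h1 := tendsto_lintegral_filter_of_dominated_convergence (μ := Λ) (l := 𝓝[>] (0 : ℝ))
    (F := fun ε => {x : ℝ | |x| < ε}.indicator fun x => ENNReal.ofReal (|x| ^ r)) (f := fun _ => 0)
    ((Set.Icc (-1 : ℝ) 1).indicator fun x => ENNReal.ofReal (|x| ^ r))
    (Eventually.of_forall fun ε => Measurable.indicator (by fun_prop) (hset ε))
    (by
      filter_upwards [Ioo_mem_nhdsGT one_pos] with ε hε
      refine ae_of_all _ fun x => Set.indicator_le_indicator_of_subset (fun x hx =>
        abs_le.1 (le_of_lt (lt_trans hx hε.2))) (fun _ => bot_le) x)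
    (by
      rw [lintegral_indicator measurableSet_Icc]
      exact hsmall.ne)
    (ae_of_all _ fun x => by
      rcases eq_or_ne x 0 with rfl | hx
      · refine tendsto_const_nhds.congr fun ε => ?_
        simp [Set.indicator, Real.zero_rpow hr.ne']
      · refine tendsto_const_nhds.congr' ?_
        filter_upwards [Ioo_mem_nhdsGT (abs_pos.2 hx)] with ε hε
        rw [Set.indicator_of_notMem]
        exact not_lt.2 hε.2.le)
  simp only [lintegral_zero] at h1
  refine h1.congr fun ε => ?_
  rw [lintegral_indicator (hset ε)]

/-- A change of the time unit multiplies the exponent of a noise reinforced Lévy process. -/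
lemma IsNRLP.hasYuleSimonExponent {Ω : Type*} [MeasurableSpace Ω] {μ : Measure Ω} {a q : ℝ}
    {Λ : Measure ℝ} {p : ℝ} {X : ℝ≥0 → Ω → ℝ} (hX : IsNRLP a q Λ p X μ) {c : ℝ≥0} (hc : 0 < c) :
    HasYuleSimonExponent p (fun l => (((1 - p) * c : ℝ) : ℂ) * levyExponent a q Λ l)
      (fun s => X (c * s)) μ := by
  refine ⟨fun t => hX.measurable _, fun k s l t hs hs0 hst => ?_⟩
  have h := hX.fdd k (fun i => c * s i) l (c * t) (fun i j hij => mul_lt_mul_of_pos_left (hs hij) hc)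
    (fun i => mul_pos hc (hs0 i)) (fun i => mul_le_mul' le_rfl (hst i))
  have hc' : (c : ℝ) ≠ 0 := by exact_mod_cast hc.ne'
  have e : ∀ i, ((c * s i : ℝ≥0) : ℝ) / ((c * t : ℝ≥0) : ℝ) = (s i : ℝ) / t := by
    intro i
    push_cast
    rw [mul_div_mul_left _ _ hc']
  simp_rw [e] at h
  rw [h, integral_const_mul]
  congr 1
  push_cast
  ring

lemma ExponentBound.const_mul {ψ : ℝ → ℂ} {r K κ : ℝ} (hψ : ExponentBound ψ r K κ) {c : ℝ}
    (hc : 0 ≤ c) : ExponentBound (fun l => (c : ℂ) * ψ l) r (c * K) κ := by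
  refine ⟨mul_nonneg hc hψ.K_nonneg, hψ.κ_nonneg, by simp [hψ.map_zero], fun l => ?_⟩
  rw [norm_mul, Complex.norm_real, Real.norm_of_nonneg hc, mul_assoc]
  exact mul_le_mul_of_nonneg_left (hψ.norm_le l) hc

theorem mainTheorem2 (a q : ℝ) (Λ : Measure ℝ) (hΛ : IsLevyMeasure Λ) (p : ℝ)
    (hp : IsAdmissible q Λ p) :
    -- every noise reinforced Lévy process has an rcll modification
    (∀ (Ω : Type*) [MeasurableSpace Ω] (μ : Measure Ω) [IsProbabilityMeasure μ]
        (X : ℝ≥0 → Ω → ℝ), IsNRLP a q Λ p X μ →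
        ∃ X' : ℝ≥0 → Ω → ℝ, (∀ t, Measurable (X' t)) ∧ (∀ t, X' t =ᵐ[μ] X t) ∧
          ∀ ω, IsRcll (fun t => X' t ω)) ∧
    -- the contribution of the jumps smaller than `ε` vanishes locally uniformly in mean
    (∀ (Ω : ℝ → Type*) [∀ ε, MeasurableSpace (Ω ε)] (μ : ∀ ε, Measure (Ω ε))
        [∀ ε, IsProbabilityMeasure (μ ε)] (X : ∀ ε, ℝ≥0 → Ω ε → ℝ),
        (∀ ε ∈ Set.Ioo (0 : ℝ) 1, IsNRLP 0 0 (Λ.restrict {x | |x| < ε}) p (X ε) (μ ε) ∧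
          ∀ᵐ ω ∂(μ ε), IsRcll (fun t => X ε t ω)) →
        ∀ t : ℝ≥0, 0 < t →
          Tendsto (fun ε => ∫⁻ ω, ⨆ s ∈ Set.Iic t, ‖X ε s ω‖ₑ ∂(μ ε)) (𝓝[>] 0) (𝓝 0)) := by
  have hp0 := hp.pos
  have hp1 := hp.lt_one
  have h1p : 0 < 1 - p := by linarith
  obtain ⟨r, hr1, hr2, hrp, hrq, hsmall⟩ := hp.exists_exponent hΛ
  obtain ⟨d, M, hY⟩ := exists_yuleSimonBound hp0 hp1 hr1.le hrp
  constructor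
  · intro Ω _ μ _ X hX
    obtain ⟨K, hK⟩ := exists_exponentBound_levyExponent a hΛ hr1.le hr2 hrq hsmall
    refine exists_rcll_modification hp0 hp1 hr1.le hY
      (fun j => hK.const_mul (c := (1 - p) * ((2 ^ j : ℝ≥0) : ℝ)) (by positivity))
      (fun j => hX.hasYuleSimonExponent (c := 2 ^ j) (by positivity)) hX.zero
  · intro Ω _ μ _ X hX t ht
    rw [ENNReal.tendsto_nhds_zero]
    intro η hη
    obtain ⟨η', hη'0, hη'⟩ := ENNReal.lt_iff_exists_real_btwn.1 hη
    have hη'pos : 0 < η' := ENNReal.ofReal_pos.1 hη'.1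
    obtain ⟨K₀, hK₀, H⟩ := exists_lintegral_dyadicSup_le hp0 hp1 hr1 hY hη'pos
    have hlim := tendsto_lintegral_small_jumps (by linarith : 0 < r) hsmall
    have hc0 : 0 < (1 - p) * (t : ℝ) := mul_pos h1p (by exact_mod_cast ht)
    have hsmall' := hlim.eventually_lt_const
      (ENNReal.ofReal_pos.2 (by positivity : 0 < K₀ / (2 * ((1 - p) * t))))
    filter_upwards [hsmall', Ioo_mem_nhdsGT (one_pos (α := ℝ))] with ε hεJ hε
    obtain ⟨hN, hrc⟩ := hX ε hε
    have hb := (exponentBound_levyExponent_restrict hr1.le hr2 hε.2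
      (hεJ.trans ENNReal.ofReal_lt_top)).const_mul hc0.le
    set J := ∫⁻ x in {x | |x| < ε}, ENNReal.ofReal (|x| ^ r) ∂Λ with hJ
    have hJle : J.toReal ≤ K₀ / (2 * ((1 - p) * t)) :=
      ENNReal.toReal_le_of_le_ofReal (by positivity) hεJ.le
    have hK : (1 - p) * t * (2 * J.toReal) ≤ K₀ := by
      rw [le_div_iff₀ (by positivity)] at hJle
      linarith
    calc ∫⁻ ω, ⨆ s ∈ Set.Iic t, ‖X ε s ω‖ₑ ∂(μ ε)
        ≤ ∫⁻ ω, dyadicSup (fun s => X ε (t * s)) ω ∂(μ ε) := by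
          apply lintegral_mono_ae
          filter_upwards [hrc] with ω hω
          exact iSup_enorm_le_dyadicSup ht hω
      _ ≤ ENNReal.ofReal η' := H hK hb (hN.hasYuleSimonExponent ht)
      _ ≤ η := hη'.2.le
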